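/- Let $R$ be a commutative ring and $n \ge 0$. A $\pm$-vector in $R^n$ is a set $\pm v = \{v,-v\}$ with $v \in R^n$ nonzero. A determinant-$1$ partial $\pm$-basis for $R^n$ is a set $\{\pm v_1,\dots,\pm v_k\}$ of $\pm$-vectors such that $\{v_1,\dots,v_k\}$ is a subset of a free basis of $R^n$ and, if $k=n$, $\det(v_1\ \cdots\ v_n) = \pm 1$. An augmented determinant-$1$ partial $\pm$-basis is a set $\{\pm v_0,\pm v_1,\dots,\pm v_k\}$ such that $\{\pm v_1,\dots,\pm v_k\}$ is a determinant-$1$ partial $\pm$-basis and $v_0 = \lambda v_1 + \nu v_2$ for some $\lambda,\nu \in \{1,-1\}$. Let $BDA^{\pm}_n(R)$ be the simplicial complex whose simplices are the nonempty sets of these two kinds. **Lemma 2.10.** For a prime $p \ge 3$, the geometric realization of $BDA^{\pm}_2(\mathbb{F}_p)$ is homeomorphic to a closed (compact, connected) oriented surface of genus $\frac{(p+2)(p-3)(p-5)}{24}$. More precisely, it is homeomorphic to the (compactified) level-$p$ modular curve $\Gamma(p)\backslash(\mathbb{H}^2 \cup \mathbb{Q} \cup \{\infty\})$, where $\Gamma(p)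 = \ker(\mathrm{SL}_2(\mathbb{Z}) \to \mathrm{SL}_2(\mathbb{F}_p))$ and where $\mathbb{H}^2 \cup \mathbb{Q} \cup \{\infty\}$ carries the topology in which $\mathbb{H}^2$ is open with its usual topology and the open horoballs centered at a point of $\mathbb{Q} \cup \{\infty\}$, together with that point, form a neighbourhood basis of it. Also, the geometric realization of $BDA^{\pm}_2(\mathbb{F}_2)$ is contractible. -/

import Mathlib

open scoped MatrixGroups UpperHalfPlane

noncomputable section

/-! ## Geometric realization of simplicial complexes -/

/-- The underlying set of the geometric realization of a simplicial complex: finitely supported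
families of barycentric coordinates whose support is a simplex. -/
def Realization {ι : Type*} (K : PreAbstractSimplicialComplex ι) : Type _ :=
  {x : ι →₀ ℝ // x.support ∈ K.faces ∧ (∀ i, 0 ≤ x i) ∧ x.sum (fun _ t => t) = 1}

/-- The inclusion of the closed geometric simplex spanned by a face `s`. -/
def Realization.faceMap {ι : Type*} (K : PreAbstractSimplicialComplex ι) (s : Finset ι)
    (hs : s ∈ K.faces) (y : stdSimplex ℝ s) : Realization K :=
  ⟨Finsupp.embDomain (Function.Embedding.subtype (· ∈ s)) (Finsupp.equivFunOnFinite.symm y.1), by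
    refine ⟨?_, ?_, ?_⟩
    · refine (K.isRelLowerSet_faces hs).2 ?_ ?_
      · intro i hi
        rw [Finsupp.support_embDomain, Finset.mem_map] at hi
        obtain ⟨j, -, rfl⟩ := hi
        exact j.2
      · rw [Finsupp.support_embDomain, Finset.map_nonempty, Finset.nonempty_iff_ne_empty, Ne,
          Finsupp.support_eq_empty]
        intro h
        have h0 : ∀ i, y.1 i = 0 := fun i => DFunLike.congr_fun h i
        have h1 := y.2.2
        simp [h0] at h1
    · intro i
      by_cases hi : i ∈ s
      · exact (Finsupp.embDomain_apply_self (Function.Embedding.subtype (· ∈ s))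
          (Finsupp.equivFunOnFinite.symm y.1) ⟨i, hi⟩).symm ▸ y.2.1 ⟨i, hi⟩
      · rw [Finsupp.embDomain_of_notMem_range]
        rintro ⟨j, rfl⟩
        exact hi j.2
    · rw [Finsupp.sum_embDomain, Finsupp.sum_fintype _ _ (fun _ => rfl)]
      exact y.2.2⟩

/-- The weak topology: a set is open iff its intersection with every closed simplex is open. -/
instance {ι : Type*} (K : PreAbstractSimplicialComplex ι) : TopologicalSpace (Realization K) :=
  ⨆ s : {s : Finset ι // s ∈ K.faces},
    TopologicalSpace.coinduced (Realization.faceMap K s.1 s.2) inferInstance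

/-! ## Closed oriented surfaces -/

/-- `a`, `b`, `c` are the three vertices of a 2-simplex of `K`. -/
def IsTriangle {ι : Type*} (K : PreAbstractSimplicialComplex ι) (a b c : ι) : Prop :=
  a ≠ b ∧ b ≠ c ∧ a ≠ c ∧ ∃ s ∈ K.faces, (s : Set ι) = {a, b, c}

/-- A coherent orientation of the 2-simplices of `K`. Here `ω a b c` says that the ordering
`(a, b, c)` of the vertices of a 2-simplex is positive. Two distinct 2-simplices with a common
edge induce opposite orientations on it. -/
structure IsCoherentOrientation {ι : Type*} (K : PreAbstractSimplicialComplex ι)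
    (ω : ι → ι → ι → Prop) : Prop where
  cyclic : ∀ a b c, IsTriangle K a b c → ω a b c → ω b c a
  alternating : ∀ a b c, IsTriangle K a b c → (ω b a c ↔ ¬ ω a b c)
  coherent : ∀ a b c d, IsTriangle K a b c → IsTriangle K a b d → c ≠ d → ω a b c → ω b a d

/-- The Euler characteristic `∑ (-1)^(dim s)` of a complex with finitely many simplices `s`;
note that `dim s = card s - 1`. -/
def eulerChar {ι : Type*} (K : PreAbstractSimplicialComplex ι) : ℤ :=
  ∑ᶠ s ∈ K.faces, (-1 : ℤ) ^ (s.card + 1)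

/-- `X` is a closed (i.e. compact without boundary) connected orientable topological surface of
genus `g`. Orientability and the genus, defined by `χ = 2 - 2g`, are read off from a finite
triangulation of `X`. -/
structure IsClosedOrientedSurface (g : ℕ) (X : Type*) [TopologicalSpace X] : Prop where
  compact : CompactSpace X
  connected : ConnectedSpace X
  hausdorff : T2Space X
  locallyEuclidean : ∀ x : X, ∃ e : OpenPartialHomeomorph X (EuclideanSpace ℝ (Fin 2)),
    x ∈ e.source
  oriented_genus : ∃ (ι : Type) (K : PreAbstractSimplicialComplex ι), K.faces.Finite ∧
    Nonempty (Realization K ≃ₜ X) ∧ (∃ ω, IsCoherentOrientation K ω) ∧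
    eulerChar K = 2 - 2 * (g : ℤ)

/-! ## The complex of augmented determinant-1 partial ±-bases -/

/-- The set `{v, -v}`. -/
def pmSet {n : ℕ} {R : Type*} [CommRing R] (v : Fin n → R) : Set (Fin n → R) := {v, -v}

/-- A ±-vector in `R^n`: a set `{v, -v}` with `v` nonzero. -/
def PMVector (n : ℕ) (R : Type*) [CommRing R] : Type _ :=
  {s : Set (Fin n → R) // ∃ v, v ≠ 0 ∧ s = pmSet v}

/-- A subset of a free basis of `R^n`. -/
def IsPartialBasis {n : ℕ} {R : Type*} [CommRing R] (B : Set (Fin n → R)) : Prop :=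
  ∃ b : Module.Basis (Fin n) R (Fin n → R), B ⊆ Set.range b

/-- A partial basis which, if it has `n` elements, has determinant `±1`: for every enumeration
`w` of its elements, the matrix with columns `w 0, …, w (n-1)` has determinant `1` or `-1`. -/
def IsDetOneVectors {n : ℕ} {R : Type*} [CommRing R] (B : Set (Fin n → R)) : Prop :=
  IsPartialBasis B ∧ ∀ w : Fin n → Fin n → R, Function.Injective w → Set.range w = B →
    (Matrix.of fun i j => w j i).det = 1 ∨ (Matrix.of fun i j => w j i).det = -1

/-- `s = {±v : v ∈ B}`. -/
def Represents {n : ℕ} {R : Type*} [CommRing R] (B : Set (Fin n → R))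
    (s : Finset (PMVector n R)) : Prop :=
  Subtype.val '' (s : Set (PMVector n R)) = pmSet '' B

/-- Determinant-1 partial ±-bases. -/
def IsDetOnePMBasis {n : ℕ} {R : Type*} [CommRing R] (s : Finset (PMVector n R)) : Prop :=
  ∃ B : Set (Fin n → R), IsDetOneVectors B ∧ Represents B s

/-- Augmented determinant-1 partial ±-bases `{±v₀, ±v₁, ±v₂, …}`: here `B = {v₁, v₂, …}` and
`v₀ = λ v₁ + ν v₂` with signs `λ`, `ν`. -/
def IsAugDetOnePMBasis {n : ℕ} {R : Type*} [CommRing R] (s : Finset (PMVector n R)) : Prop :=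
  ∃ (B : Set (Fin n → R)) (v₀ v₁ v₂ : Fin n → R) (l m : R), IsDetOneVectors B ∧
    v₁ ∈ B ∧ v₂ ∈ B ∧ v₁ ≠ v₂ ∧ (l = 1 ∨ l = -1) ∧ (m = 1 ∨ m = -1) ∧
    v₀ = l • v₁ + m • v₂ ∧ Represents (insert v₀ B) s

theorem IsDetOneVectors.mono {n : ℕ} {R : Type*} [CommRing R] {B C : Set (Fin n → R)}
    (hB : IsDetOneVectors B) (h : C ⊆ B) : IsDetOneVectors C := by
  obtain ⟨⟨b, hb⟩, hdet⟩ := hB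
  refine ⟨⟨b, h.trans hb⟩, fun w hw hwC => hdet w hw ?_⟩
  have hfin : (Set.range b).Finite := Set.finite_range b
  have hle : (Set.range b).ncard ≤ n := by
    have := Set.ncard_image_le (f := b) (s := Set.univ) Set.finite_univ
    simpa [Set.image_univ, Set.ncard_univ] using this
  have hCn : C.ncard = n := by
    rw [← hwC, ← Set.image_univ, Set.ncard_image_of_injective _ hw, Set.ncard_univ]
    simp
  rw [hwC]
  exact Set.eq_of_subset_of_ncard_le h
    ((Set.ncard_le_ncard hb hfin).trans (hle.trans hCn.ge)) (hfin.subset hb)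

/-- Replacing `v₁` by `±v₁ ± v₂`. -/
theorem IsDetOneVectors.exchange {n : ℕ} {R : Type*} [CommRing R] {B : Set (Fin n → R)}
    (hB : IsDetOneVectors B) {v₁ v₂ : Fin n → R} {l m : R} (h₁ : v₁ ∈ B) (h₂ : v₂ ∈ B)
    (hne : v₁ ≠ v₂) (hl : l = 1 ∨ l = -1) :
    IsDetOneVectors (insert (l • v₁ + m • v₂) (B \ {v₁})) := by
  classical
  have hlu : IsUnit l := by rcases hl with rfl | rfl <;> simp
  have key : ∀ (w : Fin n → Fin n → R) (j₁ j₂ : Fin n), j₁ ≠ j₂ → w j₂ = v₂ →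
      (Matrix.of fun i j => Function.update w j₁ (l • v₁ + m • v₂) j i).det =
        l * (Matrix.of fun i j => Function.update w j₁ v₁ j i).det := by
    intro w j₁ j₂ hj hw
    have e : ∀ u : Fin n → R, (Matrix.of fun i j => Function.update w j₁ u j i) =
        (Matrix.of fun i j => w j i).updateCol j₁ u := by
      intro u
      ext i j
      by_cases hjj : j = j₁
      · subst hjj; simp
      · simp [hjj]
    rw [e, e, Matrix.det_updateCol_add, Matrix.det_updateCol_smul, Matrix.det_updateCol_smul]
    have : ((Matrix.of fun i j => w j i).updateCol j₁ v₂).det = 0 := by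
      refine Matrix.det_zero_of_column_eq hj fun i => ?_
      simp [hj.symm, hw]
    rw [this, mul_zero, add_zero]
  obtain ⟨⟨b, hb⟩, hdet⟩ := hB
  constructor
  · obtain ⟨j₁, hj₁⟩ := hb h₁
    obtain ⟨j₂, hj₂⟩ := hb h₂
    have hj : j₁ ≠ j₂ := by rintro rfl; exact hne (hj₁.symm.trans hj₂)
    have hbas := (Module.Basis.is_basis_iff_det (Pi.basisFun R (Fin n))
      (v := Function.update b j₁ (l • v₁ + m • v₂))).2 (by
        rw [Module.Basis.det_apply]
        have e1 : ∀ w : Fin n → Fin n → R,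
            (Pi.basisFun R (Fin n)).toMatrix w = Matrix.of fun i j => w j i := by
          intro w; ext i j; simp [Module.Basis.toMatrix_apply]
        rw [e1, key b j₁ j₂ hj hj₂, ← hj₁, Function.update_eq_self, ← e1]
        have := Module.Basis.isUnit_det (Pi.basisFun R (Fin n)) b
        rw [Module.Basis.det_apply] at this
        exact hlu.mul this)
    refine ⟨Module.Basis.mk hbas.1 hbas.2.ge, ?_⟩
    rw [Module.Basis.coe_mk]
    rintro x (rfl | ⟨hx, hx1⟩)
    · exact ⟨j₁, by simp⟩
    · obtain ⟨j, rfl⟩ := hb hx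
      refine ⟨j, ?_⟩
      rw [Function.update_of_ne]
      rintro rfl
      exact hx1 hj₁
  · intro w hw hwr
    have hv₂ : v₂ ∈ insert (l • v₁ + m • v₂) (B \ {v₁}) := Or.inr ⟨h₂, fun h => hne h.symm⟩
    by_cases hmem : l • v₁ + m • v₂ ∈ B \ {v₁}
    · have hsub : Set.range w ⊆ B \ {v₁} := by
        rw [hwr, Set.insert_eq_of_mem hmem]
      have hw' := (IsDetOneVectors.mono ⟨⟨b, hb⟩, hdet⟩ (Set.sdiff_subset (s := B) (t := {v₁})))
      rw [Set.insert_eq_of_mem hmem] at hwr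
      exact hw'.2 w hw hwr
    · obtain ⟨j₁, hj₁⟩ : l • v₁ + m • v₂ ∈ Set.range w := hwr ▸ Or.inl rfl
      obtain ⟨j₂, hj₂⟩ : v₂ ∈ Set.range w := by rw [hwr]; exact hv₂
      have hj : j₁ ≠ j₂ := by
        rintro rfl
        refine hmem ?_
        rw [← hj₁, hj₂]
        exact ⟨h₂, fun h => hne h.symm⟩
      have hk := key w j₁ j₂ hj hj₂
      rw [← hj₁, Function.update_eq_self] at hk
      have hwj : ∀ j, j ≠ j₁ → w j ∈ B \ {v₁} := by
        intro j hjj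
        have : w j ∈ insert (l • v₁ + m • v₂) (B \ {v₁}) := hwr ▸ ⟨j, rfl⟩
        rcases this with h | h
        · exact absurd (hw (h.trans hj₁.symm)) hjj
        · exact h
      have := hdet (Function.update w j₁ v₁) (by
          intro i j hij
          by_cases hi : i = j₁ <;> by_cases hj' : j = j₁
          · rw [hi, hj']
          · subst hi
            rw [Function.update_self, Function.update_of_ne hj'] at hij
            exact absurd hij.symm (hwj j hj').2
          · subst hj'
            rw [Function.update_self, Function.update_of_ne hi] at hij
            exact absurd hij (hwj i hi).2
          · rw [Function.update_of_ne hi, Function.update_of_ne hj'] at hij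
            exact hw hij) (by
          ext x
          constructor
          · rintro ⟨j, rfl⟩
            by_cases hjj : j = j₁
            · subst hjj; simpa using h₁
            · rw [Function.update_of_ne hjj]; exact (hwj j hjj).1
          · intro hx
            by_cases hx1 : x = v₁
            · exact ⟨j₁, by simp [hx1]⟩
            · obtain ⟨j, rfl⟩ : x ∈ Set.range w := hwr ▸ Or.inr ⟨hx, hx1⟩
              refine ⟨j, Function.update_of_ne ?_ _ _⟩
              rintro rfl
              exact hmem (hj₁ ▸ ⟨hx, hx1⟩))
      rw [hk]
      rcases hl with rfl | rfl <;> rcases this with h | h <;> rw [h] <;> simp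

theorem Represents.subset {n : ℕ} {R : Type*} [CommRing R] {B : Set (Fin n → R)}
    {s t : Finset (PMVector n R)} (h : Represents B s) (hts : t ⊆ s) :
    Represents {v ∈ B | ∃ x ∈ t, x.1 = pmSet v} t := by
  unfold Represents at *
  ext y
  constructor
  · rintro ⟨x, hx, rfl⟩
    have : x.1 ∈ pmSet '' B := h ▸ ⟨x, hts hx, rfl⟩
    obtain ⟨v, hv, hvx⟩ := this
    exact ⟨v, ⟨hv, x, hx, hvx.symm⟩, hvx⟩
  · rintro ⟨v, ⟨-, x, hx, hxv⟩, rfl⟩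
    exact ⟨x, hx, hxv⟩

theorem isAugDetOnePMBasis_subset {n : ℕ} {R : Type*} [CommRing R] {s t : Finset (PMVector n R)}
    (hs : IsDetOnePMBasis s ∨ IsAugDetOnePMBasis s) (hts : t ⊆ s) :
    IsDetOnePMBasis t ∨ IsAugDetOnePMBasis t := by
  rcases hs with ⟨B, hB, hBs⟩ | ⟨B, v₀, v₁, v₂, l, m, hB, h₁, h₂, hne, hl, hm, h₀, hBs⟩
  · exact Or.inl ⟨_, hB.mono (Set.sep_subset _ _), hBs.subset hts⟩
  · have hr := hBs.subset hts
    set C := {v ∈ insert v₀ B | ∃ x ∈ t, x.1 = pmSet v} with hC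
    have hCB : ∀ v ∈ C, v ≠ v₀ → v ∈ B := fun v hv hv0 => hv.1.resolve_left hv0
    by_cases c₀ : v₀ ∈ C
    · by_cases c₁ : v₁ ∈ C
      · by_cases c₂ : v₂ ∈ C
        · refine Or.inr ⟨C ∩ B, v₀, v₁, v₂, l, m, hB.mono Set.inter_subset_right, ⟨c₁, h₁⟩,
            ⟨c₂, h₂⟩, hne, hl, hm, h₀, ?_⟩
          have : insert v₀ (C ∩ B) = C := by
            ext v
            constructor
            · rintro (rfl | h)
              exacts [c₀, h.1]
            · intro hv
              by_cases e : v = v₀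
              exacts [Or.inl e, Or.inr ⟨hv, hCB v hv e⟩]
          rwa [this]
        · refine Or.inl ⟨C, (hB.exchange (m := l) h₂ h₁ hne.symm hm).mono fun v hv => ?_, hr⟩
          by_cases e : v = v₀
          · exact Or.inl (by rw [e, h₀, add_comm])
          · exact Or.inr ⟨hCB v hv e, fun h => c₂ (h ▸ hv)⟩
      · refine Or.inl ⟨C, (hB.exchange (m := m) h₁ h₂ hne hl).mono fun v hv => ?_, hr⟩
        by_cases e : v = v₀
        · exact Or.inl (by rw [e, h₀])
        · exact Or.inr ⟨hCB v hv e, fun h => c₁ (h ▸ hv)⟩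
    · exact Or.inl ⟨C, hB.mono fun v hv => hCB v hv fun h => c₀ (h ▸ hv), hr⟩

/-- The complex of augmented determinant-1 partial ±-bases for `R^n`. -/
def BDA (n : ℕ) (R : Type*) [CommRing R] : PreAbstractSimplicialComplex (PMVector n R) where
  faces := {s | s.Nonempty ∧ (IsDetOnePMBasis s ∨ IsAugDetOnePMBasis s)}
  isRelLowerSet_faces := fun _ hs =>
    ⟨hs.1, fun _ hts ht => ⟨ht, isAugDetOnePMBasis_subset hs.2 hts⟩⟩

/-! ## Modular curves -/

/-- The points of the bordification `ℍ ∪ ℚ ∪ {∞}` of the upper half plane. -/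
inductive ExtendedUpperHalfPlane : Type
  | point (z : ℍ)
  | cusp (c : OnePoint ℚ)

/-- `SL(2, ℤ)` acts on `ℚ ∪ {∞}` by linear fractional transformations. -/
abbrev cuspAction : MulAction SL(2, ℤ) (OnePoint ℚ) :=
  MulAction.compHom (OnePoint ℚ) (Matrix.SpecialLinearGroup.mapGL ℚ : SL(2, ℤ) →* GL (Fin 2) ℚ)

attribute [local instance] cuspAction

namespace ExtendedUpperHalfPlane

/-- `SL(2, ℤ)` acts on `ℍ ∪ ℚ ∪ {∞}` by linear fractional transformations. -/
instance : MulAction SL(2, ℤ) ExtendedUpperHalfPlane where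
  smul g x := match x with
    | point z => point (g • z)
    | cusp c => cusp (g • c)
  one_smul x := match x with
    | point z => congrArg point (one_smul _ z)
    | cusp c => congrArg cusp (one_smul _ c)
  mul_smul g h x := match x with
    | point z => congrArg point (mul_smul g h z)
    | cusp c => congrArg cusp (mul_smul g h c)

/-- The open horoballs at a cusp `c = g ∞`, namely `g {z | im z > A}`. -/
def horoball (c : OnePoint ℚ) (A : ℝ) : Set ℍ :=
  {z | ∃ g : SL(2, ℤ), g • (OnePoint.infty : OnePoint ℚ) = c ∧ A < (g⁻¹ • z).im}

/-- The topology on `ℍ ∪ ℚ ∪ {∞}`: `ℍ` is open with its usual topology, and the sets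
`{c} ∪ horoball c A` form a neighbourhood basis of the cusp `c`. -/
instance : TopologicalSpace ExtendedUpperHalfPlane where
  IsOpen U := IsOpen (point ⁻¹' U) ∧
    ∀ c : OnePoint ℚ, cusp c ∈ U → ∃ A : ℝ, ∀ z ∈ horoball c A, point z ∈ U
  isOpen_univ := ⟨isOpen_univ, fun _ _ => ⟨0, fun _ _ => trivial⟩⟩
  isOpen_inter := by
    rintro U V ⟨hU, hU'⟩ ⟨hV, hV'⟩
    refine ⟨hU.inter hV, fun c hc => ?_⟩
    obtain ⟨A, hA⟩ := hU' c hc.1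
    obtain ⟨A', hA'⟩ := hV' c hc.2
    refine ⟨max A A', ?_⟩
    rintro z ⟨g, hg, hz⟩
    exact ⟨hA z ⟨g, hg, (le_max_left _ _).trans_lt hz⟩,
      hA' z ⟨g, hg, (le_max_right _ _).trans_lt hz⟩⟩
  isOpen_sUnion := by
    intro S hS
    constructor
    · rw [Set.preimage_sUnion]
      exact isOpen_biUnion fun U hU => (hS U hU).1
    · rintro c ⟨U, hU, hc⟩
      obtain ⟨A, hA⟩ := (hS U hU).2 c hc
      exact ⟨A, fun z hz => ⟨U, hU, hA z hz⟩⟩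

end ExtendedUpperHalfPlane

/-- The compactified level-`N` modular curve: the quotient of `ℍ ∪ ℚ ∪ {∞}` by the level-`N`
principal congruence subgroup of `SL(2, ℤ)`, with the quotient topology. -/
abbrev ModularCurve (N : ℕ) : Type :=
  Quotient (MulAction.orbitRel (CongruenceSubgroup.Gamma N) ExtendedUpperHalfPlane)

end

noncomputable section

open Matrix

/-! ## Triangles -/

/-! Over a field `K`, the faces of `BDA 2 K` are the nonempty vertex subsets of the triangles
±g(1,0), ±g(0,1), ±g(1,1) with g in SL(2, K) (`mem_BDA_faces_iff`). Over ℤ the same triangles are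
those of the Farey tessellation of ℍ ∪ ℚ ∪ {∞}. The proof shows that, for odd p, dividing the
tessellation by Γ(p) and reducing vectors modulo p give the same space.

Both sides are described by weighted triangles (g, l), where l is a point of the 2-simplex. On the
hyperbolic side, (g, l) gives the quadratic form ∑ l_k ⟨v_k, ·⟩², and a point z corresponds to the
form |sz + t|² / im z up to scale, a cusp to the square of a linear form. Voronoi's argument for the
perfect form x² - xy + y², whose minimal vectors are ±(1,0), ±(0,1), ±(1,1), shows that the form up
to scale determines the weighted vertices up to sign (`sameBary_of_qform_eq`). Hence two weighted
triangles give the same point exactly when they carry the same weights on ±-vectors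
(`smul_triMap_eq_iff`). On the finite side, a coincidence modulo p lifts to ℤ after translation by
an element of Γ(p) (`SameBary.lift`). Combining the two gives `triClass_eq_iff`, hence a bijection
from the realization to the modular curve. It is continuous because it is so on each face. It is
closed because the tessellation is locally finite in ℍ, and because points of small weight at a cusp
stay outside a horoball there (`isClosed_iUnion_triangles`).

For the surface structure, the triangles around a vertex are indexed by ℤ/p and glued cyclically, so
an open star is a disc (`starMap_eq_iff_discMap_eq`). The sign of the determinant orients the
triangles coherently. Simplices are counted by their stabilizers in SL(2, 𝔽_p), of orders 2p, 4 and
6 for vertices, edges and triangles; the Euler characteristic then gives the genus. For p = 2 every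
nonzero vector is a vertex of the base triangle, so the complex is a full simplex. -/

/-- The vectors `(1, 0)`, `(0, 1)`, `(1, 1)`. -/
def baseVec (R : Type*) [CommRing R] : Fin 3 → Fin 2 → R := ![![1, 0], ![0, 1], ![1, 1]]

@[simp] theorem baseVec_zero (R : Type*) [CommRing R] : baseVec R 0 = ![1, 0] := rfl
@[simp] theorem baseVec_one (R : Type*) [CommRing R] : baseVec R 1 = ![0, 1] := rfl
@[simp] theorem baseVec_two (R : Type*) [CommRing R] : baseVec R 2 = ![1, 1] := rfl

/-- The `k`-th vertex of the triangle attached to `g`. -/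
def triVec {R : Type*} [CommRing R] (g : SL(2, R)) (k : Fin 3) : Fin 2 → R :=
  g.1 *ᵥ baseVec R k

theorem triVec_mul {R : Type*} [CommRing R] (g h : SL(2, R)) (k : Fin 3) :
    triVec (g * h) k = g.1 *ᵥ triVec h k := by
  simp only [triVec, Matrix.SpecialLinearGroup.coe_mul, Matrix.mulVec_mulVec]

theorem triVec_zero {R : Type*} [CommRing R] (g : SL(2, R)) :
    triVec g 0 = ![g 0 0, g 1 0] := by
  simp [triVec]

theorem triVec_one {R : Type*} [CommRing R] (g : SL(2, R)) :
    triVec g 1 = ![g 0 1, g 1 1] := by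
  simp [triVec]

theorem triVec_two {R : Type*} [CommRing R] (g : SL(2, R)) :
    triVec g 2 = triVec g 0 + triVec g 1 := by
  simp [triVec]

theorem triVec_neg {R : Type*} [CommRing R] (g : SL(2, R)) (k : Fin 3) :
    triVec (-g) k = - triVec g k := by
  simp only [triVec, Matrix.SpecialLinearGroup.coe_neg, Matrix.neg_mulVec]

/-- Two weighted triangles carry the same measure on vectors modulo sign. -/
def SameBary {R : Type*} [CommRing R] (g : SL(2, R)) (l : Fin 3 → ℝ) (g' : SL(2, R))
    (l' : Fin 3 → ℝ) : Prop :=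
  ∀ f : (Fin 2 → R) → ℝ, (∀ v, f (-v) = f v) →
    ∑ k, l k * f (triVec g k) = ∑ k, l' k * f (triVec g' k)

namespace SameBary

variable {R : Type*} [CommRing R] {g g' g'' : SL(2, R)} {l l' l'' : Fin 3 → ℝ}

theorem rfl' : SameBary g l g l := fun _ _ => rfl

theorem symm (h : SameBary g l g' l') : SameBary g' l' g l := fun f hf => (h f hf).symm

theorem trans (h : SameBary g l g' l') (h' : SameBary g' l' g'' l'') : SameBary g l g'' l'' :=
  fun f hf => (h f hf).trans (h' f hf)

theorem mul_left (h : SameBary g l g' l') (k : SL(2, R)) :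
    SameBary (k * g) l (k * g') l' := by
  intro f hf
  simp only [triVec_mul]
  exact h (fun v => f (k.1 *ᵥ v)) (fun v => by simp only [Matrix.mulVec_neg, hf])

theorem neg_right : SameBary g l (-g) l := by
  intro f hf
  simp only [triVec_neg, hf]

end SameBary

/-- An element of order three permuting the vertices of the base triangle cyclically. -/
def rot (R : Type*) [CommRing R] : SL(2, R) := ⟨!![0, -1; 1, -1], by simp [Matrix.det_fin_two]⟩

@[simp] theorem coe_rot (R : Type*) [CommRing R] :
    (rot R : Matrix (Fin 2) (Fin 2) R) = !![0, -1; 1, -1] := rfl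

theorem triVec_rot {R : Type*} [CommRing R] :
    triVec (rot R) 0 = baseVec R 1 ∧ triVec (rot R) 1 = - baseVec R 2 ∧
      triVec (rot R) 2 = - baseVec R 0 := by
  refine ⟨?_, ?_, ?_⟩ <;> · ext i; fin_cases i <;> simp [triVec]

theorem sameBary_rot {R : Type*} [CommRing R] (g : SL(2, R)) (l : Fin 3 → ℝ) :
    SameBary g l (g * rot R) (fun k => l (k + 1)) := by
  intro f hf
  obtain ⟨h0, h1, h2⟩ := triVec_rot (R := R)
  simp only [triVec_mul, Fin.sum_univ_three, h0, h1, h2, Matrix.mulVec_neg, hf]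
  simp only [triVec]
  have e2 : (2 : Fin 3) + 1 = 0 := rfl
  have e1 : (1 : Fin 3) + 1 = 2 := rfl
  have e0 : (0 : Fin 3) + 1 = 1 := rfl
  rw [e2, e1, e0]; ring

/-- Powers of `rot` permute the vertices cyclically up to sign. Later arguments use this to assume
that the vertex of interest is the first one. -/
theorem exists_sameBary_rot {R : Type*} [CommRing R] (g : SL(2, R)) (k : Fin 3) :
    ∃ h : SL(2, R), (∀ l : Fin 3 → ℝ, SameBary g l (g * h) (fun i => l (i + k))) ∧
      (triVec (g * h) 0 = triVec g k ∨ triVec (g * h) 0 = - triVec g k) := by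
  obtain ⟨h0, h1, h2⟩ := triVec_rot (R := R)
  fin_cases k
  · exact ⟨1, fun _ => by simpa using! SameBary.rfl', by simp⟩
  · refine ⟨rot R, fun l => sameBary_rot g l, Or.inl ?_⟩
    rw [triVec_mul, h0]; rfl
  · refine ⟨rot R * rot R, fun l => ?_, Or.inr ?_⟩
    · have := (sameBary_rot g l).trans (sameBary_rot (g * rot R) _)
      rw [mul_assoc] at this
      convert this using 3
      rw [add_assoc]; rfl
    · rw [triVec_mul, triVec_mul, h0]
      change g.1 *ᵥ triVec (rot R) 1 = _
      rw [h1, Matrix.mulVec_neg]; rfl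

/-! ### Unipotent matrices and surjectivity of reduction modulo a prime -/

/-- Upper triangular unipotent matrices. -/
def upper {R : Type*} [CommRing R] (n : R) : SL(2, R) :=
  ⟨!![1, n; 0, 1], by simp [Matrix.det_fin_two]⟩

/-- Lower triangular unipotent matrices. -/
def lower {R : Type*} [CommRing R] (n : R) : SL(2, R) :=
  ⟨!![1, 0; n, 1], by simp [Matrix.det_fin_two]⟩

@[simp] theorem coe_upper {R : Type*} [CommRing R] (n : R) :
    (upper n : Matrix (Fin 2) (Fin 2) R) = !![1, n; 0, 1] := rfl

@[simp] theorem coe_lower {R : Type*} [CommRing R] (n : R) :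
    (lower n : Matrix (Fin 2) (Fin 2) R) = !![1, 0; n, 1] := rfl

theorem triVec_upper {R : Type*} [CommRing R] (n : R) :
    triVec (upper n) 0 = ![1, 0] ∧ triVec (upper n) 1 = ![n, 1] ∧
      triVec (upper n) 2 = ![n + 1, 1] := by
  refine ⟨?_, ?_, ?_⟩ <;> · ext i; fin_cases i <;> simp [triVec, add_comm]

theorem upper_zero {R : Type*} [CommRing R] : upper (0 : R) = 1 := by
  ext i j
  fin_cases i <;> fin_cases j <;> simp

theorem map_upper {R S : Type*} [CommRing R] [CommRing S] (f : R →+* S) (n : R) :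
    Matrix.SpecialLinearGroup.map f (upper n) = upper (f n) := by
  ext i j
  fin_cases i <;> fin_cases j <;> simp

theorem map_lower {R S : Type*} [CommRing R] [CommRing S] (f : R →+* S) (n : R) :
    Matrix.SpecialLinearGroup.map f (lower n) = lower (f n) := by
  ext i j
  fin_cases i <;> fin_cases j <;> simp

/-- The stabilizer of (1,0) consists of the upper unipotent matrices, so the g with a prescribed
first vertex form a torsor under R. -/
theorem eq_upper_of_triVec_zero_eq {R : Type*} [CommRing R] {g h : SL(2, R)}
    (e : triVec g 0 = triVec h 0) : ∃ n : R, h = g * upper n := by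
  have hx : triVec (g⁻¹ * h) 0 = ![1, 0] := by
    rw [triVec_mul, ← e, ← triVec_mul]; simp [triVec]
  rw [triVec_zero] at hx
  have h0 := congrFun hx 0
  have h1 := congrFun hx 1
  simp only [Matrix.cons_val_zero, Matrix.cons_val_one] at h0 h1
  refine ⟨(g⁻¹ * h) 0 1, ?_⟩
  rw [eq_comm, ← eq_inv_mul_iff_mul_eq, eq_comm]
  have hd := (g⁻¹ * h).det_coe
  rw [Matrix.det_fin_two, h0, h1] at hd
  ext i j
  fin_cases i <;> fin_cases j
  · exact h0
  · rfl
  · exact h1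
  · simpa using! hd

/-- Reduction `SL(2, ℤ) → SL(2, ℤ/N)`. -/
abbrev red (N : ℕ) : SL(2, ℤ) →* SL(2, ZMod N) :=
  Matrix.SpecialLinearGroup.map (Int.castRingHom (ZMod N))

/-- A matrix with nonzero lower left entry is a product upper · lower · upper. If that entry
vanishes, multiplication by `lower 1` makes it nonzero. -/
theorem SpecialLinearGroup.mem_of_upper_lower {K : Type*} [Field K] (H : Subgroup SL(2, K))
    (hu : ∀ x, upper x ∈ H) (hl : ∀ x, lower x ∈ H) (g : SL(2, K)) : g ∈ H := by
  have key : ∀ g : SL(2, K), g 1 0 ≠ 0 → g ∈ H := by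
    intro g hg
    have hd := g.det_coe
    rw [Matrix.det_fin_two] at hd
    have : g = upper ((g 0 0 - 1) / g 1 0) * lower (g 1 0) * upper ((g 1 1 - 1) / g 1 0) := by
      ext i j
      fin_cases i <;> fin_cases j <;>
        simp [Matrix.mul_apply, Fin.sum_univ_two] <;> field_simp
      · ring
      · linear_combination -hd
      · ring
    rw [this]
    exact H.mul_mem (H.mul_mem (hu _) (hl _)) (hu _)
  by_cases hg : g 1 0 = 0
  · have hd := g.det_coe
    rw [Matrix.det_fin_two, hg] at hd
    have h11 : g 1 1 ≠ 0 := by rintro h; simp [h] at hd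
    have := key (g * lower 1) (by
      simpa [Matrix.mul_apply, Fin.sum_univ_two, hg] using h11)
    exact (H.mul_mem_cancel_right (hl 1)).1 this
  · exact key g hg

theorem red_surjective (p : ℕ) [Fact p.Prime] : Function.Surjective (red p) := by
  intro g
  refine SpecialLinearGroup.mem_of_upper_lower (red p).range ?_ ?_ g
  · intro x
    obtain ⟨n, rfl⟩ := ZMod.intCast_surjective x
    exact ⟨upper n, by simp [map_upper]⟩
  · intro x
    obtain ⟨n, rfl⟩ := ZMod.intCast_surjective x
    exact ⟨lower n, by simp [map_lower]⟩

theorem triVec_map {R S : Type*} [CommRing R] [CommRing S] (f : R →+* S) (g : SL(2, R))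
    (k : Fin 3) : triVec (Matrix.SpecialLinearGroup.map f g) k = f ∘ triVec g k := by
  ext i
  fin_cases k <;> fin_cases i <;> simp [triVec]

theorem SameBary.map {R S : Type*} [CommRing R] [CommRing S] (f : R →+* S) {g g' : SL(2, R)}
    {l l' : Fin 3 → ℝ} (h : SameBary g l g' l') :
    SameBary (Matrix.SpecialLinearGroup.map f g) l (Matrix.SpecialLinearGroup.map f g') l' := by
  intro F hF
  simp only [triVec_map]
  refine h (fun v => F (f ∘ v)) (fun v => ?_)
  have : (f ∘ (-v) : Fin 2 → S) = -(f ∘ v) := by ext i; simp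
  rw [this, hF]

end

noncomputable section

open Matrix

/-! ## Lifting coincidences of weighted triangles from characteristic `p` -/

open Classical in
/-- The indicator function of `{w, -w}`. -/
def pmInd {R : Type*} [CommRing R] (w v : Fin 2 → R) : ℝ := if v = w ∨ v = -w then 1 else 0

theorem pmInd_neg {R : Type*} [CommRing R] (w v : Fin 2 → R) : pmInd w (-v) = pmInd w v := by
  unfold pmInd
  congr 1
  rw [neg_eq_iff_eq_neg, neg_inj, or_comm]

theorem pmInd_eq_ite {p : ℕ} [Fact p.Prime] (hp : 2 < p) (m a : ZMod p) :
    pmInd ![m, 1] ![a, 1] = if a = m then 1 else 0 := by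
  have h2 : Fact (2 < p) := ⟨hp⟩
  have h1 : (1 : ZMod p) ≠ -1 := (ZMod.neg_one_ne_one).symm
  by_cases h : a = m <;> simp [pmInd, h, h1]

theorem pmInd_base {p : ℕ} [Fact p.Prime] (m : ZMod p) : pmInd ![m, 1] ![1, 0] = 0 := by
  simp [pmInd]

theorem pmInd_nonneg {R : Type*} [CommRing R] (w v : Fin 2 → R) : 0 ≤ pmInd w v := by
  unfold pmInd; split_ifs <;> norm_num

theorem pmInd_self {R : Type*} [CommRing R] (w : Fin 2 → R) : pmInd w w = 1 := by
  simp [pmInd]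

theorem ZMod.two_ne_zero_of_lt {p : ℕ} (hp : 2 < p) : (2 : ZMod p) ≠ 0 := by
  intro h
  have : ((2 : ℕ) : ZMod p) = 0 := by exact_mod_cast h
  rw [ZMod.natCast_eq_zero_iff] at this
  exact absurd (Nat.le_of_dvd two_pos this) (by omega)

/-- Besides (1,0), the triangles have vertices ±(0,1), ±(1,1) and ±(n,1), ±(n+1,1). For n = 0, 1, -1
they coincide or share an edge, and so do their lifts with m = 0, 1, -1. Otherwise only (1,0) is
shared and carries all the weight. -/
theorem SameBary.lift_upper {p : ℕ} [Fact p.Prime] (hp : 2 < p) {n : ZMod p} {l l' : Fin 3 → ℝ}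
    (hl : l ∈ stdSimplex ℝ (Fin 3)) (hl' : l' ∈ stdSimplex ℝ (Fin 3))
    (h : SameBary (1 : SL(2, ZMod p)) l (upper n) l') :
    ∃ m : ℤ, (m : ZMod p) = n ∧ SameBary (1 : SL(2, ℤ)) l (upper m) l' := by
  obtain ⟨u0, u1, u2⟩ := triVec_upper n
  obtain ⟨v0, v1, v2⟩ := triVec_upper (0 : ZMod p)
  rw [upper_zero] at v0 v1 v2
  -- Testing against the indicator of ±(m,1) reads off the total weight at that vertex; the vertex
  -- (1,0) never contributes.
  have key : ∀ m : ZMod p, (l 1 * if 0 = m then 1 else 0) + (l 2 * if 1 = m then 1 else 0) =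
      (l' 1 * if n = m then 1 else 0) + (l' 2 * if n + 1 = m then 1 else 0) := by
    intro m
    have := h (pmInd ![m, 1]) (pmInd_neg _)
    simp only [Fin.sum_univ_three, u0, u1, u2, v0, v1, v2, pmInd_base, pmInd_eq_ite hp,
      zero_add] at this
    simpa using this
  have hs := hl.2
  have hs' := hl'.2
  rw [Fin.sum_univ_three] at hs hs'
  have h2 := ZMod.two_ne_zero_of_lt hp
  have h01 : (0 : ZMod p) ≠ 1 := zero_ne_one
  have concl : ∀ m : ℤ, (∀ f : (Fin 2 → ℤ) → ℝ, (∀ v, f (-v) = f v) →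
      l 0 * f ![1, 0] + l 1 * f ![0, 1] + l 2 * f ![1, 1] =
      l' 0 * f ![1, 0] + l' 1 * f ![m, 1] + l' 2 * f ![m + 1, 1]) →
      SameBary (1 : SL(2, ℤ)) l (upper m) l' := by
    intro m hm f hf
    obtain ⟨w0, w1, w2⟩ := triVec_upper (0 : ℤ)
    rw [upper_zero] at w0 w1 w2
    obtain ⟨u0, u1, u2⟩ := triVec_upper m
    simp only [Fin.sum_univ_three, u0, u1, u2, w0, w1, w2]
    simpa using hm f hf
  by_cases n0 : n = 0
  · subst n0
    have k0 := key 0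
    have k1 := key 1
    simp at k0 k1
    refine ⟨0, by simp, concl 0 fun f _ => ?_⟩
    rw [show l 0 = l' 0 by linarith, k0, k1]
    simp
  by_cases n1 : n = 1
  · subst n1
    have k0 := key 0
    have k1 := key 1
    have k2 := key 2
    have e : (1 : ZMod p) + 1 = 2 := by norm_num
    have e12 : (1 : ZMod p) ≠ 2 := by
      intro h; apply h01; linear_combination h
    simp [e, h2, Ne.symm h2, e12, e12.symm] at k0 k1 k2
    refine ⟨1, by simp, concl 1 fun f _ => ?_⟩
    rw [show l 0 = l' 0 by linarith, k0, k1, ← k2]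
    simp
  by_cases n2 : n = -1
  · subst n2
    have k0 := key 0
    have k1 := key 1
    have k2 := key (-1)
    have e : (-1 : ZMod p) ≠ 1 := by
      intro h; apply h2; linear_combination -h
    simp [e, e.symm] at k0 k1 k2
    refine ⟨-1, by simp, concl (-1) fun f _ => ?_⟩
    rw [show l 0 = l' 0 by linarith, k0, k1, ← k2]
    simp
  -- The pairs {0, 1} and {n, n+1} are disjoint, so the four weights away from (1,0) vanish and any
  -- integer lift of n works.
  · have k0 := key 0
    have k1 := key 1
    have k2 := key n
    have k3 := key (n + 1)
    have e1 : n + 1 ≠ 0 := fun h => n2 (by linear_combination h)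
    simp [n0, n1, e1, Ne.symm n0, Ne.symm n1, e1.symm] at k0 k1 k2 k3
    obtain ⟨m, rfl⟩ := ZMod.intCast_surjective n
    refine ⟨m, rfl, concl m fun f _ => ?_⟩
    rw [show l 0 = l' 0 by linarith, k0, k1, ← k2, ← k3]
    simp

theorem sum_stdSimplex_exists_pos {ι : Type*} [Fintype ι] {l : ι → ℝ}
    (hl : l ∈ stdSimplex ℝ ι) : ∃ k, 0 < l k := by
  by_contra! h
  have := Finset.sum_nonpos (s := Finset.univ) (f := l) (fun i _ => h i)
  rw [hl.2] at this
  linarith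

theorem stdSimplex_shift {l : Fin 3 → ℝ} (hl : l ∈ stdSimplex ℝ (Fin 3)) (k : Fin 3) :
    (fun i => l (i + k)) ∈ stdSimplex ℝ (Fin 3) :=
  ⟨fun _ => hl.1 _, by rw [← hl.2]; exact Equiv.sum_comp (Equiv.addRight k) l⟩

/-- The two triangles modulo p share a vertex of positive weight. Rotating it to the front on both
sides and adjusting a sign makes them differ by an upper unipotent matrix modulo p, which is the
case of `SameBary.lift_upper`. -/
theorem SameBary.lift {p : ℕ} [Fact p.Prime] (hp : 2 < p) {g g' : SL(2, ℤ)} {l l' : Fin 3 → ℝ}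
    (hl : l ∈ stdSimplex ℝ (Fin 3)) (hl' : l' ∈ stdSimplex ℝ (Fin 3))
    (h : SameBary (red p g) l (red p g') l') :
    ∃ γ ∈ CongruenceSubgroup.Gamma p, SameBary (γ * g) l g' l' := by
  obtain ⟨k, hk⟩ := sum_stdSimplex_exists_pos hl
  obtain ⟨k', hk'⟩ : ∃ k', triVec (red p g') k' = triVec (red p g) k ∨
      triVec (red p g') k' = - triVec (red p g) k := by
    by_contra! hne
    have := h (pmInd (triVec (red p g) k)) (pmInd_neg _)
    rw [Finset.sum_eq_zero (s := Finset.univ) (f := fun i => l' i * _)] at this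
    · rw [Finset.sum_eq_zero_iff_of_nonneg
        (fun i _ => mul_nonneg (hl.1 i) (pmInd_nonneg _ _))] at this
      have := this k (Finset.mem_univ _)
      rw [pmInd_self, mul_one] at this
      exact hk.ne' this
    · intro i _
      rw [pmInd, if_neg (by simpa using hne i), mul_zero]
  obtain ⟨r, hr, hrv⟩ := exists_sameBary_rot g k
  obtain ⟨r', hr', hrv'⟩ := exists_sameBary_rot g' k'
  have hred : ∀ {a b : Fin 2 → ℤ}, (a = b ∨ a = -b) →
      Int.castRingHom (ZMod p) ∘ a = Int.castRingHom (ZMod p) ∘ b ∨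
      Int.castRingHom (ZMod p) ∘ a = - Int.castRingHom (ZMod p) ∘ b := by
    rintro a b (rfl | rfl)
    · exact Or.inl rfl
    · right; ext i; simp
  have e1 := hred hrv
  have e1' := hred hrv'
  simp only [← triVec_map] at e1 e1'
  have e2 : triVec (red p (g' * r')) 0 = triVec (red p (g * r)) 0 ∨
      triVec (red p (g' * r')) 0 = - triVec (red p (g * r)) 0 := by
    rcases e1 with e1 | e1 <;> rcases e1' with e1' | e1' <;> rcases hk' with e2 | e2 <;>
      rw [e1, e1', e2] <;> simp
  obtain ⟨q, hq, hqv⟩ : ∃ q, SameBary g' l' q (fun i => l' (i + k')) ∧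
      triVec (red p (g * r)) 0 = triVec (red p q) 0 := by
    rcases e2 with e2 | e2
    · exact ⟨_, hr' l', e2.symm⟩
    · refine ⟨_, (hr' l').trans SameBary.neg_right, ?_⟩
      have : red p (-(g' * r')) = - red p (g' * r') := by ext; simp
      rw [this, triVec_neg, e2, neg_neg]
  obtain ⟨n, hn⟩ := eq_upper_of_triVec_zero_eq hqv
  have h3 : SameBary (red p (g * r)) (fun i => l (i + k)) (red p q) (fun i => l' (i + k')) :=
    ((hr l).symm.map _).trans (h.trans (hq.map _))
  have h4 := h3.mul_left (red p (g * r))⁻¹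
  rw [inv_mul_cancel, hn, inv_mul_cancel_left] at h4
  obtain ⟨m, rfl, h5⟩ := h4.lift_upper hp (stdSimplex_shift hl k) (stdSimplex_shift hl' k')
  -- This element carries g r to q (upper m)⁻¹, and it reduces to 1 because q is (g r) (upper m)
  -- modulo p.
  refine ⟨q * (upper m)⁻¹ * (g * r)⁻¹, ?_, ?_⟩
  · rw [CongruenceSubgroup.Gamma_mem']
    change red p _ = 1
    rw [map_mul, map_mul, hn, map_inv, map_inv, map_upper]
    simp
  · have h6 := h5.mul_left (q * (upper m)⁻¹)
    rw [mul_one, inv_mul_cancel_right] at h6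
    have h7 := (hr l).mul_left (q * (upper m)⁻¹ * (g * r)⁻¹)
    rw [inv_mul_cancel_right] at h7
    exact h7.trans (h6.trans hq.symm)

end

noncomputable section

open Matrix

/-! ## Voronoi reduction of binary quadratic forms -/

/-- Four times the form is (2x - y)² + 3y², so the form is positive definite and integral. -/
theorem one_le_hexForm {x y : ℤ} (h : x ≠ 0 ∨ y ≠ 0) : 1 ≤ x ^ 2 - x * y + y ^ 2 := by
  by_contra! hlt
  have h1 : (2 * x - y) ^ 2 + 3 * y ^ 2 ≤ 0 := by nlinarith
  have hy : y = 0 := by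
    by_contra hy
    have : 0 < y ^ 2 := by positivity
    nlinarith [sq_nonneg (2 * x - y)]
  subst hy
  have hx : x = 0 := by
    by_contra hx
    have : 0 < x ^ 2 := by positivity
    nlinarith
  simp [hx] at h

theorem hexForm_eq_one {v : Fin 2 → ℤ} (h : v 0 ^ 2 - v 0 * v 1 + v 1 ^ 2 = 1) :
    ∃ k, v = baseVec ℤ k ∨ v = - baseVec ℤ k := by
  have hv : v = ![v 0, v 1] := by ext i; fin_cases i <;> rfl
  generalize v 0 = x at *
  generalize v 1 = y at *
  subst hv
  have hx : x ^ 2 ≤ 1 := by nlinarith [sq_nonneg (x - 2 * y)]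
  have hy : y ^ 2 ≤ 1 := by nlinarith [sq_nonneg (y - 2 * x)]
  have hx1 : -1 ≤ x := by nlinarith
  have hx2 : x ≤ 1 := by nlinarith
  have hy1 : -1 ≤ y := by nlinarith
  have hy2 : y ≤ 1 := by nlinarith
  interval_cases x <;> interval_cases y <;> simp at h
  · exact ⟨2, Or.inr (by simp)⟩
  · exact ⟨0, Or.inr (by simp)⟩
  · exact ⟨1, Or.inr (by simp)⟩
  · exact ⟨1, Or.inl (by simp)⟩
  · exact ⟨0, Or.inl (by simp)⟩
  · exact ⟨2, Or.inl (by simp)⟩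

/-- The quadratic form `∑ l k ⟨v k, (s, t)⟩²` attached to a weighted triangle. -/
def qform (g : SL(2, ℤ)) (l : Fin 3 → ℝ) (s t : ℝ) : ℝ :=
  ∑ k, l k * (s * triVec g k 0 + t * triVec g k 1) ^ 2

theorem SameBary.qform_eq {g g' : SL(2, ℤ)} {l l' : Fin 3 → ℝ} (h : SameBary g l g' l')
    (s t : ℝ) : qform g l s t = qform g' l' s t :=
  h (fun v => (s * v 0 + t * v 1) ^ 2) (fun v => by simp; ring)

theorem triVec_mul_apply (g h : SL(2, ℤ)) (k : Fin 3) (i : Fin 2) :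
    triVec (g * h) k i = g i 0 * triVec h k 0 + g i 1 * triVec h k 1 := by
  rw [triVec_mul]
  simp [Matrix.mulVec, dotProduct, Fin.sum_univ_two]

theorem qform_mul (g h : SL(2, ℤ)) (l : Fin 3 → ℝ) (s t : ℝ) :
    qform (g * h) l s t = qform h l (s * g 0 0 + t * g 1 0) (s * g 0 1 + t * g 1 1) := by
  unfold qform
  refine Finset.sum_congr rfl fun k _ => ?_
  rw [triVec_mul_apply, triVec_mul_apply]
  push_cast
  ring

/-- Values of a binary quadratic form with given polarization data. -/
theorem sum_quadratic_eq {g g' : SL(2, ℤ)} {l l' : Fin 3 → ℝ} {c : ℝ}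
    (h : ∀ s t, qform g l s t = c * qform g' l' s t) (α β γ : ℝ) :
    ∑ k, l k * (α * ((triVec g k 0 : ℤ) : ℝ) ^ 2 + β * ((triVec g k 1 : ℤ) : ℝ) ^ 2 +
      γ * (triVec g k 0 * triVec g k 1)) =
    c * ∑ k, l' k * (α * ((triVec g' k 0 : ℤ) : ℝ) ^ 2 + β * ((triVec g' k 1 : ℤ) : ℝ) ^ 2 +
      γ * (triVec g' k 0 * triVec g' k 1)) := by
  have h10 := h 1 0
  have h01 := h 0 1
  have h11 := h 1 1
  simp only [qform, Fin.sum_univ_three] at *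
  linear_combination (α - γ / 2) * h10 + (β - γ / 2) * h01 + γ / 2 * h11

theorem triVec_ne_zero {R : Type*} [CommRing R] [Nontrivial R] (g : SL(2, R)) (k : Fin 3) :
    triVec g k ≠ 0 := by
  intro h
  have : triVec (g⁻¹ * g) k = 0 := by rw [triVec_mul, h, Matrix.mulVec_zero]
  rw [inv_mul_cancel] at this
  fin_cases k <;> simp [triVec] at this

theorem one_le_hexForm_triVec (g : SL(2, ℤ)) (k : Fin 3) :
    (1 : ℝ) ≤ ((triVec g k 0 : ℤ) : ℝ) ^ 2 + ((triVec g k 1 : ℤ) : ℝ) ^ 2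
      - (triVec g k 0 * triVec g k 1) := by
  have h := one_le_hexForm (x := triVec g k 0) (y := triVec g k 1) (by
    by_contra! h
    apply triVec_ne_zero g k
    ext i; fin_cases i
    exacts [h.1, h.2])
  have h' : (1 : ℝ) ≤ ((triVec g k 0 ^ 2 - triVec g k 0 * triVec g k 1 + triVec g k 1 ^ 2 : ℤ) : ℝ) := by
    exact_mod_cast h
  push_cast at h'
  linarith

/-- Pairing both forms with x² - xy + y² replaces each vertex by its value there. The left side
becomes at least ∑ l = 1, and the right side is exactly c, since the base vectors have value 1. -/
theorem one_le_of_qform_eq {h : SL(2, ℤ)} {l l' : Fin 3 → ℝ} {c : ℝ}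
    (hl : l ∈ stdSimplex ℝ (Fin 3)) (hl' : l' ∈ stdSimplex ℝ (Fin 3))
    (e : ∀ s t, qform h l s t = c * qform 1 l' s t) : 1 ≤ c := by
  have h1 := sum_quadratic_eq e 1 1 (-1)
  have h2 : ∑ k, l k ≤ ∑ k, l k * (1 * ((triVec h k 0 : ℤ) : ℝ) ^ 2 + 1 * ((triVec h k 1 : ℤ) : ℝ) ^ 2 +
      -1 * (triVec h k 0 * triVec h k 1)) := by
    refine Finset.sum_le_sum fun k _ => le_mul_of_one_le_right (hl.1 k) ?_
    have := one_le_hexForm_triVec h k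
    linarith
  rw [h1, hl.2] at h2
  have h3 := hl'.2
  simp only [Fin.sum_univ_three] at h2 h3
  simp [triVec] at h2
  nlinarith

theorem qform_inv_mul {g g' : SL(2, ℤ)} {l l' : Fin 3 → ℝ} {c : ℝ}
    (h : ∀ s t, qform g l s t = c * qform g' l' s t) (k : SL(2, ℤ)) (s t : ℝ) :
    qform (k * g) l s t = c * qform (k * g') l' s t := by
  rw [qform_mul, qform_mul, h]

/-- Equality in the pairing argument: every vertex of positive weight is a minimal vector of x² - xy
+ y², hence ± a base vector. On these vectors any even function agrees with a quadratic form, whose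
weighted sum depends only on `qform`. -/
theorem sameBary_one_of_qform_eq {h : SL(2, ℤ)} {l l' : Fin 3 → ℝ}
    (hl : l ∈ stdSimplex ℝ (Fin 3)) (hl' : l' ∈ stdSimplex ℝ (Fin 3))
    (e : ∀ s t, qform h l s t = 1 * qform 1 l' s t) : SameBary h l 1 l' := by
  have h1 := sum_quadratic_eq e 1 1 (-1)
  have h3 := hl'.2
  have h4 : ∑ k, l k * (1 * ((triVec h k 0 : ℤ) : ℝ) ^ 2 + 1 * ((triVec h k 1 : ℤ) : ℝ) ^ 2 +
      -1 * (triVec h k 0 * triVec h k 1)) = ∑ k, l k := by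
    rw [h1, hl.2, one_mul]
    rw [Fin.sum_univ_three] at h3
    simp [Fin.sum_univ_three, triVec]
    linarith
  have h5 : ∀ k ∈ Finset.univ, l k * (((triVec h k 0 : ℤ) : ℝ) ^ 2 + ((triVec h k 1 : ℤ) : ℝ) ^ 2
      - (triVec h k 0 * triVec h k 1) - 1) = 0 := by
    refine (Finset.sum_eq_zero_iff_of_nonneg fun k _ => mul_nonneg (hl.1 k) ?_).1 ?_
    · have := one_le_hexForm_triVec h k
      linarith
    · rw [← sub_eq_zero, ← Finset.sum_sub_distrib] at h4
      rw [← h4]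
      exact Finset.sum_congr rfl fun k _ => by ring
  intro f hf
  set α := f (baseVec ℤ 0)
  set β := f (baseVec ℤ 1)
  -- With this choice αx² + βy² + γxy takes the same values as f at (1,0), (0,1) and (1,1).
  set γ := f (baseVec ℤ 2) - α - β
  have hQ : ∀ v : Fin 2 → ℤ, (∃ k, v = baseVec ℤ k ∨ v = - baseVec ℤ k) →
      f v = α * (v 0 : ℝ) ^ 2 + β * (v 1 : ℝ) ^ 2 + γ * (v 0 * v 1) := by
    have hk : ∀ k, f (baseVec ℤ k) = α * (baseVec ℤ k 0 : ℝ) ^ 2 + β * (baseVec ℤ k 1 : ℝ) ^ 2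
        + γ * (baseVec ℤ k 0 * baseVec ℤ k 1) := by
      intro k
      fin_cases k
      · simp [α]
      · simp [β]
      · simp [γ]
    rintro v ⟨k, rfl | rfl⟩
    · exact hk k
    · rw [hf, hk]; simp
  have h6 := sum_quadratic_eq e α β γ
  rw [one_mul] at h6
  have h7 : ∀ k, l k * f (triVec h k) = l k * (α * ((triVec h k 0 : ℤ) : ℝ) ^ 2 +
      β * ((triVec h k 1 : ℤ) : ℝ) ^ 2 + γ * (triVec h k 0 * triVec h k 1)) := by
    intro k
    rcases mul_eq_zero.1 (h5 k (Finset.mem_univ _)) with h0 | h0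
    · rw [h0, zero_mul, zero_mul]
    · rw [hQ _ (hexForm_eq_one ?_)]
      have : ((triVec h k 0 ^ 2 - triVec h k 0 * triVec h k 1 + triVec h k 1 ^ 2 : ℤ) : ℝ) = 1 := by
        push_cast; linarith
      exact_mod_cast this
  rw [Finset.sum_congr rfl fun k _ => h7 k, h6]
  refine Finset.sum_congr rfl fun k _ => ?_
  rw [hQ _ ⟨k, Or.inl (by simp [triVec])⟩]

/-- Uniqueness of the Voronoi decomposition. -/
theorem sameBary_of_qform_eq {g g' : SL(2, ℤ)} {l l' : Fin 3 → ℝ} {c : ℝ} (hc : 0 < c)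
    (hl : l ∈ stdSimplex ℝ (Fin 3)) (hl' : l' ∈ stdSimplex ℝ (Fin 3))
    (h : ∀ s t, qform g l s t = c * qform g' l' s t) : SameBary g l g' l' := by
  have h1 := qform_inv_mul h g'⁻¹
  rw [inv_mul_cancel] at h1
  have h2 : ∀ s t, qform g' l' s t = c⁻¹ * qform g l s t := fun s t => by
    rw [h, inv_mul_cancel_left₀ hc.ne']
  have h3 := qform_inv_mul h2 g⁻¹
  rw [inv_mul_cancel] at h3
  -- The same inequality with the two triangles exchanged bounds c⁻¹ below by 1, so c = 1.
  have h4 := one_le_of_qform_eq hl hl' h1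
  have h5 := one_le_of_qform_eq hl' hl h3
  have h6 : c = 1 := le_antisymm ((one_le_inv₀ hc).1 h5) h4
  subst h6
  simpa using (sameBary_one_of_qform_eq hl hl' h1).mul_left g'

end

noncomputable section

open Matrix

attribute [local instance] cuspAction

namespace ExtendedUpperHalfPlane

/-! ## Points of the bordification as binary quadratic forms up to scale -/

theorem smul_point (g : SL(2, ℤ)) (z : ℍ) : g • point z = point (g • z) := rfl

theorem smul_cusp (g : SL(2, ℤ)) (c : OnePoint ℚ) : g • cusp c = cusp (g • c) := rfl

theorem smul_infty_iff (g : SL(2, ℤ)) :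
    g • (OnePoint.infty : OnePoint ℚ) = OnePoint.infty ↔ g 1 0 = 0 := by
  change Matrix.SpecialLinearGroup.mapGL ℚ g • (OnePoint.infty : OnePoint ℚ) = _ ↔ _
  rw [OnePoint.smul_infty_eq_self_iff]
  simp

theorem smul_infty_eq_smul_infty_iff (g h : SL(2, ℤ)) :
    g • (OnePoint.infty : OnePoint ℚ) = h • (OnePoint.infty : OnePoint ℚ) ↔
      g 0 0 * h 1 0 = g 1 0 * h 0 0 := by
  rw [eq_comm, ← inv_smul_eq_iff, smul_smul, smul_infty_iff]
  have : (g⁻¹ * h) 1 0 = g 0 0 * h 1 0 - g 1 0 * h 0 0 := by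
    simp [Matrix.SpecialLinearGroup.coe_inv, Matrix.adjugate_fin_two, Matrix.mul_apply,
      Fin.sum_univ_two]
    ring
  rw [this, sub_eq_zero]

theorem exists_smul_infty (c : OnePoint ℚ) : ∃ g : SL(2, ℤ), g • OnePoint.infty = c := by
  obtain ⟨g, hg⟩ := OnePoint.exists_mem_SL2 ℤ c
  exact ⟨g, hg⟩

/-- The quadratic form `q` is positively proportional to `(s, t) ↦ |s z + t|² / im z`, or to the
square of the linear form attached to a cusp. -/
def IsFormOf (q : ℝ → ℝ → ℝ) : ExtendedUpperHalfPlane → Prop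
  | point z => ∃ c > 0, ∀ s t, q s t = c * (((s * z.re + t) ^ 2 + (s * z.im) ^ 2) / z.im)
  | cusp c => ∃ k > 0, ∃ h : SL(2, ℤ), h • OnePoint.infty = c ∧
      ∀ s t, q s t = k * (s * h 0 0 + t * h 1 0) ^ 2

/-- For g with rows (a, b) and (c, d), one has s·gz + t = ((sa + tc)z + (sb + td)) / (cz + d) and im
gz = im z / |cz + d|², so the factor |cz + d|² cancels. -/
theorem smul_form_eq (g : SL(2, ℤ)) (z : ℍ) (s t : ℝ) :
    ((s * (g • z).re + t) ^ 2 + (s * (g • z).im) ^ 2) / (g • z).im =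
      (((s * g 0 0 + t * g 1 0) * z.re + (s * g 0 1 + t * g 1 1)) ^ 2 +
        ((s * g 0 0 + t * g 1 0) * z.im) ^ 2) / z.im := by
  have hd : (g 0 0 * g 1 1 - g 0 1 * g 1 0 : ℝ) = 1 := by
    have := g.det_coe
    rw [Matrix.det_fin_two] at this
    exact_mod_cast this
  have hy := z.im_pos
  have hv := (g • z).im_pos
  have e := UpperHalfPlane.coe_specialLinearGroup_apply g z
  have hne : ((g 1 0 : ℝ) : ℂ) * z + ((g 1 1 : ℝ) : ℂ) ≠ 0 := by
    intro h
    have h1 := congrArg Complex.im h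
    have h2 := congrArg Complex.re h
    simp at h1 h2
    rcases h1 with h1 | h1
    · rw [h1] at h2 hd
      simp at h2
      rw [h2] at hd
      simp at hd
    · exact hy.ne' h1
  simp only [eq_intCast] at e
  rw [eq_div_iff hne] at e
  generalize g • z = w at *
  have e1 := congrArg Complex.re e
  have e2 := congrArg Complex.im e
  simp at e1 e2
  generalize w.re = u at *
  generalize w.im = v at *
  generalize z.re = x at *
  generalize z.im = y at *
  generalize (g 0 0 : ℝ) = a at *
  generalize (g 0 1 : ℝ) = b at *
  generalize (g 1 0 : ℝ) = c at *
  generalize (g 1 1 : ℝ) = d at *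
  -- This is im gz · |cz + d|² = im z; `e1` and `e2` are the real and imaginary parts of gz · (cz +
  -- d) = az + b.
  have hvD : v * ((c * x + d) ^ 2 + (c * y) ^ 2) = y := by
    linear_combination -(c * y) * e1 + (c * x + d) * e2 + y * hd
  have hx : (s * a + t * c) * x + (s * b + t * d) = s * (a * x + b) + t * (c * x + d) := by ring
  have hD : ((s * a + t * c) * x + (s * b + t * d)) ^ 2 + ((s * a + t * c) * y) ^ 2 =
      ((s * u + t) ^ 2 + (s * v) ^ 2) * ((c * x + d) ^ 2 + (c * y) ^ 2) := by
    have f1 : (s * a + t * c) * x + (s * b + t * d) = (s * u + t) * (c * x + d) - s * v * (c * y) := by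
      linear_combination -s * e1
    have f2 : (s * a + t * c) * y = (s * u + t) * (c * y) + s * v * (c * x + d) := by
      linear_combination -s * e2
    rw [f1, f2]; ring
  rw [div_eq_div_iff hv.ne' hy.ne', hD]
  linear_combination -((s * u + t) ^ 2 + (s * v) ^ 2) * hvD

theorem IsFormOf.smul {q : ℝ → ℝ → ℝ} {x : ExtendedUpperHalfPlane} (h : IsFormOf q x)
    (g : SL(2, ℤ)) :
    IsFormOf (fun s t => q (s * g 0 0 + t * g 1 0) (s * g 0 1 + t * g 1 1)) (g • x) := by
  cases x with
  | point z =>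
    obtain ⟨c, hc, h⟩ := h
    exact ⟨c, hc, fun s t => (h _ _).trans (by rw [smul_form_eq])⟩
  | cusp c =>
    obtain ⟨k, hk, r, rfl, h⟩ := h
    refine ⟨k, hk, g * r, mul_smul _ _ _, fun s t => (h _ _).trans ?_⟩
    simp only [Matrix.SpecialLinearGroup.coe_mul, Matrix.mul_apply, Fin.sum_univ_two]
    push_cast
    ring

theorem SL_col_ne_zero (h : SL(2, ℤ)) : ¬ ((h 0 0 : ℝ) = 0 ∧ (h 1 0 : ℝ) = 0) := by
  rintro ⟨h0, h1⟩
  have hd := h.det_coe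
  rw [Matrix.det_fin_two] at hd
  have h0' : h 0 0 = 0 := by exact_mod_cast h0
  have h1' : h 1 0 = 0 := by exact_mod_cast h1
  simp [h0', h1'] at hd

/-- The form of a point is definite, while that of the cusp r∞ vanishes at the nonzero vector (-r₁₀,
r₀₀). -/
theorem not_isFormOf_point_cusp {q : ℝ → ℝ → ℝ} {z : ℍ} {c : OnePoint ℚ}
    (h : IsFormOf q (point z)) (h' : IsFormOf q (cusp c)) : False := by
  obtain ⟨k, hk, h⟩ := h
  obtain ⟨k', hk', r, -, h'⟩ := h'
  have e := (h (-r 1 0) (r 0 0)).symm.trans (h' (-r 1 0) (r 0 0))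
  have hy := z.im_pos
  have e0 : k' * (-(r 1 0 : ℝ) * r 0 0 + r 0 0 * r 1 0) ^ 2 = 0 := by ring
  rw [e0, mul_eq_zero, div_eq_zero_iff] at e
  rcases e with e | e | e
  · exact hk.ne' e
  · have e1 : (r 1 0 : ℝ) = 0 := by
      have : (-(r 1 0 : ℝ) * z.im) ^ 2 = 0 := le_antisymm (by nlinarith [sq_nonneg (-(r 1 0 : ℝ) * z.re + r 0 0)]) (sq_nonneg _)
      have := pow_eq_zero_iff (two_ne_zero) |>.1 this
      rcases mul_eq_zero.1 this with h | h
      · linarith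
      · exact absurd h hy.ne'
    rw [e1] at e
    simp at e
    exact SL_col_ne_zero r ⟨by exact_mod_cast e, e1⟩
  · exact hy.ne' e

/-- The values at (0,1), (1,0) and (1,1) give the scale, |z|² and |z + 1|², which determine z. A
cusp is recovered from the zero line of its form. -/
theorem IsFormOf.unique {q : ℝ → ℝ → ℝ} {x y : ExtendedUpperHalfPlane} (h : IsFormOf q x)
    (h' : IsFormOf q y) : x = y := by
  cases x with
  | point z =>
    cases y with
    | point w =>
      obtain ⟨c, hc, h⟩ := h
      obtain ⟨c', hc', h'⟩ := h'
      have e0 := (h 0 1).symm.trans (h' 0 1)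
      have e1 := (h 1 0).symm.trans (h' 1 0)
      have e2 := (h 1 1).symm.trans (h' 1 1)
      have hz := z.im_pos
      have hw := w.im_pos
      have a : c / z.im = c' / w.im := by
        have : c * (((0 * z.re + 1) ^ 2 + (0 * z.im) ^ 2) / z.im) = c / z.im := by ring
        rw [this] at e0
        rw [e0]; ring
      have a1 : c / z.im * (z.re ^ 2 + z.im ^ 2) = c / z.im * (w.re ^ 2 + w.im ^ 2) := by
        nth_rewrite 2 [a]
        ring_nf at e1 ⊢
        linarith
      have a2 : c / z.im * ((z.re + 1) ^ 2 + z.im ^ 2) =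
          c / z.im * ((w.re + 1) ^ 2 + w.im ^ 2) := by
        nth_rewrite 2 [a]
        ring_nf at e2 ⊢
        linarith
      have hpos : c / z.im ≠ 0 := (div_pos hc hz).ne'
      have b1 := mul_left_cancel₀ hpos a1
      have b2 := mul_left_cancel₀ hpos a2
      have r : z.re = w.re := by linarith
      have i : z.im = w.im := by
        rw [r] at b1
        nlinarith
      congr 1
      exact UpperHalfPlane.ext (Complex.ext r i)
    | cusp c => exact (not_isFormOf_point_cusp h h').elim
  | cusp c =>
    cases y with
    | point w => exact (not_isFormOf_point_cusp h' h).elim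
    | cusp c' =>
      obtain ⟨k, hk, r, rfl, h⟩ := h
      obtain ⟨k', hk', r', rfl, h'⟩ := h'
      congr 1
      rw [smul_infty_eq_smul_infty_iff]
      have e := (h (-r 1 0) (r 0 0)).symm.trans (h' (-r 1 0) (r 0 0))
      have e0 : k * (-(r 1 0 : ℝ) * r 0 0 + r 0 0 * r 1 0) ^ 2 = 0 := by ring
      rw [e0] at e
      rcases mul_eq_zero.1 e.symm with e | e
      · exact absurd e hk'.ne'
      · have e := pow_eq_zero_iff (two_ne_zero) |>.1 e
        have : (r 0 0 * r' 1 0 : ℝ) = r 1 0 * r' 0 0 := by linarith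
        exact_mod_cast this

theorem col_eq_of_smul_infty_eq {g h : SL(2, ℤ)}
    (e : g • (OnePoint.infty : OnePoint ℚ) = h • (OnePoint.infty : OnePoint ℚ)) :
    (g 0 0 = h 0 0 ∧ g 1 0 = h 1 0) ∨ (g 0 0 = - h 0 0 ∧ g 1 0 = - h 1 0) := by
  rw [eq_comm, ← inv_smul_eq_iff, smul_smul, smul_infty_iff] at e
  set r := g⁻¹ * h with hr
  have hgr : h = g * r := by simp [hr]
  have hd := r.det_coe
  rw [Matrix.det_fin_two, e, mul_zero, sub_zero] at hd
  have h00 : h 0 0 = g 0 0 * r 0 0 := by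
    rw [hgr]; simp [Matrix.mul_apply, Fin.sum_univ_two, e]
  have h10 : h 1 0 = g 1 0 * r 0 0 := by
    rw [hgr]; simp [Matrix.mul_apply, Fin.sum_univ_two, e]
  rcases Int.eq_one_or_neg_one_of_mul_eq_one hd with h1 | h1
  · left; simp [h00, h10, h1]
  · right; simp [h00, h10, h1]

theorem IsFormOf.proportional {q q' : ℝ → ℝ → ℝ} {x : ExtendedUpperHalfPlane}
    (h : IsFormOf q x) (h' : IsFormOf q' x) : ∃ c > 0, ∀ s t, q s t = c * q' s t := by
  cases x with
  | point z =>
    obtain ⟨c, hc, h⟩ := h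
    obtain ⟨c', hc', h'⟩ := h'
    refine ⟨c / c', div_pos hc hc', fun s t => ?_⟩
    rw [h, h', ← mul_assoc, div_mul_cancel₀ _ hc'.ne']
  | cusp c =>
    obtain ⟨k, hk, r, hr, h⟩ := h
    obtain ⟨k', hk', r', hr', h'⟩ := h'
    refine ⟨k / k', div_pos hk hk', fun s t => ?_⟩
    rw [h, h', ← mul_assoc, div_mul_cancel₀ _ hk'.ne']
    rcases col_eq_of_smul_infty_eq (hr.trans hr'.symm) with ⟨e0, e1⟩ | ⟨e0, e1⟩
    · rw [e0, e1]
    · rw [e0, e1]; push_cast; ring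

/-! ## The ideal triangle with vertices `∞`, `0`, `1` -/

/-- The determinant of the quadratic form `qform 1 l`. -/
def triDisc (l : Fin 3 → ℝ) : ℝ := l 0 * l 1 + l 0 * l 2 + l 1 * l 2

/-- The parametrization of the ideal triangle with vertices `∞`, `0`, `1` by the simplex. -/
def triMap (l : Fin 3 → ℝ) : ExtendedUpperHalfPlane :=
  if h : 0 < triDisc l ∧ 0 < l 1 + l 2 then
    point ⟨⟨l 2 / (l 1 + l 2), √(triDisc l) / (l 1 + l 2)⟩, div_pos (Real.sqrt_pos.2 h.1) h.2⟩
  else if l 0 ≠ 0 then cusp OnePoint.infty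
  else if l 1 ≠ 0 then cusp ((0 : ℚ) : OnePoint ℚ) else cusp ((1 : ℚ) : OnePoint ℚ)

theorem qform_one (l : Fin 3 → ℝ) (s t : ℝ) :
    qform 1 l s t = l 0 * s ^ 2 + l 1 * t ^ 2 + l 2 * (s + t) ^ 2 := by
  simp [qform, Fin.sum_univ_three, triVec]

/-- When `triDisc l` is positive, completing the square gives `qform 1 l` = (l₁ + l₂)|sz + t|² with
z the point chosen in `triMap`. Otherwise all the weight sits at one vertex, and the form is the
square of the corresponding linear form. -/
theorem isFormOf_triMap {l : Fin 3 → ℝ} (hl : l ∈ stdSimplex ℝ (Fin 3)) :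
    IsFormOf (qform 1 l) (triMap l) := by
  have h0 := hl.1 0
  have h1 := hl.1 1
  have h2 := hl.1 2
  have hs := hl.2
  rw [Fin.sum_univ_three] at hs
  unfold triMap
  split_ifs with h h' h''
  · obtain ⟨hD, hm⟩ := h
    refine ⟨√(triDisc l), Real.sqrt_pos.2 hD, fun s t => ?_⟩
    have hsq := Real.sq_sqrt hD.le
    have hpos := Real.sqrt_pos.2 hD
    change _ = √(triDisc l) * (((s * (l 2 / (l 1 + l 2)) + t) ^ 2 +
      (s * (√(triDisc l) / (l 1 + l 2))) ^ 2) / (√(triDisc l) / (l 1 + l 2)))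
    rw [qform_one]
    field_simp
    rw [hsq, triDisc]
    ring
  · have hD : ¬ 0 < l 1 + l 2 := by
      intro hm
      refine h ⟨?_, hm⟩
      have : 0 < l 0 * (l 1 + l 2) := mul_pos (lt_of_le_of_ne h0 (Ne.symm h')) hm
      have := mul_nonneg h1 h2
      unfold triDisc; linarith
    have e1 : l 1 = 0 := by linarith
    have e2 : l 2 = 0 := by linarith
    refine ⟨1, one_pos, 1, one_smul _ _, fun s t => ?_⟩
    rw [qform_one]
    simp [e1, e2, show l 0 = 1 by linarith]
  · push Not at h'
    have e2 : l 2 = 0 := by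
      by_contra e2
      refine h ⟨?_, ?_⟩
      · have := mul_pos (lt_of_le_of_ne h1 (Ne.symm h'')) (lt_of_le_of_ne h2 (Ne.symm e2))
        unfold triDisc; rw [h']; linarith
      · linarith
    refine ⟨1, one_pos, rot ℤ, ?_, fun s t => ?_⟩
    · change Matrix.SpecialLinearGroup.mapGL ℚ (rot ℤ) • (OnePoint.infty : OnePoint ℚ) = _
      rw [OnePoint.smul_infty_eq_ite]
      simp
    · rw [qform_one]
      simp [h', e2, show l 1 = 1 by linarith]
  · push Not at h' h''
    refine ⟨1, one_pos, lower 1, ?_, fun s t => ?_⟩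
    · change Matrix.SpecialLinearGroup.mapGL ℚ (lower (1 : ℤ)) • (OnePoint.infty : OnePoint ℚ) = _
      rw [OnePoint.smul_infty_eq_ite]
      simp
    · rw [qform_one]
      simp [h', h'', show l 2 = 1 by linarith]

theorem isFormOf_smul_triMap (g : SL(2, ℤ)) {l : Fin 3 → ℝ} (hl : l ∈ stdSimplex ℝ (Fin 3)) :
    IsFormOf (qform g l) (g • triMap l) := by
  have h := (isFormOf_triMap hl).smul g
  convert h using 3 with s t
  rw [← qform_mul, mul_one]

/-- A point determines its form up to a positive scalar, and conversely. Uniqueness of the Voronoi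
decomposition turns proportional forms into equal weights on ±-vectors. -/
theorem smul_triMap_eq_iff {g g' : SL(2, ℤ)} {l l' : Fin 3 → ℝ}
    (hl : l ∈ stdSimplex ℝ (Fin 3)) (hl' : l' ∈ stdSimplex ℝ (Fin 3)) :
    g • triMap l = g' • triMap l' ↔ SameBary g l g' l' := by
  constructor
  · intro h
    have h1 := isFormOf_smul_triMap g hl
    rw [h] at h1
    obtain ⟨c, hc, e⟩ := h1.proportional (isFormOf_smul_triMap g' hl')
    exact sameBary_of_qform_eq hc hl hl' e
  · intro h
    have h1 := isFormOf_smul_triMap g hl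
    have e : qform g l = qform g' l' := by ext s t; exact h.qform_eq s t
    rw [e] at h1
    exact h1.unique (isFormOf_smul_triMap g' hl')

/-- The barycentric coordinates of a point of the upper half plane with respect to the ideal
triangle with vertices `∞`, `0`, `1`. -/
def triCoord (z : ℍ) : Fin 3 → ℝ := fun k =>
  ![z.re ^ 2 + z.im ^ 2 - z.re, 1 - z.re, z.re] k / (z.re ^ 2 + z.im ^ 2 - z.re + 1)

theorem triCoord_denom_pos (z : ℍ) : 0 < z.re ^ 2 + z.im ^ 2 - z.re + 1 := by
  nlinarith [sq_nonneg (z.re - 1), sq_nonneg z.re, sq_nonneg z.im]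

theorem continuous_triCoord : Continuous triCoord := by
  refine continuous_pi fun k => ?_
  refine Continuous.div ?_ ?_ fun z => (triCoord_denom_pos z).ne'
  · fin_cases k <;> simp <;>
    fun_prop
  · fun_prop

/-- Comparing coefficients of the two forms gives l up to scale; the condition that the weights sum
to 1 fixes the scale and produces the denominator of `triCoord`. -/
theorem triMap_eq_point_iff {l : Fin 3 → ℝ} (hl : l ∈ stdSimplex ℝ (Fin 3)) (z : ℍ) :
    triMap l = point z ↔ l = triCoord z := by
  have hD := triCoord_denom_pos z
  have hy := z.im_pos
  constructor
  · intro h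
    have h1 := isFormOf_triMap hl
    rw [h] at h1
    obtain ⟨c, hc, h1⟩ := h1
    have e0 := h1 0 1
    have e1 := h1 1 0
    have e2 := h1 1 1
    rw [qform_one] at e0 e1 e2
    have hs := hl.2
    rw [Fin.sum_univ_three] at hs
    have f0 : l 1 + l 2 = c / z.im := by
      have : c * (((0 * z.re + 1) ^ 2 + (0 * z.im) ^ 2) / z.im) = c / z.im := by ring
      rw [this] at e0; linarith
    have f1 : l 0 + l 2 = c / z.im * (z.re ^ 2 + z.im ^ 2) := by
      have : c * (((1 * z.re + 0) ^ 2 + (1 * z.im) ^ 2) / z.im) =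
        c / z.im * (z.re ^ 2 + z.im ^ 2) := by ring
      rw [this] at e1; linarith
    have f2 : l 0 + l 1 + 4 * l 2 = c / z.im * ((z.re + 1) ^ 2 + z.im ^ 2) := by
      have : c * (((1 * z.re + 1) ^ 2 + (1 * z.im) ^ 2) / z.im) =
        c / z.im * ((z.re + 1) ^ 2 + z.im ^ 2) := by ring
      rw [this] at e2; linarith
    have g2 : l 2 = c / z.im * z.re := by linear_combination (f2 - f0 - f1) / 2
    have g1 : l 1 = c / z.im * (1 - z.re) := by linear_combination f0 - g2
    have g0 : l 0 = c / z.im * (z.re ^ 2 + z.im ^ 2 - z.re) := by linear_combination f1 - g2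
    have hr : c / z.im * (z.re ^ 2 + z.im ^ 2 - z.re + 1) = 1 := by
      linear_combination hs - g0 - g1 - g2
    have hr' : c / z.im = 1 / (z.re ^ 2 + z.im ^ 2 - z.re + 1) := by
      rw [eq_div_iff hD.ne', hr]
    rw [hr'] at g0 g1 g2
    ext k
    fin_cases k
    · change l 0 = (z.re ^ 2 + z.im ^ 2 - z.re) / _
      rw [g0]; ring
    · change l 1 = (1 - z.re) / _
      rw [g1]; ring
    · change l 2 = (z.re) / _
      rw [g2]; ring
  · rintro rfl
    refine (isFormOf_triMap hl).unique ⟨z.im / (z.re ^ 2 + z.im ^ 2 - z.re + 1), div_pos hy hD,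
      fun s t => ?_⟩
    rw [qform_one]
    simp only [triCoord, Matrix.cons_val_zero, Matrix.cons_val_one, Matrix.cons_val]
    field_simp
    ring

theorem triCoord_mem {z : ℍ} (h0 : 0 ≤ z.re) (h1 : z.re ≤ 1) (h2 : z.re ≤ z.re ^ 2 + z.im ^ 2) :
    triCoord z ∈ stdSimplex ℝ (Fin 3) := by
  have hD := triCoord_denom_pos z
  constructor
  · intro k
    refine div_nonneg ?_ hD.le
    fin_cases k <;> simp <;> linarith
  · simp only [triCoord, Fin.sum_univ_three, Matrix.cons_val_zero, Matrix.cons_val_one,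
      Matrix.cons_val]
    field_simp
    ring

/-- The translates of the ideal triangle cover the bordification. -/
theorem exists_smul_triMap_eq (x : ExtendedUpperHalfPlane) :
    ∃ g : SL(2, ℤ), ∃ l ∈ stdSimplex ℝ (Fin 3), g • triMap l = x := by
  cases x with
  | point z =>
    obtain ⟨g, hg⟩ : ∃ g : SL(2, ℤ), triCoord (g • z) ∈ stdSimplex ℝ (Fin 3) := by
      obtain ⟨g, hg⟩ := ModularGroup.exists_smul_mem_fd z
      obtain ⟨h1, h2⟩ := hg
      set w := g • z with hw
      have hn : 1 ≤ w.re ^ 2 + w.im ^ 2 := by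
        rw [Complex.normSq_apply] at h1
        have : (w : ℂ).re = w.re := rfl
        have : (w : ℂ).im = w.im := rfl
        simp at h1
        linarith
      have habs := abs_le.1 h2
      by_cases hr : 0 ≤ w.re
      · exact ⟨g, triCoord_mem hr (by linarith) (by linarith)⟩
      -- The right half of the standard fundamental domain lies in the ideal triangle 0 ≤ re ≤ 1, re
      -- ≤ |z|²; translation by 1 moves the left half into it.
      · refine ⟨ModularGroup.T * g, ?_⟩
        rw [mul_smul, ← hw]
        have e := UpperHalfPlane.modular_T_smul w
        have er : (ModularGroup.T • w).re = 1 + w.re := by rw [e]; simp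
        have ei : (ModularGroup.T • w).im = w.im := by rw [e]; simp
        refine triCoord_mem ?_ ?_ ?_
        · rw [er]; linarith
        · rw [er]; linarith
        · rw [er, ei]; nlinarith
    refine ⟨g⁻¹, _, hg, ?_⟩
    rw [(triMap_eq_point_iff hg _).2 rfl, smul_point, inv_smul_smul]
  | cusp c =>
    obtain ⟨g, hg⟩ := exists_smul_infty c
    refine ⟨g, Pi.single 0 1, single_mem_stdSimplex ℝ 0, ?_⟩
    rw [triMap, dif_neg (by simp [triDisc]), if_pos (by simp), smul_cusp, hg]

end ExtendedUpperHalfPlane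

end

noncomputable section

open Matrix

attribute [local instance] cuspAction

namespace ExtendedUpperHalfPlane

/-! ## Topology of the bordification and of the triangulation by ideal triangles -/

theorem isOpen_iff {U : Set ExtendedUpperHalfPlane} : IsOpen U ↔ IsOpen (point ⁻¹' U) ∧
    ∀ c : OnePoint ℚ, cusp c ∈ U → ∃ A : ℝ, ∀ z ∈ horoball c A, point z ∈ U := Iff.rfl

theorem continuous_point : Continuous point :=
  continuous_def.2 fun _ hU => (isOpen_iff.1 hU).1

theorem continuous_SL_smul (g : SL(2, ℤ)) : Continuous fun z : ℍ => g • z := by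
  change Continuous fun z : ℍ => (g : GL (Fin 2) ℝ) • z
  exact continuous_const_smul _

theorem continuous_smul_left (g : SL(2, ℤ)) :
    Continuous (fun x : ExtendedUpperHalfPlane => g • x) := by
  refine continuous_def.2 fun U hU => ⟨?_, fun c hc => ?_⟩
  · exact (isOpen_iff.1 hU).1.preimage (continuous_SL_smul g)
  · obtain ⟨A, hA⟩ := (isOpen_iff.1 hU).2 (g • c) hc
    refine ⟨A, ?_⟩
    rintro z ⟨h, rfl, hz⟩
    refine hA (g • z) ⟨g * h, mul_smul _ _ _, ?_⟩
    rw [_root_.mul_inv_rev, mul_smul, inv_smul_smul]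
    exact hz

/-- The height of z at the cusp g∞ depends only on the first column of g up to sign, which the cusp
determines. -/
theorem im_inv_smul_congr {g h : SL(2, ℤ)}
    (e : g • (OnePoint.infty : OnePoint ℚ) = h • (OnePoint.infty : OnePoint ℚ)) (z : ℍ) :
    (g⁻¹ • z).im = (h⁻¹ • z).im := by
  have key : ∀ g : SL(2, ℤ), ((g⁻¹ • z).im)⁻¹ =
      ((-g 1 0 * z.re + g 0 0) ^ 2 + (-g 1 0 * z.im) ^ 2) / z.im := by
    intro g
    have h := smul_form_eq g⁻¹ z 0 1
    have e0 : g⁻¹ 1 0 = - g 1 0 := by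
      simp [Matrix.SpecialLinearGroup.coe_inv, Matrix.adjugate_fin_two]
    have e1 : g⁻¹ 1 1 = g 0 0 := by
      simp [Matrix.SpecialLinearGroup.coe_inv, Matrix.adjugate_fin_two]
    rw [e0, e1] at h
    push_cast at h
    simpa using h
  rw [← _root_.inv_inj, key, key]
  rcases col_eq_of_smul_infty_eq e with ⟨e0, e1⟩ | ⟨e0, e1⟩
  · rw [e0, e1]
  · rw [e0, e1]; push_cast; ring

theorem triMap_shift (k : Fin 3) :
    ∃ h : SL(2, ℤ), ∀ l ∈ stdSimplex ℝ (Fin 3), triMap l = h • triMap (fun i => l (i + k)) := by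
  obtain ⟨h, hh, -⟩ := exists_sameBary_rot (1 : SL(2, ℤ)) k
  refine ⟨h, fun l hl => ?_⟩
  have := (smul_triMap_eq_iff hl (stdSimplex_shift hl k)).2 (hh l)
  rwa [one_smul, one_mul] at this

/-- Away from the vertex over ∞, the coordinates of the point are continuous functions of l. Near
that vertex, `triDisc l` ≥ l₀(l₁ + l₂) bounds the squared height below by l₀ / (l₁ + l₂), which
tends to infinity. -/
theorem continuousAt_triMap_of_pos (l : stdSimplex ℝ (Fin 3)) (h0 : 0 < l.1 0) :
    ContinuousAt (fun l : stdSimplex ℝ (Fin 3) => triMap l.1) l := by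
  have hc : ∀ k, Continuous fun m : stdSimplex ℝ (Fin 3) => m.1 k := fun k =>
    (continuous_apply k).comp continuous_subtype_val
  have hcD : Continuous fun m : stdSimplex ℝ (Fin 3) => triDisc m.1 := by
    unfold triDisc
    exact (((hc 0).mul (hc 1)).add ((hc 0).mul (hc 2))).add ((hc 1).mul (hc 2))
  by_cases hm : 0 < l.1 1 + l.1 2
  · have hD : 0 < triDisc l.1 := by
      have := mul_pos h0 hm
      have := mul_nonneg (l.2.1 1) (l.2.1 2)
      unfold triDisc; linarith
    set V : Set (stdSimplex ℝ (Fin 3)) := {m | 0 < triDisc m.1 ∧ 0 < m.1 1 + m.1 2}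
    have hV : IsOpen V := (isOpen_lt continuous_const hcD).inter
      (isOpen_lt continuous_const ((hc 1).add (hc 2)))
    refine ContinuousOn.continuousAt (s := V) ?_ (hV.mem_nhds ⟨hD, hm⟩)
    rw [continuousOn_iff_continuous_domRestrict]
    set F : V → ℍ := fun m => ⟨⟨m.1.1 2 / (m.1.1 1 + m.1.1 2), √(triDisc m.1.1) /
      (m.1.1 1 + m.1.1 2)⟩, div_pos (Real.sqrt_pos.2 m.2.1) m.2.2⟩ with hF
    have hFc : Continuous F := by
      rw [UpperHalfPlane.isEmbedding_coe.continuous_iff]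
      have e : (UpperHalfPlane.coe ∘ F) = fun m : V =>
          ((m.1.1 2 / (m.1.1 1 + m.1.1 2) : ℝ) : ℂ) + ((√(triDisc m.1.1) /
            (m.1.1 1 + m.1.1 2) : ℝ) : ℂ) * Complex.I := by
        ext m
        exact (Complex.re_add_im _).symm
      rw [e]
      have hs : Continuous fun m : V => m.1.1 1 + m.1.1 2 :=
        ((hc 1).add (hc 2)).comp continuous_subtype_val
      have h2 : Continuous fun m : V => m.1.1 2 := (hc 2).comp continuous_subtype_val
      have hr : Continuous fun m : V => √(triDisc m.1.1) :=
        (hcD.comp continuous_subtype_val).sqrt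
      exact (Complex.continuous_ofReal.comp (h2.div hs fun m => m.2.2.ne')).add
        ((Complex.continuous_ofReal.comp (hr.div hs fun m => m.2.2.ne')).mul continuous_const)
    refine (continuous_point.comp hFc).congr fun m => ?_
    simp only [Function.comp, Set.domRestrict_apply, triMap]
    have hm : 0 < triDisc m.1.1 ∧ 0 < m.1.1 1 + m.1.1 2 := m.2
    rw [dif_pos hm]
  · have h1 := l.2.1 1
    have h2 := l.2.1 2
    have e : triMap l.1 = cusp OnePoint.infty := by
      rw [triMap, dif_neg (fun h => hm h.2), if_pos h0.ne']
    rw [ContinuousAt, e, Filter.tendsto_def]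
    intro s hs
    obtain ⟨U, hUs, hU, hcU⟩ := mem_nhds_iff.1 hs
    obtain ⟨A, hA⟩ := (isOpen_iff.1 hU).2 _ hcU
    have hW : IsOpen {m : stdSimplex ℝ (Fin 3) | |A| ^ 2 * (m.1 1 + m.1 2) < m.1 0} :=
      isOpen_lt (continuous_const.mul ((hc 1).add (hc 2))) (hc 0)
    refine Filter.mem_of_superset (hW.mem_nhds ?_) ?_
    · have : l.1 1 + l.1 2 = 0 := by linarith
      simp only [Set.mem_ofPred_eq, this]
      simpa using h0
    · intro m hmW
      refine hUs ?_
      have hmW : |A| ^ 2 * (m.1 1 + m.1 2) < m.1 0 := hmW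
      have m1 := m.2.1 1
      have m2 := m.2.1 2
      have hm0 : 0 < m.1 0 := lt_of_le_of_lt (by positivity) hmW
      change triMap m.1 ∈ U
      unfold triMap
      split_ifs with h h'
      · refine hA _ ⟨1, one_smul _ _, ?_⟩
        rw [inv_one, one_smul]
        change A < √(triDisc m.1) / (m.1 1 + m.1 2)
        rw [lt_div_iff₀ h.2]
        refine lt_of_le_of_lt (mul_le_mul_of_nonneg_right (le_abs_self A) h.2.le) ?_
        rw [Real.lt_sqrt (mul_nonneg (abs_nonneg A) h.2.le)]
        have := mul_lt_mul_of_pos_right hmW h.2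
        have := mul_nonneg m1 m2
        unfold triDisc
        nlinarith
      · exact hcU
      · exact absurd hm0.ne' h'
      · exact absurd hm0.ne' h'

theorem continuous_triMap : Continuous (fun l : stdSimplex ℝ (Fin 3) => triMap l.1) := by
  refine continuous_iff_continuousAt.2 fun l => ?_
  obtain ⟨k, hk⟩ := sum_stdSimplex_exists_pos l.2
  obtain ⟨h, hh⟩ := triMap_shift k
  set S : stdSimplex ℝ (Fin 3) → stdSimplex ℝ (Fin 3) := fun m => ⟨_, stdSimplex_shift m.2 k⟩
  have hS : Continuous S := Continuous.subtype_mk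
    (continuous_pi fun i => (continuous_apply (i + k)).comp (continuous_subtype_val (p := (· ∈ stdSimplex ℝ (Fin 3))))) _
  have e : (fun l : stdSimplex ℝ (Fin 3) => triMap l.1) =
      (fun x => h • x) ∘ (fun l : stdSimplex ℝ (Fin 3) => triMap l.1) ∘ S := by
    ext m; exact hh m.1 m.2
  rw [e]
  refine (continuous_smul_left h).continuousAt.comp (ContinuousAt.comp ?_ hS.continuousAt)
  refine continuousAt_triMap_of_pos _ ?_
  simpa [S] using hk

/-- The normalized form |sz + t|² / im z has determinant 1 and SL(2, ℤ) preserves determinants, so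
the square of the scale is `triDisc l`. -/
theorem exists_scale {g : SL(2, ℤ)} {l : Fin 3 → ℝ} {z : ℍ} (hl : l ∈ stdSimplex ℝ (Fin 3))
    (h : g • triMap l = point z) : ∃ c > 0, c ^ 2 = triDisc l ∧ ∀ s t,
      qform g l s t = c * (((s * z.re + t) ^ 2 + (s * z.im) ^ 2) / z.im) := by
  set w := g⁻¹ • z with hw
  have hgw : g • w = z := by simp [hw]
  have h' : triMap l = point w := by
    rw [hw, ← smul_point, ← h, inv_smul_smul]
  have h1 := isFormOf_triMap hl
  rw [h'] at h1
  obtain ⟨c, hc, h1⟩ := h1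
  refine ⟨c, hc, ?_, fun s t => ?_⟩
  · have e0 := h1 0 1
    have e1 := h1 1 0
    have e2 := h1 1 1
    rw [qform_one] at e0 e1 e2
    have hy := w.im_pos
    generalize w.re = x at *
    generalize w.im = y at *
    field_simp at e0 e1 e2
    have f2 : l 2 * y = c * x := by linear_combination (e2 - e0 - e1) / 2
    have f3 : y ^ 2 * triDisc l = y ^ 2 * c ^ 2 := by
      unfold triDisc
      linear_combination (l 1 * y + l 2 * y) * e1 + c * (x ^ 2 + y ^ 2) * e0 -
        (l 2 * y + c * x) * f2
    exact (mul_left_cancel₀ (by positivity) f3).symm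
  · have := qform_mul g 1 l s t
    rw [mul_one] at this
    rw [this, h1, ← smul_form_eq, hgw]

theorem triDisc_le_one {l : Fin 3 → ℝ} (hl : l ∈ stdSimplex ℝ (Fin 3)) : triDisc l ≤ 1 := by
  have h0 := hl.1 0
  have h1 := hl.1 1
  have h2 := hl.1 2
  have hs := hl.2
  rw [Fin.sum_univ_three] at hs
  have : (l 0 + l 1 + l 2) ^ 2 = 1 := by rw [hs]; norm_num
  unfold triDisc
  nlinarith [mul_nonneg h0 h1, mul_nonneg h0 h2, mul_nonneg h1 h2]

theorem triVec_eq_of_snd_eq_zero {g : SL(2, ℤ)} {k : Fin 3} (h : triVec g k 1 = 0) :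
    triVec g k = ![1, 0] ∨ triVec g k = -![1, 0] := by
  obtain ⟨r, -, hr⟩ := exists_sameBary_rot g k
  have h1 : triVec (g * r) 0 1 = 0 := by
    rcases hr with e | e <;> rw [e] <;> simp [h]
  have h2 : triVec (g * r) 0 = ![1, 0] ∨ triVec (g * r) 0 = -![1, 0] := by
    rw [triVec_zero] at h1 ⊢
    simp only [Matrix.cons_val_one, Matrix.cons_val_zero] at h1
    have hd := (g * r).det_coe
    rw [Matrix.det_fin_two, h1, mul_zero, sub_zero] at hd
    rw [h1]
    rcases Int.eq_one_or_neg_one_of_mul_eq_one hd with e | e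
    · left; rw [e]
    · right; rw [e]; simp
  rcases hr with e | e
  · rwa [e] at h2
  · rw [e] at h2
    rcases h2 with h2 | h2
    · right; rw [← h2, neg_neg]
    · left; exact neg_injective h2

/-- A point of an ideal triangle with small weight at a cusp is far from this cusp. -/
theorem im_le_of_weight_le {g h : SL(2, ℤ)} {l : Fin 3 → ℝ} {z : ℍ} {ε : ℝ} (hε : 0 < ε)
    (hl : l ∈ stdSimplex ℝ (Fin 3)) (hz : g • triMap l = point z)
    (hw : ∑ k, l k * pmInd (triVec h 0) (triVec g k) ≤ 1 - ε) : (h⁻¹ • z).im ≤ 1 / ε := by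
  have hz' : (h⁻¹ * g) • triMap l = point (h⁻¹ • z) := by rw [mul_smul, hz, smul_point]
  obtain ⟨c, hc, hcD, e⟩ := exists_scale hl hz'
  have e := e 0 1
  have hy := (h⁻¹ • z).im_pos
  have hc1 : c ≤ 1 := by nlinarith [triDisc_le_one hl]
  -- At (0,1) the form sums the weighted squares of second coordinates. These are integers, nonzero
  -- except at vertices equal to ± the first column of h, and the other vertices have total weight
  -- at least ε. The same value is c / im (h⁻¹z) with c ≤ 1.
  have hlow : ε ≤ qform (h⁻¹ * g) l 0 1 := by
    have h1 : ∑ k, l k * (1 - pmInd (triVec h 0) (triVec g k)) ≤ qform (h⁻¹ * g) l 0 1 := by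
      refine Finset.sum_le_sum fun k _ => mul_le_mul_of_nonneg_left ?_ (hl.1 k)
      rw [zero_mul, zero_add, one_mul]
      by_cases hb : triVec (h⁻¹ * g) k 1 = 0
      · have e1 : triVec g k = triVec h 0 ∨ triVec g k = - triVec h 0 := by
          have eg : triVec g k = h.1 *ᵥ triVec (h⁻¹ * g) k := by
            rw [← triVec_mul, mul_inv_cancel_left]
          rcases triVec_eq_of_snd_eq_zero hb with e1 | e1
          · left; rw [eg, e1]; rfl
          · right; rw [eg, e1, Matrix.mulVec_neg]; rfl
        rw [pmInd, if_pos e1, hb]; simp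
      · have : (1 : ℝ) ≤ ((triVec (h⁻¹ * g) k 1 : ℤ) : ℝ) ^ 2 := by
          have h2 : 0 < (triVec (h⁻¹ * g) k 1) ^ 2 := by positivity
          exact_mod_cast h2
        linarith [pmInd_nonneg (triVec h 0) (triVec g k)]
    refine le_trans ?_ h1
    simp only [mul_sub, mul_one, Finset.sum_sub_distrib, hl.2]
    linarith
  have e3 : qform (h⁻¹ * g) l 0 1 = c / (h⁻¹ • z).im := by rw [e]; ring
  rw [e3, le_div_iff₀ hy] at hlow
  rw [le_div_iff₀ hε]
  linarith

theorem finite_entries_le (K : ℝ) : {g : SL(2, ℤ) | ∀ i j, |((g i j : ℤ) : ℝ)| ≤ K}.Finite := by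
  have hf : (Set.Icc (fun _ _ => -⌊K⌋ : Fin 2 → Fin 2 → ℤ) (fun _ _ => ⌊K⌋)).Finite :=
    Set.finite_Icc _ _
  refine Set.Finite.subset (hf.preimage (f := fun g : SL(2, ℤ) => (g.1 : Fin 2 → Fin 2 → ℤ))
    (fun a _ b _ e => Subtype.ext e)) ?_
  intro g hg
  have hg' : ∀ i j, |g i j| ≤ ⌊K⌋ := fun i j => Int.le_floor.2 (by exact_mod_cast hg i j)
  exact ⟨fun i j => (abs_le.1 (hg' i j)).1, fun i j => (abs_le.1 (hg' i j)).2⟩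

/-- The trace of the form is ∑ l_k |v_k|² ≤ cm, where c² = `triDisc l`. One of the three products in
`triDisc l` is at least c²/3, so for that pair |v_a|² |v_b|² ≤ 3m². Both factors are at least 1, so
both vectors are bounded, and the third vertex is their sum or difference up to sign. -/
theorem entries_le_of_mem {g : SL(2, ℤ)} {l : Fin 3 → ℝ} {z : ℍ} {m : ℝ}
    (hl : l ∈ stdSimplex ℝ (Fin 3)) (hz : g • triMap l = point z)
    (hm : (z.re ^ 2 + z.im ^ 2 + 1) / z.im ≤ m) (i j : Fin 2) :
    |((g i j : ℤ) : ℝ)| ≤ 6 * m ^ 2 := by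
  obtain ⟨c, hc, hcD, e⟩ := exists_scale hl hz
  have hy := z.im_pos
  set n : Fin 3 → ℝ := fun k => ((triVec g k 0 : ℤ) : ℝ) ^ 2 + ((triVec g k 1 : ℤ) : ℝ) ^ 2
    with hn
  have hm0 : 0 ≤ m := le_trans (by positivity) hm
  have hn1 : ∀ k, 1 ≤ n k := by
    intro k
    have h1 : 0 < triVec g k 0 ^ 2 + triVec g k 1 ^ 2 := by
      by_contra! hle
      have a0 : triVec g k 0 = 0 := by
        by_contra h; have : 0 < triVec g k 0 ^ 2 := by positivity
        nlinarith [sq_nonneg (triVec g k 1)]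
      have a1 : triVec g k 1 = 0 := by
        by_contra h; have : 0 < triVec g k 1 ^ 2 := by positivity
        nlinarith [sq_nonneg (triVec g k 0)]
      exact triVec_ne_zero g k (by ext i; fin_cases i; exacts [a0, a1])
    have h2 : (1 : ℤ) ≤ triVec g k 0 ^ 2 + triVec g k 1 ^ 2 := h1
    have h3 : ((1 : ℤ) : ℝ) ≤ ((triVec g k 0 ^ 2 + triVec g k 1 ^ 2 : ℤ) : ℝ) :=
      Int.cast_le.2 h2
    push_cast at h3
    exact h3
  have hsum : ∑ k, l k * n k ≤ c * m := by
    have e1 := e 1 0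
    have e2 := e 0 1
    have : ∑ k, l k * n k = qform g l 1 0 + qform g l 0 1 := by
      simp only [qform, hn, Fin.sum_univ_three]; ring
    rw [this, e1, e2, ← mul_add]
    refine mul_le_mul_of_nonneg_left (le_trans (le_of_eq ?_) hm) hc.le
    ring
  have hle : ∀ k, l k * n k ≤ c * m := fun k =>
    le_trans (Finset.single_le_sum (f := fun k => l k * n k)
      (fun k _ => mul_nonneg (hl.1 k) (by linarith [hn1 k])) (Finset.mem_univ k)) hsum
  have hpair : ∀ a b : Fin 3, c ^ 2 ≤ 3 * (l a * l b) → n a ≤ 3 * m ^ 2 ∧ n b ≤ 3 * m ^ 2 := by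
    intro a b hab
    have h1 := mul_le_mul (hle a) (hle b)
      (mul_nonneg (hl.1 b) (by linarith [hn1 b])) (by positivity)
    have hna := hn1 a
    have hnb := hn1 b
    have hp : n a * n b ≤ 3 * m ^ 2 := by
      have hnn : 0 ≤ n a * n b := by positivity
      have h2 : c ^ 2 * (n a * n b) ≤ c ^ 2 * (3 * m ^ 2) := by nlinarith
      exact le_of_mul_le_mul_left h2 (by positivity)
    constructor <;> nlinarith
  have hcoord : ∀ k i, n k ≤ 3 * m ^ 2 → |((triVec g k i : ℤ) : ℝ)| ≤ 3 * m ^ 2 := by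
    intro k i h
    have h1 : |((triVec g k i : ℤ) : ℝ)| ≤ ((triVec g k i : ℤ) : ℝ) ^ 2 := by
      have : |triVec g k i| ≤ triVec g k i ^ 2 := by
        rw [← sq_abs]; exact Int.le_self_sq _
      exact_mod_cast this
    have h2 : ((triVec g k i : ℤ) : ℝ) ^ 2 ≤ n k := by
      fin_cases i
      · exact le_add_of_nonneg_right (sq_nonneg _)
      · exact le_add_of_nonneg_left (sq_nonneg _)
    linarith
  have hgij : g i 0 = triVec g 0 i ∧ g i 1 = triVec g 1 i := by
    rw [triVec_zero, triVec_one]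
    fin_cases i <;> exact ⟨rfl, rfl⟩
  have h2 : ((triVec g 2 i : ℤ) : ℝ) = (triVec g 0 i : ℤ) + (triVec g 1 i : ℤ) := by
    rw [triVec_two]; push_cast [Pi.add_apply]; rfl
  suffices h : |((triVec g 0 i : ℤ) : ℝ)| ≤ 6 * m ^ 2 ∧ |((triVec g 1 i : ℤ) : ℝ)| ≤ 6 * m ^ 2 by
    fin_cases j
    · exact hgij.1 ▸ h.1
    · exact hgij.2 ▸ h.2
  -- The largest of three numbers with sum c² is at least c² / 3.
  have hcases : c ^ 2 ≤ 3 * (l 0 * l 1) ∨ c ^ 2 ≤ 3 * (l 0 * l 2) ∨ c ^ 2 ≤ 3 * (l 1 * l 2) := by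
    by_contra! h
    rw [hcD, triDisc] at h
    linarith [h.1, h.2.1, h.2.2]
  have hmm := sq_nonneg m
  rcases hcases with h | h | h
  · have a := hcoord 0 i (hpair 0 1 h).1
    have b := hcoord 1 i (hpair 0 1 h).2
    exact ⟨by linarith, by linarith⟩
  · have a := hcoord 0 i (hpair 0 2 h).1
    have b := hcoord 2 i (hpair 0 2 h).2
    rw [h2] at b
    rw [abs_le] at a b ⊢
    rw [abs_le]
    exact ⟨⟨by linarith, by linarith⟩, by linarith, by linarith⟩
  · have a := hcoord 1 i (hpair 1 2 h).1
    have b := hcoord 2 i (hpair 1 2 h).2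
    rw [h2] at b
    rw [abs_le] at a b ⊢
    rw [abs_le]
    exact ⟨⟨by linarith, by linarith⟩, by linarith, by linarith⟩

/-- The bound of `entries_le_of_mem` is uniform where the continuous function M is bounded, and only
finitely many integer matrices satisfy it. -/
theorem locallyFinite_triangles : LocallyFinite fun g : SL(2, ℤ) =>
    {z : ℍ | ∃ l ∈ stdSimplex ℝ (Fin 3), g • triMap l = point z} := by
  intro z₀
  set M : ℍ → ℝ := fun z => (z.re ^ 2 + z.im ^ 2 + 1) / z.im
  have hM : Continuous M := by
    refine Continuous.div ?_ ?_ fun z => z.im_pos.ne' <;> fun_prop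
  refine ⟨{z | M z < M z₀ + 1}, (isOpen_lt hM continuous_const).mem_nhds (by simp), ?_⟩
  refine (finite_entries_le (6 * (M z₀ + 1) ^ 2)).subset ?_
  rintro g ⟨z, ⟨l, hl, hz⟩, hzM⟩ i j
  exact entries_le_of_mem hl hz (le_of_lt hzM) i j

/-- A union of closed pieces of ideal triangles is closed if near each cusp it has small weight. -/
theorem isClosed_iUnion_triangles (D : SL(2, ℤ) → Set (Fin 3 → ℝ))
    (hD : ∀ g, D g ⊆ stdSimplex ℝ (Fin 3)) (hDc : ∀ g, IsClosed (D g))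
    (hcusp : ∀ h : SL(2, ℤ), (¬ ∃ g, ∃ l ∈ D g, g • triMap l = cusp (h • OnePoint.infty)) →
      ∃ ε > 0, ∀ g, ∀ l ∈ D g, ∑ k, l k * pmInd (triVec h 0) (triVec g k) ≤ 1 - ε) :
    IsClosed {x | ∃ g, ∃ l ∈ D g, g • triMap l = x} := by
  rw [← isOpen_compl_iff, isOpen_iff]
  constructor
  · rw [Set.preimage_compl, isOpen_compl_iff]
    have e : point ⁻¹' {x | ∃ g, ∃ l ∈ D g, g • triMap l = x} =
        ⋃ g : SL(2, ℤ), {z : ℍ | ∃ l ∈ D g, g • triMap l = point z} := by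
      ext z; simp
    rw [e]
    refine LocallyFinite.isClosed_iUnion (locallyFinite_triangles.subset ?_) ?_
    · rintro g z ⟨l, hl, hz⟩
      exact ⟨l, hD g hl, hz⟩
    · intro g
      -- Inside ℍ the weights are the continuous function `triCoord`, so each piece is the preimage
      -- of a closed set.
      have e : {z : ℍ | ∃ l ∈ D g, g • triMap l = point z} =
          (fun z => triCoord (g⁻¹ • z)) ⁻¹' D g := by
        ext z
        constructor
        · rintro ⟨l, hl, hz⟩
          have : triMap l = point (g⁻¹ • z) := by rw [← smul_point, ← hz, inv_smul_smul]
          rw [triMap_eq_point_iff (hD g hl)] at this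
          change triCoord (g⁻¹ • z) ∈ D g
          exact this ▸ hl
        · intro hz
          refine ⟨_, hz, ?_⟩
          rw [(triMap_eq_point_iff (hD g hz) _).2 rfl, smul_point, smul_inv_smul]
      rw [e]
      exact (hDc g).preimage (continuous_triCoord.comp (continuous_SL_smul _))
  · intro c hc
    obtain ⟨h, rfl⟩ := exists_smul_infty c
    obtain ⟨ε, hε, hw⟩ := hcusp h hc
    -- By `im_le_of_weight_le`, no point of the union has height above 1 / ε at this cusp.
    refine ⟨1 / ε, ?_⟩
    rintro z ⟨r, hr, hz⟩ ⟨g, l, hl, hgl⟩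
    have := im_le_of_weight_le hε (hD g hl) hgl (hw g l hl)
    rw [im_inv_smul_congr hr] at hz
    linarith

end ExtendedUpperHalfPlane

end

noncomputable section

open Matrix

/-! ## Realizations of finite complexes -/

namespace Realization

variable {ι : Type*} {K : PreAbstractSimplicialComplex ι}

theorem faceMap_apply {s : Finset ι} (hs : s ∈ K.faces) (y : stdSimplex ℝ s) {i : ι}
    (hi : i ∈ s) : (faceMap K s hs y).1 i = y.1 ⟨i, hi⟩ :=
  Finsupp.embDomain_apply_self (Function.Embedding.subtype (· ∈ s))
    (Finsupp.equivFunOnFinite.symm y.1) ⟨i, hi⟩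

theorem faceMap_apply_of_notMem {s : Finset ι} (hs : s ∈ K.faces) (y : stdSimplex ℝ s) {i : ι}
    (hi : i ∉ s) : (faceMap K s hs y).1 i = 0 := by
  refine Finsupp.embDomain_of_notMem_range _ _ _ ?_
  rintro ⟨j, rfl⟩
  exact hi j.2

theorem ext' {x y : Realization K} (h : ∀ i, x.1 i = y.1 i) : x = y :=
  Subtype.ext (Finsupp.ext h)

theorem continuous_faceMap (s : Finset ι) (hs : s ∈ K.faces) : Continuous (faceMap K s hs) :=
  continuous_iff_coinduced_le.2 (le_iSup (fun s : {s : Finset ι // s ∈ K.faces} =>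
    TopologicalSpace.coinduced (faceMap K s.1 s.2) inferInstance) ⟨s, hs⟩)

theorem continuous_iff_faceMap {X : Type*} [TopologicalSpace X] {f : Realization K → X} :
    Continuous f ↔ ∀ s hs, Continuous (f ∘ faceMap K s hs) := by
  constructor
  · exact fun h s hs => h.comp (continuous_faceMap s hs)
  · intro h
    refine continuous_iSup_dom.2 fun s => ?_
    exact continuous_coinduced_dom.2 (h s.1 s.2)

theorem continuous_coord (i : ι) : Continuous fun x : Realization K => x.1 i := by
  refine continuous_iff_faceMap.2 fun s hs => ?_
  by_cases hi : i ∈ s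
  · refine (((continuous_apply (⟨i, hi⟩ : s)).comp continuous_subtype_val)).congr fun y => ?_
    exact (faceMap_apply hs y hi).symm
  · refine (continuous_const (y := (0 : ℝ))).congr fun y => ?_
    exact (faceMap_apply_of_notMem hs y hi).symm

theorem continuous_coords : Continuous fun (x : Realization K) (i : ι) => x.1 i :=
  continuous_pi continuous_coord

theorem injective_coords : Function.Injective fun (x : Realization K) (i : ι) => x.1 i :=
  fun _ _ h => ext' fun i => congrFun h i

instance : T2Space (Realization K) :=
  T2Space.of_injective_continuous injective_coords continuous_coords

theorem exists_faceMap_eq (x : Realization K) : ∃ y, faceMap K x.1.support x.2.1 y = x := by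
  refine ⟨⟨fun i => x.1 i, fun i => x.2.2.1 i, ?_⟩, ?_⟩
  · rw [Finset.sum_coe_sort x.1.support (fun i => x.1 i)]
    exact x.2.2.2
  · refine ext' fun i => ?_
    by_cases hi : i ∈ x.1.support
    · rw [faceMap_apply _ _ hi]
    · rw [faceMap_apply_of_notMem _ _ hi, Finsupp.notMem_support_iff.1 hi]

theorem compactSpace (hK : K.faces.Finite) : CompactSpace (Realization K) := by
  have := hK.to_subtype
  refine ⟨?_⟩
  have : (Set.univ : Set (Realization K)) = ⋃ s : K.faces, Set.range (faceMap K s.1 s.2) := by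
    refine (Set.eq_univ_of_forall fun x => ?_).symm
    obtain ⟨y, hy⟩ := exists_faceMap_eq x
    exact Set.mem_iUnion.2 ⟨⟨_, x.2.1⟩, y, hy⟩
  rw [this]
  exact isCompact_iUnion fun s => isCompact_range (continuous_faceMap s.1 s.2)

/-- For a finite complex the weak topology is compact, so the continuous injection into the
Hausdorff product of coordinates is a closed embedding. Continuity into the realization can then be
tested on coordinates. -/
theorem isClosedEmbedding_coords (hK : K.faces.Finite) :
    Topology.IsClosedEmbedding fun (x : Realization K) (i : ι) => x.1 i := by
  have := compactSpace hK
  exact continuous_coords.isClosedEmbedding injective_coords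

theorem continuous_of_coord (hK : K.faces.Finite) {X : Type*} [TopologicalSpace X]
    {f : X → Realization K} (h : ∀ i, Continuous fun x => (f x).1 i) : Continuous f :=
  (isClosedEmbedding_coords hK).isEmbedding.continuous_iff.2 (continuous_pi h)

theorem coord_le_one (x : Realization K) (i : ι) : x.1 i ≤ 1 := by
  by_cases hi : i ∈ x.1.support
  · have h : ∑ k ∈ x.1.support, x.1 k = 1 := x.2.2.2
    exact (Finset.single_le_sum (f := fun i => x.1 i) (fun i _ => x.2.2.1 i) hi).trans_eq h
  · rw [Finsupp.notMem_support_iff.1 hi]; exact zero_le_one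

theorem eq_single_of_coord_eq_one (x : Realization K) {i : ι} (h : x.1 i = 1) :
    x.1 = Finsupp.single i 1 := by
  classical
  ext j
  by_cases hj : i = j
  · subst hj; simp [h]
  · rw [Finsupp.single_eq_of_ne (Ne.symm hj)]
    by_contra hx
    have hi : i ∈ x.1.support := by simp [h]
    have hj' : j ∈ x.1.support := by simpa using hx
    have h1 : x.1 i + x.1 j ≤ ∑ k ∈ x.1.support, x.1 k := by
      rw [← Finset.sum_pair (f := fun k => x.1 k) hj]
      refine Finset.sum_le_sum_of_subset_of_nonneg ?_ fun k _ _ => x.2.2.1 k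
      intro k hk
      rcases Finset.mem_insert.1 hk with rfl | hk
      · exact hi
      · rw [Finset.mem_singleton.1 hk]; exact hj'
    have h2 : ∑ k ∈ x.1.support, x.1 k = 1 := x.2.2.2
    have h3 : 0 < x.1 j := lt_of_le_of_ne (x.2.2.1 j) (Ne.symm hx)
    linarith

end Realization

/-! ## Faces of `BDA 2` over a field -/

theorem pmSet_eq_iff {n : ℕ} {R : Type*} [CommRing R] {v w : Fin n → R} :
    pmSet v = pmSet w ↔ v = w ∨ v = -w := by
  constructor
  · intro h
    have : v ∈ pmSet w := h ▸ (Or.inl rfl : v ∈ pmSet v)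
    exact this
  · rintro (rfl | rfl)
    · rfl
    · simp [pmSet, Set.pair_comm]

/-- The `k`-th vertex of the triangle attached to `g`, as a ±-vector. -/
def triVertex {R : Type*} [CommRing R] [Nontrivial R] (g : SL(2, R)) (k : Fin 3) : PMVector 2 R :=
  ⟨pmSet (triVec g k), triVec g k, triVec_ne_zero g k, rfl⟩

theorem triVertex_eq_iff {R : Type*} [CommRing R] [Nontrivial R] {g h : SL(2, R)}
    {k l : Fin 3} :
    triVertex g k = triVertex h l ↔ triVec g k = triVec h l ∨ triVec g k = - triVec h l := by
  rw [← pmSet_eq_iff]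
  exact Subtype.ext_iff

theorem triVec_injective_pm {R : Type*} [CommRing R] [Nontrivial R] (h2 : (2 : R) ≠ 0)
    (g : SL(2, R)) {k l : Fin 3} (h : triVec g k = triVec g l ∨ triVec g k = - triVec g l) :
    k = l := by
  have h' : baseVec R k = baseVec R l ∨ baseVec R k = - baseVec R l := by
    have e : ∀ k, baseVec R k = (g⁻¹).1 *ᵥ triVec g k := by
      intro k
      rw [← triVec_mul, inv_mul_cancel]; simp [triVec]
    rw [e k, e l]
    rcases h with h | h
    · left; rw [h]
    · right; rw [h, Matrix.mulVec_neg]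
  have h3 : (1 : R) ≠ -1 := fun h => h2 (by linear_combination h)
  fin_cases k <;> fin_cases l <;> simp [h3] at h' ⊢

theorem triVertex_injective {R : Type*} [CommRing R] [Nontrivial R] (h2 : (2 : R) ≠ 0)
    (g : SL(2, R)) : Function.Injective (triVertex g) :=
  fun _ _ h => triVec_injective_pm h2 g (triVertex_eq_iff.1 h)

/-- The matrix with two prescribed columns. -/
def ofCols {R : Type*} [CommRing R] (v w : Fin 2 → R) (h : v 0 * w 1 - w 0 * v 1 = 1) :
    SL(2, R) :=
  ⟨!![v 0, w 0; v 1, w 1], by rw [Matrix.det_fin_two_of, h]⟩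

theorem triVec_ofCols {R : Type*} [CommRing R] (v w : Fin 2 → R)
    (h : v 0 * w 1 - w 0 * v 1 = 1) :
    triVec (ofCols v w h) 0 = v ∧ triVec (ofCols v w h) 1 = w ∧
      triVec (ofCols v w h) 2 = v + w := by
  have h0 : triVec (ofCols v w h) 0 = v := by
    rw [triVec_zero]; ext i; fin_cases i <;> rfl
  have h1 : triVec (ofCols v w h) 1 = w := by
    rw [triVec_one]; ext i; fin_cases i <;> rfl
  exact ⟨h0, h1, by rw [triVec_two, h0, h1]⟩

theorem exists_tri_of_det {R : Type*} [CommRing R] {a b : Fin 2 → R}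
    (h : a 0 * b 1 - b 0 * a 1 = 1 ∨ a 0 * b 1 - b 0 * a 1 = -1) :
    ∃ g : SL(2, R), (∃ k, a = triVec g k) ∧ (∃ k, b = triVec g k) ∧ ∃ k, a + b = triVec g k := by
  rcases h with h | h
  · obtain ⟨h0, h1, h2⟩ := triVec_ofCols a b h
    exact ⟨_, ⟨0, h0.symm⟩, ⟨1, h1.symm⟩, ⟨2, h2.symm⟩⟩
  · obtain ⟨h0, h1, h2⟩ := triVec_ofCols b a (by linear_combination -h)
    exact ⟨_, ⟨1, h1.symm⟩, ⟨0, h0.symm⟩, ⟨2, by rw [h2, add_comm]⟩⟩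

theorem IsDetOneVectors.det_pair {R : Type*} [CommRing R] {B : Set (Fin 2 → R)}
    (hB : IsDetOneVectors B) {v w : Fin 2 → R} (hv : v ∈ B) (hw : w ∈ B) (hne : v ≠ w) :
    B = {v, w} ∧ (v 0 * w 1 - w 0 * v 1 = 1 ∨ v 0 * w 1 - w 0 * v 1 = -1) := by
  obtain ⟨⟨b, hb⟩, hdet⟩ := hB
  have hB2 : B = {v, w} := by
    have hfin : (Set.range b).Finite := Set.finite_range b
    have hle : (Set.range b).ncard ≤ 2 := by
      have := Set.ncard_image_le (f := b) (s := Set.univ) Set.finite_univ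
      simpa [Set.image_univ, Set.ncard_univ] using this
    symm
    refine Set.eq_of_subset_of_ncard_le ?_ ?_ (hfin.subset hb)
    · rintro x (rfl | rfl)
      exacts [hv, hw]
    · rw [Set.ncard_pair hne]
      exact (Set.ncard_le_ncard hb hfin).trans hle
  refine ⟨hB2, ?_⟩
  have := hdet ![v, w] ?_ ?_
  · rw [Matrix.det_fin_two] at this
    simpa using this
  · intro i j hij
    fin_cases i <;> fin_cases j <;> simp_all
  · rw [hB2]; ext x; simp [eq_comm, or_comm]

theorem exists_tri_of_ne_zero {K : Type*} [Field K] {v : Fin 2 → K} (hv : v ≠ 0) :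
    ∃ g : SL(2, K), triVec g 0 = v := by
  by_cases h0 : v 0 = 0
  · have h1 : v 1 ≠ 0 := by
      intro h1; apply hv; ext i; fin_cases i
      exacts [h0, h1]
    exact ⟨_, (triVec_ofCols v ![-(v 1)⁻¹, 0] (by simp [h1])).1⟩
  · exact ⟨_, (triVec_ofCols v ![0, (v 0)⁻¹] (by simp [h0])).1⟩

theorem isDetOneVectors_cols {R : Type*} [CommRing R] (g : SL(2, R)) :
    IsDetOneVectors {triVec g 0, triVec g 1} := by
  have hM : ∀ w : Fin 2 → Fin 2 → R, (Pi.basisFun R (Fin 2)).toMatrix w =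
      Matrix.of fun i j => w j i := by
    intro w; ext i j; simp [Module.Basis.toMatrix_apply]
  have hd := g.det_coe
  rw [Matrix.det_fin_two] at hd
  constructor
  · have hbas := (Module.Basis.is_basis_iff_det (Pi.basisFun R (Fin 2))
      (v := ![triVec g 0, triVec g 1])).2 (by
        rw [Module.Basis.det_apply, hM, Matrix.det_fin_two]
        simp [triVec_zero, triVec_one, hd])
    refine ⟨Module.Basis.mk hbas.1 hbas.2.ge, ?_⟩
    rw [Module.Basis.coe_mk]
    rintro x (rfl | rfl)
    · exact ⟨0, rfl⟩
    · exact ⟨1, rfl⟩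
  · intro w hw hwr
    have h0 : w 0 ∈ ({triVec g 0, triVec g 1} : Set _) := hwr ▸ ⟨0, rfl⟩
    have h1 : w 1 ∈ ({triVec g 0, triVec g 1} : Set _) := hwr ▸ ⟨1, rfl⟩
    have hne : w 0 ≠ w 1 := fun h => by simpa using hw h
    rw [Matrix.det_fin_two]
    rcases h0 with h0 | h0 <;> rcases h1 with h1 | h1
    · exact absurd (h0.trans h1.symm) hne
    · left
      rw [Set.mem_singleton_iff] at h1
      simp [h0, h1, triVec_zero, triVec_one, hd]
    · right
      rw [Set.mem_singleton_iff] at h0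
      simp [h0, h1, triVec_zero, triVec_one]
      linear_combination -hd
    · exact absurd (h0.trans h1.symm) hne

/-- A nonzero vector extends to a basis of determinant 1, and a pair of determinant ±1 can be
reordered to have determinant 1. In an augmented basis the signs can be absorbed so that v₀ is the
sum of the other two vectors. -/
theorem mem_BDA_faces_iff {K : Type*} [Field K] {s : Finset (PMVector 2 K)} :
    s ∈ (BDA 2 K).faces ↔ s.Nonempty ∧ ∃ g : SL(2, K), ∀ x ∈ s, ∃ k, x = triVertex g k := by
  classical
  constructor
  · rintro ⟨hne, h⟩
    refine ⟨hne, ?_⟩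
    suffices H : ∃ (C : Set (Fin 2 → K)) (g : SL(2, K)), _root_.Represents C s ∧
        ∀ v ∈ C, ∃ k, v = triVec g k by
      obtain ⟨C, g, hC, hg⟩ := H
      refine ⟨g, fun x hx => ?_⟩
      have : x.1 ∈ pmSet '' C := hC ▸ ⟨x, hx, rfl⟩
      obtain ⟨v, hv, hvx⟩ := this
      obtain ⟨k, rfl⟩ := hg v hv
      exact ⟨k, Subtype.ext hvx.symm⟩
    rcases h with ⟨B, hB, hBs⟩ | ⟨B, v₀, v₁, v₂, l, m, hB, h₁, h₂, hne, hl, hm, h₀, hBs⟩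
    · by_cases hpair : ∃ v ∈ B, ∃ w ∈ B, v ≠ w
      · obtain ⟨v, hv, w, hw, hvw⟩ := hpair
        obtain ⟨hB2, hd⟩ := hB.det_pair hv hw hvw
        obtain ⟨g, ⟨k, hk⟩, ⟨k', hk'⟩, -⟩ := exists_tri_of_det hd
        refine ⟨B, g, hBs, ?_⟩
        rw [hB2]
        rintro x (rfl | rfl)
        exacts [⟨k, hk⟩, ⟨k', hk'⟩]
      · push Not at hpair
        obtain ⟨x, hx⟩ := hne
        have : x.1 ∈ pmSet '' B := hBs ▸ ⟨x, hx, rfl⟩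
        obtain ⟨v, hv, hvx⟩ := this
        have hv0 : v ≠ 0 := by
          obtain ⟨w, hw, e⟩ := x.2
          rw [e, pmSet_eq_iff] at hvx
          rcases hvx with rfl | rfl
          · exact hw
          · simpa using hw
        obtain ⟨g, hg⟩ := exists_tri_of_ne_zero hv0
        exact ⟨B, g, hBs, fun w hw => ⟨0, by rw [hg]; exact (hpair v hv w hw).symm⟩⟩
    · obtain ⟨hB2, hd⟩ := hB.det_pair h₁ h₂ hne
      have hd' : (l • v₁) 0 * (m • v₂) 1 - (m • v₂) 0 * (l • v₁) 1 = 1 ∨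
          (l • v₁) 0 * (m • v₂) 1 - (m • v₂) 0 * (l • v₁) 1 = -1 := by
        have e : (l • v₁) 0 * (m • v₂) 1 - (m • v₂) 0 * (l • v₁) 1 =
          l * m * (v₁ 0 * v₂ 1 - v₂ 0 * v₁ 1) := by
          simp only [Pi.smul_apply, smul_eq_mul]; ring
        rw [e]
        rcases hl with rfl | rfl <;> rcases hm with rfl | rfl <;> rcases hd with h | h <;>
          rw [h] <;> simp
      obtain ⟨g, hk1, hk2, hk0⟩ := exists_tri_of_det hd'
      -- Multiplying v₁ and v₂ by the signs does not change the ±-vectors, and makes v₀ the plain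
      -- sum.
      refine ⟨{v₀, l • v₁, m • v₂}, g, ?_, ?_⟩
      · unfold _root_.Represents at *
        rw [hBs, hB2]
        have el : pmSet (l • v₁) = pmSet v₁ := pmSet_eq_iff.2 (by rcases hl with rfl | rfl <;> simp)
        have em : pmSet (m • v₂) = pmSet v₂ := pmSet_eq_iff.2 (by rcases hm with rfl | rfl <;> simp)
        simp only [Set.image_insert_eq, Set.image_singleton, el, em]
      · rintro x (rfl | rfl | rfl)
        · rw [h₀]; exact hk0
        · exact hk1
        · exact hk2
  · rintro ⟨hne, g, hg⟩
    refine ⟨hne, isAugDetOnePMBasis_subset (s := Finset.univ.image (triVertex g)) (Or.inr ?_) ?_⟩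
    · refine ⟨{triVec g 0, triVec g 1}, triVec g 2, triVec g 0, triVec g 1, 1, 1,
        isDetOneVectors_cols g, Or.inl rfl, Or.inr rfl, ?_, Or.inl rfl, Or.inl rfl, ?_, ?_⟩
      · intro h
        have hd := g.det_coe
        rw [triVec_zero, triVec_one] at h
        have h0 := congrFun h 0
        have h1 := congrFun h 1
        simp at h0 h1
        rw [Matrix.det_fin_two, h0, h1] at hd
        simp at hd
      · rw [one_smul, one_smul, triVec_two]
      · unfold _root_.Represents
        ext y
        simp only [Finset.coe_image, Finset.coe_univ, Set.image_univ, Set.image_insert_eq,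
          Set.image_singleton]
        constructor
        · rintro ⟨_, ⟨k, rfl⟩, rfl⟩
          fin_cases k
          · exact Or.inr (Or.inl rfl)
          · exact Or.inr (Or.inr rfl)
          · exact Or.inl rfl
        · rintro (rfl | rfl | rfl)
          · exact ⟨_, ⟨2, rfl⟩, rfl⟩
          · exact ⟨_, ⟨0, rfl⟩, rfl⟩
          · exact ⟨_, ⟨1, rfl⟩, rfl⟩
    · intro x hx
      obtain ⟨k, rfl⟩ := hg x hx
      exact Finset.mem_image_of_mem _ (Finset.mem_univ k)

instance {n : ℕ} {R : Type*} [CommRing R] [Finite R] : Finite (PMVector n R) :=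
  inferInstanceAs (Finite {s : Set (Fin n → R) // ∃ v, v ≠ 0 ∧ s = pmSet v})

theorem BDA_faces_finite {n : ℕ} {R : Type*} [CommRing R] [Finite R] : (BDA n R).faces.Finite := by
  exact Set.toFinite _

end

noncomputable section

open Matrix

attribute [local instance] cuspAction

/-! ## The homeomorphism with the modular curve -/

/-- The weighted vertices of the triangle attached to `g`. -/
def baryFinsupp {R : Type*} [CommRing R] [Nontrivial R] (g : SL(2, R)) (l : Fin 3 → ℝ) :
    PMVector 2 R →₀ ℝ := ∑ k, Finsupp.single (triVertex g k) (l k)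

theorem baryFinsupp_apply {R : Type*} [CommRing R] [Nontrivial R] (g : SL(2, R))
    (l : Fin 3 → ℝ) {x : PMVector 2 R} {w : Fin 2 → R} (hx : x.1 = pmSet w) :
    baryFinsupp g l x = ∑ k, l k * pmInd w (triVec g k) := by
  classical
  rw [baryFinsupp, Finsupp.finsetSum_apply]
  refine Finset.sum_congr rfl fun k _ => ?_
  rw [Finsupp.single_apply, pmInd]
  have : triVertex g k = x ↔ (triVec g k = w ∨ triVec g k = -w) := by
    rw [← pmSet_eq_iff, ← hx]; exact Subtype.ext_iff
  simp only [this]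
  split_ifs <;> simp

/-- An even function on vectors is a function on ±-vectors, hence a linear functional on finitely
supported families. Conversely the indicators `pmInd` are even and recover the coordinates. -/
theorem baryFinsupp_eq_iff {R : Type*} [CommRing R] [Nontrivial R] {g g' : SL(2, R)}
    {l l' : Fin 3 → ℝ} : baryFinsupp g l = baryFinsupp g' l' ↔ SameBary g l g' l' := by
  constructor
  · intro h f hf
    have hrep : ∀ x : PMVector 2 R, ∃ v, x.1 = pmSet v := fun x => by
      obtain ⟨v, -, hv⟩ := x.2; exact ⟨v, hv⟩
    choose rep hrep using hrep
    have hfr : ∀ (g : SL(2, R)) k, f (rep (triVertex g k)) = f (triVec g k) := by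
      intro g k
      have : pmSet (triVec g k) = pmSet (rep (triVertex g k)) := hrep (triVertex g k)
      rcases pmSet_eq_iff.1 this with e | e
      · rw [← e]
      · rw [e, hf]
    have key : ∀ (g : SL(2, R)) (l : Fin 3 → ℝ),
        Finsupp.linearCombination ℝ (fun x => f (rep x)) (baryFinsupp g l) =
          ∑ k, l k * f (triVec g k) := by
      intro g l
      simp only [baryFinsupp, map_sum, Finsupp.linearCombination_single, hfr, smul_eq_mul]
    rw [← key, ← key, h]
  · intro h
    ext x
    obtain ⟨w, -, hw⟩ := x.2
    rw [baryFinsupp_apply g l hw, baryFinsupp_apply g' l' hw]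
    exact h _ (pmInd_neg w)

theorem baryFinsupp_nonneg {R : Type*} [CommRing R] [Nontrivial R] (g : SL(2, R))
    {l : Fin 3 → ℝ} (hl : ∀ k, 0 ≤ l k) (x : PMVector 2 R) : 0 ≤ baryFinsupp g l x := by
  obtain ⟨w, -, hw⟩ := x.2
  rw [baryFinsupp_apply g l hw]
  exact Finset.sum_nonneg fun k _ => mul_nonneg (hl k) (pmInd_nonneg _ _)

theorem baryFinsupp_sum {R : Type*} [CommRing R] [Nontrivial R] (g : SL(2, R))
    (l : Fin 3 → ℝ) : (baryFinsupp g l).sum (fun _ t => t) = ∑ k, l k := by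
  have h : ∀ y : PMVector 2 R →₀ ℝ, y.sum (fun _ t => t) =
      Finsupp.linearCombination ℝ (fun _ => (1 : ℝ)) y := by
    intro y; simp [Finsupp.linearCombination_apply]
  rw [h, baryFinsupp, map_sum]
  simp

/-- The point of the realization with given barycentric coordinates in the triangle of `g`. -/
def bary {K : Type*} [Field K] (g : SL(2, K)) (l : stdSimplex ℝ (Fin 3)) :
    Realization (BDA 2 K) := ⟨baryFinsupp g l.1, by
  have hs := (baryFinsupp_sum g l.1).trans l.2.2
  refine ⟨mem_BDA_faces_iff.2 ⟨?_, g, fun x hx => ?_⟩, baryFinsupp_nonneg g l.2.1, hs⟩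
  · rw [Finset.nonempty_iff_ne_empty]
    intro h
    rw [Finsupp.sum, h, Finset.sum_empty] at hs
    exact zero_ne_one hs
  · by_contra! hne
    obtain ⟨w, -, hw⟩ := x.2
    rw [Finsupp.mem_support_iff, baryFinsupp_apply g l.1 hw] at hx
    refine hx (Finset.sum_eq_zero fun k _ => ?_)
    rw [pmInd, if_neg, mul_zero]
    intro h
    refine hne k (Subtype.ext ?_)
    rw [hw]; exact (pmSet_eq_iff.2 h).symm⟩

theorem bary_eq_iff {K : Type*} [Field K] {g g' : SL(2, K)} {l l' : stdSimplex ℝ (Fin 3)} :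
    bary g l = bary g' l' ↔ SameBary g l.1 g' l'.1 := by
  rw [← baryFinsupp_eq_iff]; exact Subtype.ext_iff

theorem coord_bary {K : Type*} [Field K] (g : SL(2, K)) (l : stdSimplex ℝ (Fin 3))
    {x : PMVector 2 K} {w : Fin 2 → K} (hx : x.1 = pmSet w) :
    (bary g l).1 x = ∑ k, l.1 k * pmInd w (triVec g k) := baryFinsupp_apply g l.1 hx

theorem continuous_bary {K : Type*} [Field K] [Finite K] (g : SL(2, K)) :
    Continuous (bary g) := by
  refine Realization.continuous_of_coord BDA_faces_finite fun x => ?_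
  obtain ⟨w, -, hw⟩ := x.2
  simp only [coord_bary g _ hw]
  exact continuous_finsetSum _ fun k _ =>
    ((continuous_apply k).comp continuous_subtype_val).mul continuous_const

theorem eq_bary_of_support {K : Type*} [Field K] (h2 : (2 : K) ≠ 0) {g : SL(2, K)}
    (x : Realization (BDA 2 K)) (hx : ∀ v ∈ x.1.support, ∃ k, v = triVertex g k) :
    ∃ hl : (fun k => x.1 (triVertex g k)) ∈ stdSimplex ℝ (Fin 3), x = bary g ⟨_, hl⟩ := by
  classical
  have hinj := triVertex_injective h2 g
  have e : x.1 = baryFinsupp g (fun k => x.1 (triVertex g k)) := by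
    ext v
    rw [baryFinsupp, Finsupp.finsetSum_apply]
    simp only [Finsupp.single_apply]
    by_cases hv : v ∈ x.1.support
    · obtain ⟨k, rfl⟩ := hx v hv
      simp [hinj.eq_iff]
    · rw [Finsupp.notMem_support_iff.1 hv, eq_comm]
      refine Finset.sum_eq_zero fun k _ => ?_
      split_ifs with h
      · rw [h, Finsupp.notMem_support_iff.1 hv]
      · rfl
  have hl : (fun k => x.1 (triVertex g k)) ∈ stdSimplex ℝ (Fin 3) := by
    refine ⟨fun k => x.2.2.1 _, ?_⟩
    have h1 := x.2.2.2
    rw [← baryFinsupp_sum g, ← e]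
    exact h1
  exact ⟨hl, Subtype.ext e⟩

theorem exists_eq_bary {K : Type*} [Field K] (h2 : (2 : K) ≠ 0) (x : Realization (BDA 2 K)) :
    ∃ g l, x = bary g l := by
  obtain ⟨-, g, hg⟩ := mem_BDA_faces_iff.1 x.2.1
  obtain ⟨hl, e⟩ := eq_bary_of_support h2 x hg
  exact ⟨g, _, e⟩

/-! ### Comparison of the realization with the modular curve -/

section ModularCurve

variable {p : ℕ}

/-- The class in the modular curve of a point of a translate of the ideal triangle. -/
def triClass (p : ℕ) (g : SL(2, ℤ)) (l : stdSimplex ℝ (Fin 3)) : ModularCurve p :=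
  Quotient.mk _ (g • ExtendedUpperHalfPlane.triMap l.1)

theorem exists_triClass_eq (x : ModularCurve p) : ∃ g l, triClass p g l = x := by
  induction x using Quotient.inductionOn with
  | h x =>
    obtain ⟨g, l, hl, rfl⟩ := ExtendedUpperHalfPlane.exists_smul_triMap_eq x
    exact ⟨g, ⟨l, hl⟩, rfl⟩

theorem continuous_triClass (g : SL(2, ℤ)) : Continuous (triClass p g) :=
  continuous_quotient_mk'.comp ((ExtendedUpperHalfPlane.continuous_smul_left g).comp
    ExtendedUpperHalfPlane.continuous_triMap)

variable [Fact p.Prime]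

theorem exists_eq_bary_red (hp : 2 < p) (x : Realization (BDA 2 (ZMod p))) :
    ∃ (g : SL(2, ℤ)) (l : stdSimplex ℝ (Fin 3)), x = bary (red p g) l := by
  obtain ⟨g, l, rfl⟩ := exists_eq_bary (ZMod.two_ne_zero_of_lt hp) x
  obtain ⟨g, rfl⟩ := red_surjective p g
  exact ⟨g, l, rfl⟩

/-- Reducing a coincidence of weighted integral triangles modulo p gives one implication; lifting
through `SameBary.lift` gives the other. This makes the comparison map both well defined and
injective. -/
theorem triClass_eq_iff (hp : 2 < p) {g g' : SL(2, ℤ)} {l l' : stdSimplex ℝ (Fin 3)} :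
    triClass p g l = triClass p g' l' ↔ bary (red p g) l = bary (red p g') l' := by
  rw [bary_eq_iff, triClass, triClass, Quotient.eq]
  constructor
  · rintro ⟨γ, hγ⟩
    have hγ' : (γ.1 * g') • ExtendedUpperHalfPlane.triMap l'.1 =
        g • ExtendedUpperHalfPlane.triMap l.1 := by
      rw [mul_smul]; exact hγ
    rw [ExtendedUpperHalfPlane.smul_triMap_eq_iff l'.2 l.2] at hγ'
    have h := hγ'.symm.map (Int.castRingHom (ZMod p))
    have h1 : red p γ.1 = 1 := CongruenceSubgroup.Gamma_mem'.1 γ.2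
    change SameBary (red p g) l.1 (red p (γ.1 * g')) l'.1 at h
    rwa [map_mul, h1, one_mul] at h
  · intro h
    obtain ⟨γ, hγ, h'⟩ := h.symm.lift hp l'.2 l.2
    refine ⟨⟨γ, hγ⟩, ?_⟩
    have := (ExtendedUpperHalfPlane.smul_triMap_eq_iff l'.2 l.2).2 h'
    rw [mul_smul] at this
    exact this

/-- The comparison map from the realization to the modular curve. -/
def toModularCurve (hp : 2 < p) (x : Realization (BDA 2 (ZMod p))) : ModularCurve p :=
  triClass p (exists_eq_bary_red hp x).choose (exists_eq_bary_red hp x).choose_spec.choose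

theorem toModularCurve_bary (hp : 2 < p) (g : SL(2, ℤ)) (l : stdSimplex ℝ (Fin 3)) :
    toModularCurve hp (bary (red p g) l) = triClass p g l :=
  (triClass_eq_iff hp).2 (exists_eq_bary_red hp (bary (red p g) l)).choose_spec.choose_spec.symm

theorem bijective_toModularCurve (hp : 2 < p) : Function.Bijective (toModularCurve hp) := by
  constructor
  · intro x y h
    obtain ⟨g, l, rfl⟩ := exists_eq_bary_red hp x
    obtain ⟨g', l', rfl⟩ := exists_eq_bary_red hp y
    rw [toModularCurve_bary, toModularCurve_bary] at h
    exact (triClass_eq_iff hp).1 h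
  · intro x
    obtain ⟨g, l, rfl⟩ := exists_triClass_eq x
    exact ⟨_, toModularCurve_bary hp g l⟩

theorem continuous_toModularCurve (hp : 2 < p) : Continuous (toModularCurve hp) := by
  refine Realization.continuous_iff_faceMap.2 fun s hs => ?_
  obtain ⟨-, g, hg⟩ := mem_BDA_faces_iff.1 hs
  obtain ⟨g, rfl⟩ := red_surjective p g
  have hsupp : ∀ y, ∀ v ∈ (Realization.faceMap _ s hs y).1.support,
      ∃ k, v = triVertex (red p g) k := by
    intro y v hv
    refine hg v ?_
    by_contra hvs
    exact Finsupp.mem_support_iff.1 hv (Realization.faceMap_apply_of_notMem hs y hvs)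
  have h := fun y => eq_bary_of_support (ZMod.two_ne_zero_of_lt hp)
    (Realization.faceMap _ s hs y) (hsupp y)
  choose hl he using h
  have e : toModularCurve hp ∘ Realization.faceMap _ s hs = fun y => triClass p g ⟨_, hl y⟩ := by
    ext y
    exact (congrArg (toModularCurve hp) (he y)).trans (toModularCurve_bary hp g _)
  rw [e]
  refine (continuous_triClass g).comp (Continuous.subtype_mk (continuous_pi fun k => ?_) _)
  exact (Realization.continuous_coord _).comp (Realization.continuous_faceMap s hs)

/-- The preimage of the image of C in the bordification is the union, over all integral triangles,
of the closed sets of weights whose reduction lies in C. The criterion `isClosed_iUnion_triangles`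
needs a bound away from 1 on the weight at each omitted cusp, which compactness of C supplies. -/
theorem isClosedMap_toModularCurve (hp : 2 < p) : IsClosedMap (toModularCurve hp) := by
  intro C hC
  have hcomp := Realization.compactSpace (BDA_faces_finite (n := 2) (R := ZMod p))
  rw [← isQuotientMap_quotient_mk'.isClosed_preimage]
  set D : SL(2, ℤ) → Set (Fin 3 → ℝ) := fun g => Subtype.val '' (bary (red p g) ⁻¹' C) with hD
  have e : Quotient.mk _ ⁻¹' (toModularCurve hp '' C) =
      {x | ∃ g, ∃ l ∈ D g, g • ExtendedUpperHalfPlane.triMap l = x} := by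
    ext x
    constructor
    · rintro ⟨y, hy, hyx⟩
      obtain ⟨g, l, rfl⟩ := exists_eq_bary_red hp y
      rw [toModularCurve_bary] at hyx
      obtain ⟨γ, hγ⟩ := Quotient.exact hyx.symm
      refine ⟨γ.1 * g, l.1, ⟨l, ?_, rfl⟩, ?_⟩
      · have h1 : red p γ.1 = 1 := CongruenceSubgroup.Gamma_mem'.1 γ.2
        rw [Set.mem_preimage, map_mul, h1, one_mul]
        exact hy
      · rw [mul_smul]; exact hγ
    · rintro ⟨g, _, ⟨l, hl, rfl⟩, rfl⟩
      exact ⟨_, hl, toModularCurve_bary hp g l⟩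
  change IsClosed (Quotient.mk _ ⁻¹' (toModularCurve hp '' C))
  rw [e]
  refine ExtendedUpperHalfPlane.isClosed_iUnion_triangles D ?_ ?_ ?_
  · rintro g _ ⟨l, -, rfl⟩
    exact l.2
  · intro g
    exact (isClosed_stdSimplex ℝ (Fin 3)).isClosedEmbedding_subtypeVal.isClosedMap _
      (hC.preimage (continuous_bary _))
  · intro h hh
    set v := triVertex (red p h) 0 with hv
    -- A point with weight 1 at v is the vertex v itself, and its image would contain the cusp h∞
    -- that is assumed to be omitted.
    have hlt : ∀ x ∈ C, x.1 v < 1 := by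
      intro x hx
      refine lt_of_le_of_ne (x.coord_le_one v) fun h1 => hh ?_
      have hx1 := x.eq_single_of_coord_eq_one h1
      refine ⟨h, Pi.single 0 1, ⟨⟨_, single_mem_stdSimplex ℝ 0⟩, ?_, rfl⟩, ?_⟩
      · have : bary (red p h) ⟨_, single_mem_stdSimplex ℝ 0⟩ = x := by
          refine Subtype.ext ?_
          rw [hx1]
          change baryFinsupp _ _ = _
          simp [baryFinsupp, Fin.sum_univ_three, hv]
        rw [Set.mem_preimage, this]
        exact hx
      · rw [ExtendedUpperHalfPlane.triMap,
          dif_neg (by simp [ExtendedUpperHalfPlane.triDisc]), if_pos (by simp)]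
        rfl
    obtain ⟨ε, hε, hCε⟩ : ∃ ε > 0, ∀ x ∈ C, x.1 v ≤ 1 - ε := by
      by_cases hne : C.Nonempty
      · obtain ⟨x₀, hx₀, hmax⟩ := hC.isCompact.exists_isMaxOn hne
          (Realization.continuous_coord v).continuousOn
        exact ⟨1 - x₀.1 v, sub_pos.2 (hlt x₀ hx₀), fun x hx => by
          rw [sub_sub_cancel]; exact hmax hx⟩
      · rw [Set.not_nonempty_iff_eq_empty] at hne
        exact ⟨1, one_pos, fun x hx => by simp [hne] at hx⟩
    refine ⟨ε, hε, ?_⟩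
    rintro g _ ⟨l, hl, rfl⟩
    refine le_trans ?_ (hCε _ hl)
    rw [coord_bary (w := triVec (red p h) 0) (red p g) l rfl]
    -- Vertices equal up to sign over ℤ stay so modulo p, so the weight at the integral vertex is at
    -- most the weight at its reduction.
    refine Finset.sum_le_sum fun k _ => mul_le_mul_of_nonneg_left ?_ (l.2.1 k)
    rw [pmInd]
    split_ifs with hc
    · have : triVec (red p g) k = triVec (red p h) 0 ∨ triVec (red p g) k = - triVec (red p h) 0 := by
        rw [triVec_map, triVec_map]
        rcases hc with hc | hc
        · left; rw [hc]
        · right; rw [hc]; ext i; simp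
      rw [pmInd, if_pos this]
    · exact pmInd_nonneg _ _

/-- The realization of `BDA 2 (ZMod p)` is homeomorphic to the modular curve of level `p`. -/
def realizationHomeo (hp : 2 < p) : Realization (BDA 2 (ZMod p)) ≃ₜ ModularCurve p :=
  (Equiv.ofBijective _ (bijective_toModularCurve hp)).toHomeomorphOfContinuousClosed
    (continuous_toModularCurve hp) (isClosedMap_toModularCurve hp)

/-- The connected set ℍ is dense, since every horoball at a cusp is nonempty. -/
theorem connectedSpace_extendedUpperHalfPlane : ConnectedSpace ExtendedUpperHalfPlane := by
  have hd : DenseRange ExtendedUpperHalfPlane.point := by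
    intro x
    rw [mem_closure_iff]
    intro U hU hx
    cases x with
    | point z => exact ⟨_, hx, z, rfl⟩
    | cusp c =>
      obtain ⟨A, hA⟩ := (ExtendedUpperHalfPlane.isOpen_iff.1 hU).2 c hx
      obtain ⟨g, hg⟩ := ExtendedUpperHalfPlane.exists_smul_infty c
      refine ⟨_, hA (g • ⟨⟨0, |A| + 1⟩, by positivity⟩) ⟨g, hg, ?_⟩, _, rfl⟩
      rw [inv_smul_smul]
      change A < |A| + 1
      linarith [le_abs_self A]
  have h1 := isPreconnected_range (ExtendedUpperHalfPlane.continuous_point)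
  have h2 := h1.closure
  rw [hd.closure_range] at h2
  have : PreconnectedSpace ExtendedUpperHalfPlane := ⟨h2⟩
  exact { toNonempty := ⟨ExtendedUpperHalfPlane.cusp OnePoint.infty⟩ }

theorem connectedSpace_realization (hp : 2 < p) :
    ConnectedSpace (Realization (BDA 2 (ZMod p))) := by
  have := connectedSpace_extendedUpperHalfPlane
  exact (realizationHomeo hp).symm.surjective.connectedSpace (realizationHomeo hp).symm.continuous

end ModularCurve

end

noncomputable section

open Matrix

/-! ## The realization is locally Euclidean -/

/-- A continuous map from a compact space to a Hausdorff space is closed, so it is a quotient map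
onto its range and continuity can be tested upstairs. -/
theorem continuousOn_range_of_comp_eq {X Y Z : Type*} [TopologicalSpace X] [TopologicalSpace Y]
    [TopologicalSpace Z] [CompactSpace Y] [T2Space X] {A : Y → X} {B : Y → Z} {f : X → Z}
    (hA : Continuous A) (hB : Continuous B) (h : ∀ y, f (A y) = B y) :
    ContinuousOn f (Set.range A) := by
  rw [continuousOn_iff_isClosed]
  intro t ht
  refine ⟨A '' (B ⁻¹' t), hA.isClosedMap _ (ht.preimage hB), ?_⟩
  ext x
  constructor
  · rintro ⟨hx, y, rfl⟩
    refine ⟨⟨y, ?_, rfl⟩, y, rfl⟩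
    rw [Set.mem_preimage, ← h]
    exact hx
  · rintro ⟨⟨y, hy, rfl⟩, hx⟩
    refine ⟨?_, hx⟩
    rw [Set.mem_preimage, h]
    exact hy

/-- Two maps from a compact space with the same fibres induce a homeomorphism between open
subsets of their images. -/
theorem exists_openPartialHomeomorph_of_fibers {X Y Z : Type*} [TopologicalSpace X]
    [TopologicalSpace Y] [TopologicalSpace Z] [CompactSpace Y] [T2Space X] [T2Space Z] [Nonempty Y]
    {A : Y → X} {B : Y → Z} (hA : Continuous A) (hB : Continuous B)
    (hAB : ∀ y y', A y = A y' ↔ B y = B y') {U : Set X} {V : Set Z} (hU : IsOpen U)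
    (hV : IsOpen V) (hUA : U ⊆ Set.range A) (hVB : V ⊆ Set.range B)
    (hUV : ∀ y, A y ∈ U ↔ B y ∈ V) :
    ∃ e : OpenPartialHomeomorph X Z, e.source = U := by
  have hf : ∀ y, B (Function.invFun A (A y)) = B y := fun y =>
    (hAB _ _).1 (Function.invFun_eq ⟨y, rfl⟩)
  have hg : ∀ y, A (Function.invFun B (B y)) = A y := fun y =>
    (hAB _ _).2 (Function.invFun_eq ⟨y, rfl⟩)
  exact ⟨{
    toFun := B ∘ Function.invFun A
    invFun := A ∘ Function.invFun B
    source := U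
    target := V
    map_source' := by
      intro x hx
      obtain ⟨y, rfl⟩ := hUA hx
      rw [Function.comp, hf]
      exact (hUV y).1 hx
    map_target' := by
      intro x hx
      obtain ⟨y, rfl⟩ := hVB hx
      rw [Function.comp, hg]
      exact (hUV y).2 hx
    left_inv' := by
      intro x hx
      obtain ⟨y, rfl⟩ := hUA hx
      simp only [Function.comp, hf, hg]
    right_inv' := by
      intro x hx
      obtain ⟨y, rfl⟩ := hVB hx
      simp only [Function.comp, hf, hg]
    open_source := hU
    open_target := hV
    continuousOn_toFun := (continuousOn_range_of_comp_eq hA hB hf).mono hUA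
    continuousOn_invFun := (continuousOn_range_of_comp_eq hB hA hg).mono hVB }, rfl⟩

/-- Barycentric coordinates in a triangle of a star: distance `t` from the centre, and position
`s` on the opposite edge. -/
def starCoord (t s : unitInterval) : stdSimplex ℝ (Fin 3) :=
  ⟨![1 - t, t * (1 - s), t * s], by
    constructor
    · have := t.2.1
      have := s.2.1
      have := sub_nonneg.2 t.2.2
      have := sub_nonneg.2 s.2.2
      intro k
      fin_cases k
      · change 0 ≤ 1 - (t : ℝ); assumption
      · exact mul_nonneg ‹_› ‹_›
      · exact mul_nonneg ‹_› ‹_›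
    · simp [Fin.sum_univ_three]; ring⟩

theorem continuous_starCoord : Continuous fun y : unitInterval × unitInterval =>
    starCoord y.1 y.2 := by
  refine Continuous.subtype_mk (continuous_pi fun k => ?_) _
  fin_cases k <;> simp <;> fun_prop

/-! ### Open stars of vertices as discs -/

section Star

variable {p : ℕ} [Fact p.Prime]

/-- The star of the vertex `triVertex g 0`. -/
def starMap (g : SL(2, ZMod p)) (y : ZMod p × unitInterval × unitInterval) :
    Realization (BDA 2 (ZMod p)) := bary (g * upper y.1) (starCoord y.2.1 y.2.2)

/-- The model of the star in the plane. -/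
def discMap (p : ℕ) [Fact p.Prime] (y : ZMod p × unitInterval × unitInterval) : ℂ :=
  (y.2.1 : ℝ) * (ZMod.stdAddChar y.1 * Complex.exp (2 * Real.pi * Complex.I * (y.2.2 : ℝ) / p))

theorem continuous_starMap (g : SL(2, ZMod p)) : Continuous (starMap g) :=
  continuous_prod_of_discrete_left.2 fun i =>
    (continuous_bary (g * upper i)).comp continuous_starCoord

theorem continuous_discMap : Continuous (discMap p) := by
  refine continuous_prod_of_discrete_left.2 fun i => ?_
  unfold discMap
  fun_prop

theorem norm_discMap (y : ZMod p × unitInterval × unitInterval) : ‖discMap p y‖ = y.2.1 := by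
  have h1 : ‖(ZMod.stdAddChar y.1 : ℂ)‖ = 1 := by
    rw [ZMod.stdAddChar_apply]; exact Circle.norm_coe _
  have h2 : ‖Complex.exp (2 * Real.pi * Complex.I * (y.2.2 : ℝ) / p)‖ = 1 := by
    have : (2 * Real.pi * Complex.I * (y.2.2 : ℝ) / p : ℂ) =
      ((2 * Real.pi * (y.2.2 : ℝ) / p : ℝ) : ℂ) * Complex.I := by push_cast; ring
    rw [this, Complex.norm_exp_ofReal_mul_I]
  rw [discMap, norm_mul, norm_mul, h1, h2, Complex.norm_real, Real.norm_of_nonneg y.2.1.2.1]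
  simp

theorem pmInd_mulVec {R : Type*} [CommRing R] (g : SL(2, R)) (v w : Fin 2 → R) :
    pmInd (g.1 *ᵥ w) (g.1 *ᵥ v) = pmInd w v := by
  have hinj : Function.Injective (fun v => g.1 *ᵥ v) := by
    intro a b h
    have h' := congrArg (fun v => g⁻¹.1 *ᵥ v) h
    simpa only [Matrix.mulVec_mulVec, ← Matrix.SpecialLinearGroup.coe_mul, inv_mul_cancel,
      Matrix.SpecialLinearGroup.coe_one, Matrix.one_mulVec] using h'
  have e1 : g.1 *ᵥ v = g.1 *ᵥ w ↔ v = w := hinj.eq_iff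
  have e2 : g.1 *ᵥ v = -(g.1 *ᵥ w) ↔ v = -w := by
    rw [← Matrix.mulVec_neg]; exact hinj.eq_iff
  unfold pmInd
  congr 1
  exact propext (or_congr e1 e2)

theorem starMap_center (g : SL(2, ZMod p)) (y : ZMod p × unitInterval × unitInterval) :
    (starMap g y).1 (triVertex g 0) = 1 - y.2.1 := by
  rw [starMap, coord_bary (w := triVec g 0) _ _ rfl]
  obtain ⟨h0, h1, h2⟩ := triVec_upper y.1
  have hg : triVec g 0 = g.1 *ᵥ ![1, 0] := rfl
  simp only [triVec_mul, h0, h1, h2, hg, pmInd_mulVec, Fin.sum_univ_three]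
  simp [pmInd, starCoord]

theorem starMap_link (hp : 2 < p) (g : SL(2, ZMod p)) (y : ZMod p × unitInterval × unitInterval)
    (m : ZMod p) : (starMap g y).1 (triVertex (g * upper m) 1) =
      y.2.1 * ((1 - y.2.2) * (if y.1 = m then 1 else 0) +
        y.2.2 * (if y.1 + 1 = m then 1 else 0)) := by
  rw [starMap, coord_bary (w := triVec (g * upper m) 1) _ _ rfl]
  obtain ⟨h0, h1, h2⟩ := triVec_upper y.1
  simp only [triVec_mul, h0, h1, h2, (triVec_upper m).2.1, pmInd_mulVec, Fin.sum_univ_three,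
    pmInd_base, pmInd_eq_ite hp]
  simp only [starCoord, Matrix.cons_val_zero, Matrix.cons_val_one, Matrix.cons_val]
  ring

/-- The weight at the centre is 1 - t, and for t ≠ 0 the weights on the link determine the edge (i,
i+1) and the position on it. Excluding s = 1 removes the ambiguity at the link vertices. -/
theorem starMap_eq_iff (hp : 2 < p) (g : SL(2, ZMod p)) {i j : ZMod p} {t s t' s' : unitInterval}
    (hs : s < 1) (hs' : s' < 1) :
    starMap g (i, t, s) = starMap g (j, t', s') ↔ t = t' ∧ (t = 0 ∨ i = j ∧ s = s') := by
  have hsr : (s : ℝ) < 1 := hs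
  have hsr' : (s' : ℝ) < 1 := hs'
  constructor
  · intro h
    have h0 := starMap_center g (i, t, s)
    rw [h, starMap_center] at h0
    have ht : t = t' := Subtype.ext (by simpa using h0.symm)
    subst ht
    refine ⟨rfl, ?_⟩
    by_cases ht : t = 0
    · exact Or.inl ht
    have htr : (t : ℝ) ≠ 0 := fun e => ht (Subtype.ext e)
    have key : ∀ m, (1 - (s : ℝ)) * (if i = m then 1 else 0) + s * (if i + 1 = m then 1 else 0) =
        (1 - (s' : ℝ)) * (if j = m then 1 else 0) + s' * (if j + 1 = m then 1 else 0) := by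
      intro m
      have h1 := starMap_link hp g (i, t, s) m
      rw [h, starMap_link hp] at h1
      exact (mul_left_cancel₀ htr h1).symm
    have one_ne : ∀ i : ZMod p, i + 1 ≠ i := fun i h => one_ne_zero (add_eq_left.1 h)
    have two_ne : ∀ i : ZMod p, i + 1 + 1 ≠ i := fun i h =>
      ZMod.two_ne_zero_of_lt hp (by linear_combination h)
    have hij : i = j := by
      have k1 := key i
      rw [if_pos rfl, if_neg (one_ne i)] at k1
      by_contra hne
      rw [if_neg (Ne.symm hne)] at k1
      by_cases hj : j + 1 = i
      · have k2 := key j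
        subst hj
        rw [if_neg (one_ne j), if_neg (two_ne j), if_pos rfl] at k2
        linarith
      · rw [if_neg hj] at k1
        linarith
    subst hij
    refine Or.inr ⟨rfl, Subtype.ext ?_⟩
    have k1 := key i
    rw [if_pos rfl, if_neg (one_ne i)] at k1
    linarith
  · rintro ⟨rfl, rfl | ⟨rfl, rfl⟩⟩
    · refine bary_eq_iff.2 fun f _ => ?_
      obtain ⟨h0, h1, h2⟩ := triVec_upper i
      obtain ⟨k0, k1, k2⟩ := triVec_upper j
      simp only [triVec_mul, h0, h1, h2, k0, k1, k2, Fin.sum_univ_three]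
      simp [starCoord]
    · rfl

/-- The modulus is t and an argument is 2π(i + s)/p, so i is recovered as an integer part modulo p
and s as a fractional part. -/
theorem discMap_eq_iff {i j : ZMod p} {t s t' s' : unitInterval} (hs : s < 1) (hs' : s' < 1) :
    discMap p (i, t, s) = discMap p (j, t', s') ↔ t = t' ∧ (t = 0 ∨ i = j ∧ s = s') := by
  have hsr : (s : ℝ) < 1 := hs
  have hsr' : (s' : ℝ) < 1 := hs'
  have hp0 : (p : ℂ) ≠ 0 := Nat.cast_ne_zero.2 (Fact.out : p.Prime).ne_zero
  have hpi : (2 * Real.pi * Complex.I : ℂ) ≠ 0 := Complex.two_pi_I_ne_zero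
  constructor
  · intro h
    have h0 := norm_discMap (i, t, s)
    rw [h, norm_discMap] at h0
    have ht : t = t' := (Subtype.ext h0).symm
    subst ht
    refine ⟨rfl, ?_⟩
    by_cases ht : t = 0
    · exact Or.inl ht
    have htr : ((t : ℝ) : ℂ) ≠ 0 := fun e => ht (Subtype.ext (by exact_mod_cast e))
    have h1 := mul_left_cancel₀ htr h
    obtain ⟨a, rfl⟩ := ZMod.intCast_surjective i
    obtain ⟨b, rfl⟩ := ZMod.intCast_surjective j
    simp only [ZMod.stdAddChar_coe, ← Complex.exp_add] at h1
    obtain ⟨n, hn⟩ := Complex.exp_eq_exp_iff_exists_int.1 h1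
    have hn' : ((a : ℂ) + (s : ℝ)) = b + (s' : ℝ) + n * p := by
      have e1 : (2 * Real.pi * Complex.I : ℂ) * (a + (s : ℝ)) =
          (2 * Real.pi * Complex.I) * (b + (s' : ℝ) + n * p) := by
        field_simp at hn
        linear_combination (2 * Real.pi * Complex.I) * hn
      exact mul_left_cancel₀ hpi e1
    have hr : (a : ℝ) + s = b + s' + n * p := by exact_mod_cast hn'
    have h2 : (s : ℝ) - s' = ((b + n * p - a : ℤ) : ℝ) := by push_cast; linarith
    have h3 : b + n * p - a = 0 := by
      have l1 : ((b + n * p - a : ℤ) : ℝ) < 1 := by rw [← h2]; linarith [s'.2.1]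
      have l2 : (-1 : ℝ) < ((b + n * p - a : ℤ) : ℝ) := by rw [← h2]; linarith [s.2.1]
      have l1' : b + n * p - a < 1 := by exact_mod_cast l1
      have l2' : -1 < b + n * p - a := by exact_mod_cast l2
      omega
    refine Or.inr ⟨?_, Subtype.ext ?_⟩
    · have : a = b + n * p := by omega
      rw [this]; simp
    · rw [h3] at h2; push_cast at h2; linarith
  · rintro ⟨rfl, rfl | ⟨rfl, rfl⟩⟩
    · simp [discMap]
    · rfl

theorem starMap_one (g : SL(2, ZMod p)) (i : ZMod p) (t : unitInterval) :
    starMap g (i, t, 1) = starMap g (i + 1, t, 0) := by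
  refine bary_eq_iff.2 fun f _ => ?_
  obtain ⟨h0, h1, h2⟩ := triVec_upper i
  obtain ⟨k0, k1, k2⟩ := triVec_upper (i + 1)
  simp only [triVec_mul, h0, h1, h2, k0, k1, k2, Fin.sum_univ_three]
  simp [starCoord]

theorem discMap_one (i : ZMod p) (t : unitInterval) :
    discMap p (i, t, 1) = discMap p (i + 1, t, 0) := by
  have h := ZMod.stdAddChar_coe (N := p) 1
  simp only [discMap, AddChar.map_add_eq_mul]
  rw [Int.cast_one] at h
  rw [h]
  simp

theorem starMap_eq_iff_discMap_eq (hp : 2 < p) (g : SL(2, ZMod p))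
    (y y' : ZMod p × unitInterval × unitInterval) :
    starMap g y = starMap g y' ↔ discMap p y = discMap p y' := by
  -- Under both maps the edge s = 1 of triangle i is glued to the edge s = 0 of triangle i + 1, so s
  -- < 1 may be assumed.
  have norm : ∀ y : ZMod p × unitInterval × unitInterval, ∃ (j : ZMod p) (t r : unitInterval),
      r < 1 ∧ starMap g y = starMap g (j, t, r) ∧ discMap p y = discMap p (j, t, r) := by
    rintro ⟨i, t, s⟩
    rcases eq_or_lt_of_le (unitInterval.le_one' (t := s)) with h | h
    · subst h
      exact ⟨i + 1, t, 0, zero_lt_one, starMap_one g i t, discMap_one i t⟩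
    · exact ⟨i, t, s, h, rfl, rfl⟩
  obtain ⟨j, t, r, hr, e1, e2⟩ := norm y
  obtain ⟨j', t', r', hr', e1', e2'⟩ := norm y'
  rw [e1, e1', e2, e2', starMap_eq_iff hp g hr hr', discMap_eq_iff hr hr']

theorem ball_subset_range_discMap : Metric.ball (0 : ℂ) 1 ⊆ Set.range (discMap p) := by
  intro z hz
  have hz1 : ‖z‖ < 1 := by simpa using hz
  have hp0 : (p : ℂ) ≠ 0 := Nat.cast_ne_zero.2 (Fact.out : p.Prime).ne_zero
  have hpi : (Real.pi : ℂ) ≠ 0 := by exact_mod_cast Real.pi_ne_zero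
  set θ : ℝ := p * z.arg / (2 * Real.pi) with hθ
  refine ⟨((⌊θ⌋ : ℤ), ⟨‖z‖, norm_nonneg z, hz1.le⟩,
    ⟨Int.fract θ, Int.fract_nonneg θ, (Int.fract_lt_one θ).le⟩), ?_⟩
  conv_rhs => rw [← Complex.norm_mul_exp_arg_mul_I z]
  simp only [discMap]
  rw [ZMod.stdAddChar_coe, ← Complex.exp_add]
  congr 2
  have h1 : ((⌊θ⌋ : ℤ) : ℂ) + ((Int.fract θ : ℝ) : ℂ) = p * z.arg / (2 * Real.pi) := by
    have := Int.floor_add_fract θ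
    have h2 : (((⌊θ⌋ : ℤ) : ℝ) : ℂ) + ((Int.fract θ : ℝ) : ℂ) = (θ : ℂ) := by
      exact_mod_cast this
    rw [Complex.ofReal_intCast] at h2
    rw [h2, hθ]; push_cast; rfl
  have h3 : (2 * Real.pi * Complex.I * ((⌊θ⌋ : ℤ) : ℂ) / p +
      2 * Real.pi * Complex.I * ((Int.fract θ : ℝ) : ℂ) / p : ℂ) =
      2 * Real.pi * Complex.I / p * (((⌊θ⌋ : ℤ) : ℂ) + ((Int.fract θ : ℝ) : ℂ)) := by ring
  rw [h3, h1]
  field_simp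

/-- A triangle containing the vertex can be rotated, and its sign changed, so that this vertex comes
first; it is then one of the triangles g · `upper n`. -/
theorem mem_range_starMap (hp : 2 < p) (g : SL(2, ZMod p)) {x : Realization (BDA 2 (ZMod p))}
    (hx : 0 < x.1 (triVertex g 0)) : x ∈ Set.range (starMap g) := by
  obtain ⟨-, h, hh⟩ := mem_BDA_faces_iff.1 x.2.1
  obtain ⟨k, hk⟩ := hh (triVertex g 0) (Finsupp.mem_support_iff.2 hx.ne')
  obtain ⟨hl, e⟩ := eq_bary_of_support (ZMod.two_ne_zero_of_lt hp) x hh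
  set l : Fin 3 → ℝ := fun k => x.1 (triVertex h k)
  obtain ⟨r, hr, hrv⟩ := exists_sameBary_rot h k
  rw [triVertex_eq_iff] at hk
  obtain ⟨q, hq, hqv⟩ : ∃ q, SameBary h l q (fun i => l (i + k)) ∧ triVec g 0 = triVec q 0 := by
    have e2 : triVec (h * r) 0 = triVec g 0 ∨ triVec (h * r) 0 = - triVec g 0 := by
      rcases hrv with e1 | e1 <;> rcases hk with e3 | e3 <;> rw [e1, e3] <;> simp
    rcases e2 with e2 | e2
    · exact ⟨_, hr l, e2.symm⟩
    · exact ⟨_, (hr l).trans SameBary.neg_right, by rw [triVec_neg, e2, neg_neg]⟩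
  obtain ⟨n, rfl⟩ := eq_upper_of_triVec_zero_eq hqv
  have hl' := stdSimplex_shift hl k
  set l' : Fin 3 → ℝ := fun i => l (i + k)
  have hx' : x = bary (g * upper n) ⟨l', hl'⟩ := e.trans (bary_eq_iff.2 hq)
  have h0 := hl'.1 0
  have h1 := hl'.1 1
  have h2 := hl'.1 2
  have hs := hl'.2
  rw [Fin.sum_univ_three] at hs
  -- These values invert `starCoord`. At the centre the quotient is 0 / 0 = 0, which is harmless
  -- because t = 0 there.
  refine ⟨(n, ⟨l' 1 + l' 2, by linarith, by linarith⟩, ⟨l' 2 / (l' 1 + l' 2),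
    div_nonneg h2 (by linarith), div_le_one_of_le₀ (by linarith) (by linarith)⟩), ?_⟩
  rw [hx', starMap]
  congr 1
  refine Subtype.ext ?_
  ext i
  by_cases ht : l' 1 + l' 2 = 0
  · have e1 : l' 1 = 0 := by linarith
    have e2 : l' 2 = 0 := by linarith
    fin_cases i <;> simp [starCoord, e1, e2]
    linarith
  · fin_cases i <;> simp [starCoord] <;> field_simp <;> linarith

theorem locallyEuclidean_realization (hp : 2 < p) (x : Realization (BDA 2 (ZMod p))) :
    ∃ e : OpenPartialHomeomorph (Realization (BDA 2 (ZMod p))) (EuclideanSpace ℝ (Fin 2)),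
      x ∈ e.source := by
  obtain ⟨v, hv⟩ := (mem_BDA_faces_iff.1 x.2.1).1
  obtain ⟨w, hw0, hw⟩ := v.2
  obtain ⟨g, hg⟩ := exists_tri_of_ne_zero hw0
  have hvg : v = triVertex g 0 := Subtype.ext (by rw [hw, ← hg]; rfl)
  have hx : 0 < x.1 (triVertex g 0) :=
    lt_of_le_of_ne (x.2.2.1 _) (Ne.symm (Finsupp.mem_support_iff.1 (hvg ▸ hv)))
  obtain ⟨e, he⟩ := exists_openPartialHomeomorph_of_fibers (continuous_starMap g)
    (continuous_discMap (p := p)) (starMap_eq_iff_discMap_eq hp g)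
    (isOpen_lt continuous_const (Realization.continuous_coord (triVertex g 0)))
    Metric.isOpen_ball (fun y hy => mem_range_starMap hp g hy) ball_subset_range_discMap
    (fun y => by
      rw [Set.mem_ofPred_eq, starMap_center, mem_ball_zero_iff, norm_discMap, sub_pos])
  refine ⟨e.trans Complex.orthonormalBasisOneI.repr.toHomeomorph.toOpenPartialHomeomorph, ?_⟩
  simp only [OpenPartialHomeomorph.trans_source, he]
  exact ⟨hx, trivial⟩

end Star

end

noncomputable section

open Matrix

/-! ## Orientation -/

/-- `(a, b, c) = (±v, ±w, ±(v + w))` with `det (v, w) = 1`. -/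
def triOrientation (R : Type*) [CommRing R] (a b c : PMVector 2 R) : Prop :=
  ∃ v w : Fin 2 → R, a.1 = pmSet v ∧ b.1 = pmSet w ∧ c.1 = pmSet (v + w) ∧
    v 0 * w 1 - w 0 * v 1 = 1

namespace triOrientation

theorem cyclic {R : Type*} [CommRing R] {a b c : PMVector 2 R} (h : triOrientation R a b c) :
    triOrientation R b c a := by
  obtain ⟨v, w, ha, hb, hc, hd⟩ := h
  refine ⟨w, -(v + w), hb, ?_, ?_, ?_⟩
  · rw [hc]; exact pmSet_eq_iff.2 (Or.inr (neg_neg _).symm)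
  · rw [ha]; exact pmSet_eq_iff.2 (Or.inr (by abel))
  · simp only [Pi.neg_apply, Pi.add_apply]
    linear_combination hd

theorem of_triVertex {R : Type*} [CommRing R] [Nontrivial R] (g : SL(2, R)) :
    triOrientation R (triVertex g 0) (triVertex g 1) (triVertex g 2) := by
  refine ⟨triVec g 0, triVec g 1, rfl, rfl, ?_, ?_⟩
  · rw [← triVec_two]; rfl
  · have hd := g.det_coe
    rw [Matrix.det_fin_two] at hd
    simpa [triVec_zero, triVec_one] using hd

theorem of_isTriangle {K : Type*} [Field K] {a b c : PMVector 2 K}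
    (h : IsTriangle (BDA 2 K) a b c) : triOrientation K a b c ∨ triOrientation K b a c := by
  obtain ⟨hab, hbc, hac, s, hs, hsabc⟩ := h
  obtain ⟨-, g, hg⟩ := mem_BDA_faces_iff.1 hs
  have ha : a ∈ s := by rw [← Finset.mem_coe, hsabc]; simp
  have hb : b ∈ s := by rw [← Finset.mem_coe, hsabc]; simp
  have hc : c ∈ s := by rw [← Finset.mem_coe, hsabc]; simp
  obtain ⟨i, rfl⟩ := hg a ha
  obtain ⟨j, rfl⟩ := hg b hb
  obtain ⟨k, rfl⟩ := hg c hc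
  have h := of_triVertex g
  fin_cases i <;> fin_cases j <;>
    first
    | exact absurd rfl hab
    | (fin_cases k <;>
        first
        | exact absurd rfl hbc
        | exact absurd rfl hac
        | exact Or.inl h
        | exact Or.inl h.cyclic
        | exact Or.inl h.cyclic.cyclic
        | exact Or.inr h
        | exact Or.inr h.cyclic
        | exact Or.inr h.cyclic.cyclic)

/-- The representatives of a and b in the two orderings agree up to signs. Equal signs make one
determinant both 1 and -1; opposite signs give v + w = ±(v - w), so that 2v = 0 or 2w = 0. -/
theorem asymm {K : Type*} [Field K] (h2 : (2 : K) ≠ 0) {a b c : PMVector 2 K}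
    (h : triOrientation K a b c) (h' : triOrientation K b a c) : False := by
  obtain ⟨v, w, ha, hb, hc, hd⟩ := h
  obtain ⟨w', v', hb', ha', hc', hd'⟩ := h'
  rw [ha, pmSet_eq_iff] at ha'
  rw [hb, pmSet_eq_iff] at hb'
  rw [hc, pmSet_eq_iff] at hc'
  have pos : ∀ {v w : Fin 2 → K}, v 0 * w 1 - w 0 * v 1 = 1 → v 0 * w 1 - w 0 * v 1 = -1 →
      False := fun h h' => h2 (by linear_combination h' - h)
  have hv : ¬ (2 * v 0 = 0 ∧ 2 * v 1 = 0) := by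
    rintro ⟨e0, e1⟩
    rw [mul_eq_zero] at e0 e1
    rw [e0.resolve_left h2, e1.resolve_left h2] at hd
    simp at hd
  have hw : ¬ (2 * w 0 = 0 ∧ 2 * w 1 = 0) := by
    rintro ⟨e0, e1⟩
    rw [mul_eq_zero] at e0 e1
    rw [e0.resolve_left h2, e1.resolve_left h2] at hd
    simp at hd
  rcases ha' with ha' | ha' <;> rcases hb' with hb' | hb' <;> subst ha' <;> subst hb'
  · exact pos hd (by linear_combination -hd')
  · rcases hc' with e | e
    · have e0 := congrFun e 0
      have e1 := congrFun e 1
      simp only [Pi.add_apply, Pi.neg_apply] at e0 e1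
      exact hw ⟨by simp only [Pi.neg_apply]; linear_combination e0,
        by simp only [Pi.neg_apply]; linear_combination e1⟩
    · have e0 := congrFun e 0
      have e1 := congrFun e 1
      simp only [Pi.add_apply, Pi.neg_apply] at e0 e1
      exact hv ⟨by linear_combination e0, by linear_combination e1⟩
  · rcases hc' with e | e
    · have e0 := congrFun e 0
      have e1 := congrFun e 1
      simp only [Pi.add_apply, Pi.neg_apply] at e0 e1
      exact hv ⟨by simp only [Pi.neg_apply]; linear_combination e0,
        by simp only [Pi.neg_apply]; linear_combination e1⟩
    · have e0 := congrFun e 0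
      have e1 := congrFun e 1
      simp only [Pi.add_apply, Pi.neg_apply] at e0 e1
      exact hw ⟨by linear_combination e0, by linear_combination e1⟩
  · refine pos hd ?_
    simp only [Pi.neg_apply]
    linear_combination -hd'

/-- Determinant 1 forces the representatives of a and b to change sign together, so ±(v + w) is well
defined. Hence the other triangle on the edge ab is oriented the opposite way, which is coherence.
-/
theorem unique {K : Type*} [Field K] (h2 : (2 : K) ≠ 0) {a b c d : PMVector 2 K}
    (h : triOrientation K a b c) (h' : triOrientation K a b d) : c = d := by
  obtain ⟨v, w, ha, hb, hc, hd⟩ := h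
  obtain ⟨v', w', ha', hb', hc', hd'⟩ := h'
  rw [ha, pmSet_eq_iff] at ha'
  rw [hb, pmSet_eq_iff] at hb'
  have pos : ∀ {v w : Fin 2 → K}, v 0 * w 1 - w 0 * v 1 = 1 → v 0 * w 1 - w 0 * v 1 = -1 →
      False := fun h h' => h2 (by linear_combination h' - h)
  refine Subtype.ext ?_
  rw [hc, hc', pmSet_eq_iff]
  rcases ha' with ha' | ha' <;> rcases hb' with hb' | hb' <;> subst ha' <;> subst hb'
  · exact Or.inl rfl
  · refine (pos hd ?_).elim
    simp only [Pi.neg_apply]; linear_combination -hd'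
  · refine (pos hd ?_).elim
    simp only [Pi.neg_apply]; linear_combination -hd'
  · exact Or.inr (by abel)

theorem isCoherentOrientation {K : Type*} [Field K] (h2 : (2 : K) ≠ 0) :
    IsCoherentOrientation (BDA 2 K) (triOrientation K) where
  cyclic _ _ _ _ h := h.cyclic
  alternating a b c h := by
    constructor
    · exact fun h1 h2' => asymm h2 h2' h1
    · exact fun h1 => (of_isTriangle h).resolve_left h1
  coherent a b c d _ hd hcd h := by
    rcases of_isTriangle hd with h' | h'
    · exact absurd (unique h2 h h') hcd
    · exact h'

end triOrientation

/-! ## Counting simplices -/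

/-- Each fibre of f is a translate g · k(T), so all fibres have as many elements as T. Here k lists
the stabilizer of a simplex. -/
theorem card_eq_ncard_range_mul {G X T : Type*} [Group G] (f : G → X) (k : T → G)
    (hk : Function.Injective k) (h : ∀ g g', f g = f g' ↔ ∃ t, g' = g * k t) :
    Nat.card G = (Set.range f).ncard * Nat.card T := by
  rw [← Nat.card_coe_set_eq, ← Nat.card_prod]
  refine (Nat.card_congr (Equiv.ofBijective
    (fun y : Set.range f × T => y.1.2.choose * k y.2) ⟨?_, ?_⟩)).symm
  · rintro ⟨y, t⟩ ⟨y', t'⟩ e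
    have hf : ∀ (y : Set.range f) t, f (y.2.choose * k t) = y := fun y t =>
      ((h _ _).2 ⟨t, rfl⟩).symm.trans y.2.choose_spec
    have hy : y = y' := Subtype.ext (by rw [← hf y t, ← hf y' t']; exact congrArg f e)
    subst hy
    exact Prod.ext rfl (hk (mul_left_cancel e))
  · intro g
    have := (⟨f g, g, rfl⟩ : Set.range f).2.choose_spec
    obtain ⟨t, ht⟩ := (h _ _).1 this
    exact ⟨(⟨f g, g, rfl⟩, t), ht.symm⟩

theorem SL_neg_ne {R : Type*} [CommRing R] (h2 : ∀ x : R, 2 * x = 0 → x = 0) [Nontrivial R]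
    (g : SL(2, R)) : g ≠ -g := by
  intro h
  have h0 : ∀ k, triVec g k = - triVec g k := fun k => by rw [← triVec_neg, ← h]
  refine triVec_ne_zero g 0 ?_
  ext i
  refine h2 _ ?_
  have := congrFun (h0 0) i
  simp only [Pi.neg_apply] at this
  linear_combination this

theorem card_SL_eq_of_pm {K T X : Type*} [Field K] (h2 : (2 : K) ≠ 0) (f : SL(2, K) → X)
    (k : T → SL(2, K)) (hk : ∀ t t', (k t = k t' ∨ k t = - k t') → t = t')
    (h : ∀ g g', f g = f g' ↔ ∃ t, g' = g * k t ∨ g' = -(g * k t)) :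
    Nat.card SL(2, K) = (Set.range f).ncard * (2 * Nat.card T) := by
  have hcard : 2 * Nat.card T = Nat.card (Bool × T) := by simp [Nat.card_prod]
  rw [hcard]
  refine card_eq_ncard_range_mul f (fun t => cond t.1 (k t.2) (-(k t.2))) ?_ ?_
  · have hne := SL_neg_ne (R := K) fun x hx => (mul_eq_zero.1 hx).resolve_left h2
    rintro ⟨b, t⟩ ⟨b', t'⟩ e
    cases b <;> cases b' <;> simp only [cond_true, cond_false] at e
    · rw [hk t t' (Or.inl (neg_injective e))]
    · have ht := hk t' t (Or.inr e.symm)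
      subst ht
      exact absurd e.symm (hne _)
    · have ht := hk t t' (Or.inr e)
      subst ht
      exact absurd e (hne _)
    · rw [hk t t' (Or.inl e)]
  · intro g g'
    rw [h]
    constructor
    · rintro ⟨t, ht | ht⟩
      · exact ⟨(true, t), ht⟩
      · exact ⟨(false, t), by simpa using ht⟩
    · rintro ⟨⟨b, t⟩, ht⟩
      refine ⟨t, ?_⟩
      cases b
      · exact Or.inr (by simpa using ht)
      · exact Or.inl ht

/-! ### Numbers of vertices, edges and triangles, and the genus -/

section Count

variable {p : ℕ} [Fact p.Prime]

theorem triVec_mul_upper_zero {R : Type*} [CommRing R] (g : SL(2, R)) (n : R) :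
    triVec (g * upper n) 0 = triVec g 0 := by
  rw [triVec_mul, (triVec_upper n).1]; rfl

theorem upper_injective {R : Type*} [CommRing R] : Function.Injective (upper : R → SL(2, R)) := by
  intro m n h
  have := congrArg (fun g : SL(2, R) => g 0 1) h
  simpa using this

/-- The first column can be any of the p² - 1 nonzero vectors, and each is attained by p matrices.
-/
theorem card_SL : Nat.card SL(2, ZMod p) = (p ^ 2 - 1) * p := by
  rw [card_eq_ncard_range_mul (fun g : SL(2, ZMod p) => triVec g 0) upper upper_injective]
  · have hr : Set.range (fun g : SL(2, ZMod p) => triVec g 0) = {0}ᶜ := by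
      ext v
      constructor
      · rintro ⟨g, rfl⟩
        exact triVec_ne_zero g 0
      · exact fun hv => exists_tri_of_ne_zero hv
    rw [hr, Set.ncard_compl, Set.ncard_singleton]
    simp
  · intro g g'
    constructor
    · exact eq_upper_of_triVec_zero_eq
    · rintro ⟨n, rfl⟩
      exact (triVec_mul_upper_zero g n).symm

theorem triVertex_neg {R : Type*} [CommRing R] [Nontrivial R] (g : SL(2, R)) (k : Fin 3) :
    triVertex (-g) k = triVertex g k :=
  triVertex_eq_iff.2 (Or.inr (triVec_neg g k))

theorem triVertex_mul_eq_iff {R : Type*} [CommRing R] [Nontrivial R] {g h h' : SL(2, R)}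
    {k l : Fin 3} : triVertex (g * h) k = triVertex (g * h') l ↔
      triVertex h k = triVertex h' l := by
  rw [triVertex_eq_iff, triVertex_eq_iff, triVec_mul, triVec_mul, ← Matrix.mulVec_neg]
  have hinj : Function.Injective (fun v => g.1 *ᵥ v) := by
    intro a b h
    have h' := congrArg (fun v => g⁻¹.1 *ᵥ v) h
    simpa only [Matrix.mulVec_mulVec, ← Matrix.SpecialLinearGroup.coe_mul, inv_mul_cancel,
      Matrix.SpecialLinearGroup.coe_one, Matrix.one_mulVec] using h'
  exact or_congr hinj.eq_iff hinj.eq_iff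

theorem triVertex_zero_eq_iff {R : Type*} [CommRing R] [Nontrivial R] {g g' : SL(2, R)} :
    triVertex g 0 = triVertex g' 0 ↔ ∃ n, g' = g * upper n ∨ g' = -(g * upper n) := by
  constructor
  · intro h
    rcases triVertex_eq_iff.1 h with h | h
    · obtain ⟨n, hn⟩ := eq_upper_of_triVec_zero_eq h
      exact ⟨n, Or.inl hn⟩
    · rw [← triVec_neg] at h
      obtain ⟨n, hn⟩ := eq_upper_of_triVec_zero_eq h
      exact ⟨n, Or.inr (by rw [← hn, neg_neg])⟩
  · rintro ⟨n, rfl | rfl⟩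
    · exact triVertex_eq_iff.2 (Or.inl (triVec_mul_upper_zero g n).symm)
    · rw [triVertex_neg]
      exact triVertex_eq_iff.2 (Or.inl (triVec_mul_upper_zero g n).symm)

theorem pmSet_eq_pmSet_one_iff (hp : 2 < p) {m n : ZMod p} :
    (![m, 1] = ![n, (1 : ZMod p)] ∨ ![m, 1] = -![n, (1 : ZMod p)]) ↔ m = n := by
  have h2 : Fact (2 < p) := ⟨hp⟩
  have h1 : (1 : ZMod p) ≠ -1 := (ZMod.neg_one_ne_one).symm
  simp [h1]

theorem triVertex_upper_eq_iff (hp : 2 < p) (n : ZMod p) :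
    (triVertex (upper n) 1 = triVertex 1 1 ↔ n = 0) ∧
    (triVertex (upper n) 1 = triVertex 1 2 ↔ n = 1) ∧
    (triVertex (upper n) 2 = triVertex 1 1 ↔ n + 1 = 0) ∧
    (triVertex (upper n) 2 = triVertex 1 2 ↔ n + 1 = 1) := by
  obtain ⟨-, h1, h2⟩ := triVec_upper n
  obtain ⟨-, k1, k2⟩ := triVec_upper (0 : ZMod p)
  rw [upper_zero] at k1 k2
  rw [zero_add] at k2
  simp only [triVertex_eq_iff, h1, h2, k1, k2, pmSet_eq_pmSet_one_iff hp, and_self]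

theorem triVertex_rot {R : Type*} [CommRing R] [Nontrivial R] (g : SL(2, R)) (k : Fin 3) :
    triVertex (g * rot R) k = triVertex g (k + 1) := by
  have h : triVertex (rot R) k = triVertex 1 (k + 1) := by
    obtain ⟨h0, h1, h2⟩ := triVec_rot (R := R)
    rw [triVertex_eq_iff]
    have e : ∀ k, triVec (1 : SL(2, R)) k = baseVec R k := fun k => by simp [triVec]
    rw [e]
    fin_cases k
    · exact Or.inl h0
    · exact Or.inr h1
    · exact Or.inr h2
  have := (triVertex_mul_eq_iff (g := g)).2 h
  rwa [mul_one] at this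

theorem triVertex_rot_pow {R : Type*} [CommRing R] [Nontrivial R] (g : SL(2, R)) (k l : Fin 3) :
    triVertex (g * rot R ^ (l : ℕ)) k = triVertex g (k + l) := by
  fin_cases l
  · simp
  · simpa using triVertex_rot g k
  · have h := triVertex_rot (g * rot R) k
    rw [mul_assoc, ← pow_two, triVertex_rot, add_assoc] at h
    exact h

open Classical in
/-- The vertices, edges and triangles attached to `g`. -/
def triFace {R : Type*} [CommRing R] [Nontrivial R] (S : Finset (Fin 3)) (g : SL(2, R)) :
    Finset (PMVector 2 R) := S.image (triVertex g)

theorem mem_triFace {R : Type*} [CommRing R] [Nontrivial R] {S : Finset (Fin 3)} {g : SL(2, R)}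
    {x : PMVector 2 R} : x ∈ triFace S g ↔ ∃ k ∈ S, triVertex g k = x := by
  simp [triFace]

theorem card_triFace {R : Type*} [CommRing R] [Nontrivial R] (h2 : (2 : R) ≠ 0)
    (S : Finset (Fin 3)) (g : SL(2, R)) : (triFace S g).card = S.card := by
  classical
  rw [triFace, Finset.card_image_of_injective _ (triVertex_injective h2 g)]

theorem triFace_neg {R : Type*} [CommRing R] [Nontrivial R] (S : Finset (Fin 3)) (g : SL(2, R)) :
    triFace S (-g) = triFace S g := by
  ext x; simp only [mem_triFace, triVertex_neg]

theorem card_vertices (hp : 2 < p) :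
    Nat.card SL(2, ZMod p) = (Set.range (triFace (R := ZMod p) {0})).ncard * (2 * p) := by
  have h := card_SL_eq_of_pm (ZMod.two_ne_zero_of_lt hp) (triFace (R := ZMod p) {0}) upper ?_ ?_
  · rwa [Nat.card_zmod] at h
  · rintro m n (h | h)
    · exact upper_injective h
    · have := congrArg (fun g : SL(2, ZMod p) => g 0 0) h
      have h2 : Fact (2 < p) := ⟨hp⟩
      have h1 : (1 : ZMod p) ≠ -1 := (ZMod.neg_one_ne_one).symm
      simp [h1] at this
  · intro g g'
    rw [← triVertex_zero_eq_iff]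
    simp [triFace]

/-- The element of order four exchanging the two coordinate lines. -/
def quarterTurn (R : Type*) [CommRing R] : SL(2, R) := ⟨!![0, -1; 1, 0], by simp [Matrix.det_fin_two]⟩

@[simp]
theorem coe_quarterTurn (R : Type*) [CommRing R] :
    (quarterTurn R : Matrix (Fin 2) (Fin 2) R) = !![0, -1; 1, 0] := rfl

theorem triVertex_quarterTurn {R : Type*} [CommRing R] [Nontrivial R] (g : SL(2, R)) :
    triVertex (g * quarterTurn R) 0 = triVertex g 1 ∧ triVertex (g * quarterTurn R) 1 = triVertex g 0 := by
  have h0 : triVertex (quarterTurn R) 0 = triVertex 1 1 := by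
    rw [triVertex_eq_iff]; left; ext i; fin_cases i <;> simp [triVec, baseVec, Matrix.mulVec, dotProduct]
  have h1 : triVertex (quarterTurn R) 1 = triVertex 1 0 := by
    rw [triVertex_eq_iff]; right; ext i; fin_cases i <;> simp [triVec, baseVec, Matrix.mulVec, dotProduct]
  have e0 := (triVertex_mul_eq_iff (g := g)).2 h0
  have e1 := (triVertex_mul_eq_iff (g := g)).2 h1
  rw [mul_one] at e0 e1
  exact ⟨e0, e1⟩

/-- An ordered edge determines the matrix up to sign: the first vertex leaves only ± an upper
unipotent factor, and the second makes that factor trivial. -/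
theorem eq_or_eq_neg_of_edge (hp : 2 < p) {g g' : SL(2, ZMod p)}
    (h0 : triVertex g 0 = triVertex g' 0) (h1 : triVertex g' 1 = triVertex g 1) :
    g' = g ∨ g' = -g := by
  obtain ⟨n, hn⟩ := triVertex_zero_eq_iff.1 h0
  have e : triVertex g' 1 = triVertex (g * upper n) 1 := by
    rcases hn with rfl | rfl
    · rfl
    · rw [triVertex_neg]
  rw [e] at h1
  have h1' : triVertex (g * upper n) 1 = triVertex (g * 1) 1 := by rw [h1, mul_one]
  rw [triVertex_mul_eq_iff, (triVertex_upper_eq_iff hp n).1] at h1'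
  subst h1'
  simpa [upper_zero] using hn

/-- The stabilizer of the base edge has the four elements ±1 and ±`quarterTurn`. -/
theorem card_edges (hp : 2 < p) :
    Nat.card SL(2, ZMod p) = (Set.range (triFace (R := ZMod p) {0, 1})).ncard * 4 := by
  have h2 := ZMod.two_ne_zero_of_lt hp
  have h := card_SL_eq_of_pm h2 (triFace (R := ZMod p) {0, 1})
    (fun b : Bool => cond b (quarterTurn (ZMod p)) 1) ?_ ?_
  · simpa using h
  · have h3 : triVertex (quarterTurn (ZMod p)) 0 ≠ triVertex 1 0 := by
      have h := (triVertex_quarterTurn (1 : SL(2, ZMod p))).1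
      rw [one_mul] at h
      rw [h]
      exact fun e => by simpa using triVertex_injective h2 _ e
    have key : ∀ b b', (cond b (quarterTurn (ZMod p)) 1 = cond b' (quarterTurn (ZMod p)) 1 ∨
        cond b (quarterTurn (ZMod p)) 1 = - cond b' (quarterTurn (ZMod p)) 1) →
        triVertex (cond b (quarterTurn (ZMod p)) 1) 0 = triVertex (cond b' (quarterTurn (ZMod p)) 1) 0 := by
      rintro b b' (h | h) <;> rw [h]
      exact triVertex_neg _ _
    intro b b' hb
    have := key b b' hb
    cases b <;> cases b'
    · rfl
    · exact absurd this.symm h3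
    · exact absurd this h3
    · rfl
  · intro g g'
    constructor
    · intro h
      have m0 : triVertex g' 0 ∈ triFace {0, 1} g := h ▸ mem_triFace.2 ⟨0, by simp, rfl⟩
      have m1 : triVertex g' 1 ∈ triFace {0, 1} g := h ▸ mem_triFace.2 ⟨1, by simp, rfl⟩
      have hne : triVertex g' 0 ≠ triVertex g' 1 := fun e => by
        simpa using triVertex_injective h2 _ e
      simp only [mem_triFace, Finset.mem_insert, Finset.mem_singleton, exists_eq_or_imp,
        exists_eq_left] at m0 m1
      obtain ⟨s0, s1⟩ := triVertex_quarterTurn g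
      rcases m0 with m0 | m0 <;> rcases m1 with m1 | m1
      · exact absurd (m0.symm.trans m1) hne
      · exact ⟨false, by simpa using eq_or_eq_neg_of_edge hp m0 m1.symm⟩
      · exact ⟨true, eq_or_eq_neg_of_edge hp (s0.trans m0) (m1.symm.trans s1.symm)⟩
      · exact absurd (m0.symm.trans m1) hne
    · have key : ∀ b, triFace {0, 1} g = triFace {0, 1} (g * cond b (quarterTurn (ZMod p)) 1) := by
        intro b
        cases b
        · simp
        · obtain ⟨s0, s1⟩ := triVertex_quarterTurn g
          ext x
          simp only [mem_triFace, Finset.mem_insert, Finset.mem_singleton, exists_eq_or_imp,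
            exists_eq_left, cond_true, s0, s1]
          exact or_comm
      rintro ⟨b, rfl | rfl⟩
      · exact key b
      · rw [triFace_neg]; exact key b

/-- The stabilizer of the base triangle has order 6, consisting of ± the powers of `rot`. -/
theorem card_triangles (hp : 2 < p) :
    Nat.card SL(2, ZMod p) = (Set.range (triFace (R := ZMod p) Finset.univ)).ncard * 6 := by
  have h2 := ZMod.two_ne_zero_of_lt hp
  have h := card_SL_eq_of_pm h2 (triFace (R := ZMod p) Finset.univ)
    (fun k : Fin 3 => rot (ZMod p) ^ (k : ℕ)) ?_ ?_
  · simpa using h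
  · have hv : ∀ k : Fin 3, triVertex (rot (ZMod p) ^ (k : ℕ)) 0 = triVertex 1 k := by
      intro k
      have := triVertex_rot_pow (1 : SL(2, ZMod p)) 0 k
      rwa [one_mul, zero_add] at this
    intro k l hkl
    refine triVertex_injective h2 1 ?_
    rw [← hv, ← hv]
    rcases hkl with h | h
    · rw [h]
    · rw [h, triVertex_neg]
  · intro g g'
    constructor
    · intro h
      have m : ∀ k, ∃ l, triVertex g l = triVertex g' k := by
        intro k
        have : triVertex g' k ∈ triFace Finset.univ g := h ▸ mem_triFace.2 ⟨k, by simp, rfl⟩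
        simpa [mem_triFace] using this
      obtain ⟨l, hl⟩ := m 0
      refine ⟨l, ?_⟩
      set q := g * rot (ZMod p) ^ (l : ℕ) with hq
      have hqv : ∀ k, triVertex q k = triVertex g (k + l) := by
        intro k; rw [hq, triVertex_rot_pow]
      have h0 : triVertex q 0 = triVertex g' 0 := by rw [hqv, zero_add, hl]
      have m' : ∀ k, ∃ j, triVertex g' k = triVertex q j := by
        intro k
        obtain ⟨j, hj⟩ := m k
        exact ⟨j - l, by rw [hqv, sub_add_cancel, hj]⟩
      refine eq_or_eq_neg_of_edge hp h0 ?_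
      obtain ⟨n, hn⟩ := triVertex_zero_eq_iff.1 h0
      have e : ∀ k, triVertex g' k = triVertex (q * upper n) k := by
        intro k
        rcases hn with hn | hn
        · rw [hn]
        · rw [hn, triVertex_neg]
      have m'' : ∀ k ≠ 0, triVertex (upper n) k = triVertex 1 1 ∨
          triVertex (upper n) k = triVertex 1 2 := by
        intro k hk
        obtain ⟨j, hj⟩ := m' k
        have hj0 : j ≠ 0 := by
          rintro rfl
          rw [h0] at hj
          exact hk (triVertex_injective h2 _ hj)
        have hj' : triVertex (upper n) k = triVertex 1 j := by
          rw [← triVertex_mul_eq_iff (g := q), ← e, hj, mul_one]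
        fin_cases j
        · exact absurd rfl hj0
        · exact Or.inl hj'
        · exact Or.inr hj'
      obtain ⟨t11, t12, t21, t22⟩ := triVertex_upper_eq_iff hp n
      have c1 := m'' 1 (by decide)
      have c2 := m'' 2 (by decide)
      rw [t11, t12] at c1
      rw [t21, t22] at c2
      -- Both n and n + 1 lie in {0, 1}; since 2 ≠ 0, this leaves only n = 0.
      have hn0 : n = 0 := by
        rcases c1 with c1 | c1
        · exact c1
        · rcases c2 with c2 | c2
          · exact absurd (by rw [c1] at c2; linear_combination c2) h2
          · linear_combination c2
      rw [e, hn0, upper_zero, mul_one]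
    · have key : ∀ l : Fin 3, triFace Finset.univ g =
          triFace Finset.univ (g * rot (ZMod p) ^ (l : ℕ)) := by
        intro l
        ext x
        simp only [mem_triFace, Finset.mem_univ, true_and, triVertex_rot_pow]
        constructor
        · rintro ⟨k, rfl⟩
          exact ⟨k - l, by rw [sub_add_cancel]⟩
        · rintro ⟨k, rfl⟩
          exact ⟨_, rfl⟩
      rintro ⟨l, rfl | rfl⟩
      · exact key l
      · rw [triFace_neg]; exact key l

theorem BDA_faces_eq : (BDA 2 (ZMod p)).faces = Set.range (triFace (R := ZMod p) {0}) ∪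
    (Set.range (triFace (R := ZMod p) {0, 1}) ∪ Set.range (triFace (R := ZMod p) Finset.univ)) := by
  ext s
  rw [mem_BDA_faces_iff]
  constructor
  · rintro ⟨hne, g, hg⟩
    classical
    obtain ⟨S, hS⟩ : ∃ S, s = triFace S g := by
      refine ⟨Finset.univ.filter fun k => triVertex g k ∈ s, ?_⟩
      ext x
      simp only [mem_triFace, Finset.mem_filter, Finset.mem_univ, true_and]
      constructor
      · intro hx
        obtain ⟨k, rfl⟩ := hg x hx
        exact ⟨k, hx, rfl⟩
      · rintro ⟨k, hk, rfl⟩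
        exact hk
    have hrot : ∀ (T : Finset (Fin 3)) (l : Fin 3), triFace (T.image (· + l)) g =
        triFace T (g * rot (ZMod p) ^ (l : ℕ)) := by
      intro T l
      ext x
      simp only [mem_triFace, triVertex_rot_pow, Finset.exists_mem_image]
    -- Cyclic shifts bring every nonempty set of vertices to {0}, {0, 1} or the whole triangle.
    have hcases : ∀ S : Finset (Fin 3), S.Nonempty → ∃ l : Fin 3,
        S = Finset.image (· + l) {0} ∨ S = Finset.image (· + l) {0, 1} ∨ S = Finset.univ := by
      decide
    have hSne : S.Nonempty := by
      rw [hS] at hne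
      obtain ⟨x, hx⟩ := hne
      obtain ⟨k, hk, -⟩ := mem_triFace.1 hx
      exact ⟨k, hk⟩
    obtain ⟨l, h | h | h⟩ := hcases S hSne
    · left; exact ⟨_, by rw [hS, h, hrot]⟩
    · right; left; exact ⟨_, by rw [hS, h, hrot]⟩
    · right; right; exact ⟨g, by rw [hS, h]⟩
  · have key : ∀ (S : Finset (Fin 3)) (g : SL(2, ZMod p)), S.Nonempty →
        (triFace S g).Nonempty ∧ ∃ h : SL(2, ZMod p), ∀ x ∈ triFace S g, ∃ k, x = triVertex h k := by
      intro S g hS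
      refine ⟨hS.elim fun k hk => ⟨_, mem_triFace.2 ⟨k, hk, rfl⟩⟩, g, fun x hx => ?_⟩
      obtain ⟨k, -, hk⟩ := mem_triFace.1 hx
      exact ⟨k, hk.symm⟩
    rintro (⟨g, rfl⟩ | ⟨g, rfl⟩ | ⟨g, rfl⟩)
    · exact key _ g (by simp)
    · exact key _ g (by simp)
    · exact key _ g (by simp)

theorem eulerChar_BDA (hp : 2 < p) : eulerChar (BDA 2 (ZMod p)) =
    (Set.range (triFace (R := ZMod p) {0})).ncard -
      (Set.range (triFace (R := ZMod p) {0, 1})).ncard +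
      (Set.range (triFace (R := ZMod p) Finset.univ)).ncard := by
  have h2 := ZMod.two_ne_zero_of_lt hp
  have hconst : ∀ S : Finset (Fin 3), ∑ᶠ s ∈ Set.range (triFace (R := ZMod p) S),
      (-1 : ℤ) ^ (s.card + 1) = (-1) ^ (S.card + 1) * (Set.range (triFace (R := ZMod p) S)).ncard := by
    intro S
    have hfin := Set.toFinite (Set.range (triFace (R := ZMod p) S))
    rw [finsum_mem_eq_finite_toFinset_sum _ hfin, Finset.sum_congr rfl (g := fun _ =>
      (-1 : ℤ) ^ (S.card + 1)), Finset.sum_const, ← Set.ncard_eq_toFinset_card]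
    · rw [nsmul_eq_mul, mul_comm]
    · intro s hs
      obtain ⟨g, rfl⟩ := (Set.Finite.mem_toFinset _).1 hs
      rw [card_triFace h2]
  have hdisj : ∀ S T : Finset (Fin 3), S.card ≠ T.card →
      Disjoint (Set.range (triFace (R := ZMod p) S)) (Set.range (triFace (R := ZMod p) T)) := by
    intro S T hST
    rw [Set.disjoint_left]
    rintro _ ⟨g, rfl⟩ ⟨g', h⟩
    have := congrArg Finset.card h
    rw [card_triFace h2, card_triFace h2] at this
    exact hST this.symm
  rw [eulerChar, BDA_faces_eq, finsum_mem_union _ (Set.toFinite _) (Set.toFinite _),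
    finsum_mem_union _ (Set.toFinite _) (Set.toFinite _), hconst, hconst, hconst]
  · simp
    ring
  · exact hdisj _ _ (by decide)
  · rw [Set.disjoint_union_right]
    exact ⟨hdisj _ _ (by decide), hdisj _ _ (by decide)⟩

/-- The counts are V = (p² - 1)/2, E = p(p² - 1)/4 and F = p(p² - 1)/6. The rest is divisibility,
needed to obtain an integer genus. -/
theorem exists_genus (hp : 2 < p) : ∃ g : ℕ,
    24 * (g : ℤ) = ((p : ℤ) + 2) * ((p : ℤ) - 3) * ((p : ℤ) - 5) ∧
      eulerChar (BDA 2 (ZMod p)) = 2 - 2 * (g : ℤ) := by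
  have h1 := card_vertices (p := p) hp
  have h2 := card_edges (p := p) hp
  have h3 := card_triangles (p := p) hp
  have he := eulerChar_BDA (p := p) hp
  rw [card_SL] at h1 h2 h3
  generalize (Set.range (triFace (R := ZMod p) {0})).ncard = a at *
  generalize (Set.range (triFace (R := ZMod p) {0, 1})).ncard = b at *
  generalize (Set.range (triFace (R := ZMod p) Finset.univ)).ncard = c at *
  rw [he]
  -- Since p is odd, p² - 1 = 8r with r the triangular number m(m + 1)/2.
  obtain ⟨m, hm⟩ : ∃ m, p = 2 * m + 1 := by
    have := (Fact.out : p.Prime).eq_two_or_odd'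
    exact this.resolve_left (by omega)
  obtain ⟨r, hr⟩ : ∃ r, m * (m + 1) = 2 * r := (Nat.even_mul_succ_self m).exists_two_nsmul _ |>.imp
    fun r hr => by simpa using hr
  have hp2 : p ^ 2 - 1 = 8 * r := by
    have : p ^ 2 = 8 * r + 1 := by rw [hm]; linarith [hr, show (2 * m + 1) ^ 2 = 4 * (m * (m + 1)) + 1 by ring]
    omega
  have hrp : (p : ℤ) ^ 2 - 1 = 8 * r := by
    have : p ^ 2 = 8 * r + 1 := by
      have : 1 ≤ p ^ 2 := Nat.one_le_pow _ _ (by omega)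
      omega
    have : (p : ℤ) ^ 2 = 8 * r + 1 := by exact_mod_cast this
    linarith
  rw [hp2] at h1 h2 h3
  have ha : a = 4 * r := by
    have : a * (2 * p) = (4 * r) * (2 * p) := by rw [← h1]; ring
    exact Nat.eq_of_mul_eq_mul_right (by omega) this
  have hb : b = 2 * (r * p) := by nlinarith
  obtain ⟨d, hd⟩ : ∃ d, c = 4 * d := by
    have h6 : 3 * c = 4 * (r * p) := by nlinarith
    have : 4 ∣ c := (Nat.Coprime.dvd_mul_left (by norm_num : Nat.Coprime 4 3)).1 ⟨_, h6⟩
    exact this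
  have hc : 3 * d = r * p := by nlinarith
  -- This solves V - E + F = 2 - 2e for V = 4r, E = 2rp and F = 4d.
  set e : ℤ := 1 - 2 * r + r * p - 2 * d with hedef
  have hc' : 3 * (d : ℤ) = r * p := by exact_mod_cast hc
  have h24 : 24 * e = ((p : ℤ) + 2) * ((p : ℤ) - 3) * ((p : ℤ) - 5) := by
    rw [hedef]
    linear_combination (-16) * hc' + (6 - (p : ℤ)) * hrp
  -- The product (p - 3)(p - 5) is negative only for p = 4, which is not odd.
  have hpos : 0 ≤ e := by
    have hp3 : (3 : ℤ) ≤ p := by exact_mod_cast hp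
    have : 0 ≤ ((p : ℤ) - 3) * ((p : ℤ) - 5) := by
      by_cases h5 : (5 : ℤ) ≤ p
      · exact mul_nonneg (by linarith) (by linarith)
      · have : p = 3 := by omega
        subst this; norm_num
    nlinarith
  refine ⟨e.toNat, ?_, ?_⟩
  · rw [Int.toNat_of_nonneg hpos, h24]
  · rw [Int.toNat_of_nonneg hpos, hedef, ha, hb, hd]
    push_cast
    ring

end Count

end

noncomputable section

open Matrix

/-! ## The full simplex -/

theorem Realization.contractibleSpace_of_faces_eq {ι : Type*} [Finite ι] [Nonempty ι]
    {K : PreAbstractSimplicialComplex ι} (h : ∀ s : Finset ι, s.Nonempty → s ∈ K.faces) :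
    ContractibleSpace (Realization K) := by
  classical
  have := Fintype.ofFinite ι
  have hemb := Realization.isClosedEmbedding_coords K.faces.toFinite
  have hr : Set.range (fun (x : Realization K) (i : ι) => x.1 i) = stdSimplex ℝ ι := by
    ext y
    constructor
    · rintro ⟨x, rfl⟩
      refine ⟨x.2.2.1, ?_⟩
      exact (Finsupp.sum_fintype x.1 (fun _ t => t) fun _ => rfl).symm.trans x.2.2.2
    · rintro ⟨h0, h1⟩
      refine ⟨⟨Finsupp.equivFunOnFinite.symm y, h _ ?_, h0, ?_⟩, rfl⟩
      · rw [Finset.nonempty_iff_ne_empty, Ne, Finsupp.support_eq_empty]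
        intro e
        have hy : ∀ i, y i = 0 := fun i => DFunLike.congr_fun e i
        simp [hy] at h1
      · rw [Finsupp.sum_fintype _ _ fun _ => rfl]
        exact h1
  have : ContractibleSpace (stdSimplex ℝ ι) :=
    (convex_stdSimplex ℝ ι).contractibleSpace ⟨_, single_mem_stdSimplex ℝ (Classical.arbitrary ι)⟩
  exact (hemb.isEmbedding.toHomeomorph.trans (Homeomorph.setCongr hr)).contractibleSpace

/-- The three nonzero vectors of 𝔽₂² are the base vectors, so every nonempty set of ±-vectors is a
face of the base triangle. -/
theorem contractibleSpace_realization_two : ContractibleSpace (Realization (BDA 2 (ZMod 2))) := by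
  have : Nonempty (PMVector 2 (ZMod 2)) := ⟨triVertex 1 0⟩
  refine Realization.contractibleSpace_of_faces_eq fun s hs => mem_BDA_faces_iff.2 ⟨hs, 1, ?_⟩
  rintro ⟨x, v, hv, rfl⟩ -
  have hb : ∀ v : Fin 2 → ZMod 2, v ≠ 0 → ∃ k, v = baseVec (ZMod 2) k := by decide
  obtain ⟨k, rfl⟩ := hb v hv
  exact ⟨k, Subtype.ext (by simp [triVertex, triVec])⟩

theorem isClosedOrientedSurface_realization {p : ℕ} [Fact p.Prime] (hp : 2 < p) {g : ℕ}
    (h : eulerChar (BDA 2 (ZMod p)) = 2 - 2 * (g : ℤ)) :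
    IsClosedOrientedSurface g (Realization (BDA 2 (ZMod p))) where
  compact := Realization.compactSpace BDA_faces_finite
  connected := connectedSpace_realization hp
  hausdorff := inferInstance
  locallyEuclidean := locallyEuclidean_realization hp
  oriented_genus := ⟨PMVector 2 (ZMod p), BDA 2 (ZMod p), BDA_faces_finite, ⟨Homeomorph.refl _⟩,
    ⟨_, triOrientation.isCoherentOrientation (ZMod.two_ne_zero_of_lt hp)⟩, h⟩

end

theorem lemma2p10 :
    (∀ p : ℕ, p.Prime → 3 ≤ p →
      (∃ g : ℕ, 24 * (g : ℤ) = ((p : ℤ) + 2) * ((p : ℤ) - 3) * ((p : ℤ) - 5) ∧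
        IsClosedOrientedSurface g (Realization (BDA 2 (ZMod p)))) ∧
      Nonempty (Realization (BDA 2 (ZMod p)) ≃ₜ ModularCurve p)) ∧
    ContractibleSpace (Realization (BDA 2 (ZMod 2))) := by
  refine ⟨fun p hprime hp => ?_, contractibleSpace_realization_two⟩
  have : Fact p.Prime := ⟨hprime⟩
  obtain ⟨g, hg, hχ⟩ := exists_genus (p := p) hp
  exact ⟨⟨g, hg, isClosedOrientedSurface_realization hp hχ⟩, ⟨realizationHomeo hp⟩⟩
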